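/- **Setting.** All algorithms are probabilistic and receive the security parameter $\lambda$ in unary; PPT means probabilistic polynomial time, a function of $\lambda$ is negligible if it decays faster than every inverse polynomial, and computational indistinguishability ($\approxeq$) is with respect to PPT distinguishers with polynomial-length advice. Let $N=pq$ be a Paillier modulus ($p\ne q$ primes with at least $\lambda$ and at most polynomially many bits, $\gcd(N,(p-1)(q-1))=1$) drawn by a key generation algorithm; $pk=N$ and $sk=(p,q)$. Let $\mathsf{Enc}(m)=(1+N)^m\rho^N \bmod N^2$ for $m\in\mathbb Z_N$ be Paillier encryption and $\mathsf E^2(m)=(1+N)^m\rho^{N^2}\bmod N^3$ for $m\in\mathbb Z_{N^2}$ be Damgård–Jurik encryption, with $\rho\in\mathbb Z_N^*$ uniform. Let $F$ be a function family with $\lambda$-bit keys and $\ell(\lambda)$-bit values, where $\ell(\lambda)\ge\lambda$ is polynomially bounded, and let $s\ge 1$. For an object $o$ put $\mathsf{EHL}(o)=\big(\mathsf{Enc}(F_{\kappa_i}(o)\bmod N)\big)_{1\le i\le s}$, and $\mathsf{EHL}(x)\ominus\mathsf{EHL}(y)=\prod_i(\mathsf{EHL}(x)[i]\cdot\mathsf{EHL}(y)[i]^{-1})^{r_i}$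 with uniform $r_i\in\mathbb Z_N$. A relation consists of $M$ lists of $n$ items $(o,x)$ (object, score) and has polynomial size. Its encryption $\mathsf{ER}$ consists of the $E(I)=\langle\mathsf{EHL}(o),\mathsf{Enc}(x)\rangle$ for all items $I=(o,x)$, with common uniform hash keys $\kappa_1,\dots,\kappa_s$; $|\mathsf{ER}|=(n,M)$. A query selects $m+1$ of the lists. Fix a depth $d$ and one of these lists; let $I=(o,x)$ be its item at depth $d$, let $I_j=(o_j,x_j)$, $1\le j\le m$, be the items at depth $d$ of the other selected lists, and put $H=(E(I_j))_{j\le m}$, $|H|=m$. Server $S_1$ holds $pk$ and $\mathsf{ER}$ (in particular $E(I)$ and $H$), and $S_2$ holds $pk,sk$. **Protocols.** Every ciphertext sent from one server to the other is re-encrypted, that is, multiplied by a fresh encryption of $0$ under the same scheme (for freshly generated ciphertexts this changes nothing). * $\mathsf{RecoverEnc}(\mathsf E^2(\mathsf{Enc}(c)))$: $S_1$ picks $r\in\mathbb Z_N$ uniformly and an encryption $\mathsf{Enc}(r)$, and sends $\mathsf E^2(\mathsf{Enc}(c))^{\mathsf{Enc}(r)}$; $S_2$ decrypts the outer layer and returns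 the result $\mathsf{Enc}(c+r)$; $S_1$ outputs $\mathsf{Enc}(c+r)\cdot\mathsf{Enc}(r)^{-1}$. * $\mathsf{SecWorst}(E(I),H)$: $S_1$ picks a uniform permutation $\pi$ of $\{1,\dots,m\}$. For each $j$, $S_1$ sends $\mathsf{Enc}(b_j)=\mathsf{EHL}(o)\ominus\mathsf{EHL}(o_{\pi(j)})$; $S_2$ decrypts $b_j$ and returns $\mathsf E^2(t_j)$, where $t_j=1$ if $b_j=0$ and $t_j=0$ otherwise; $S_1$ computes $\mathsf E^2(t_j)^{\mathsf{Enc}(x_{\pi(j)})}\cdot(\mathsf E^2(1)\,\mathsf E^2(t_j)^{-1})^{\mathsf{Enc}(0)}$ and runs $\mathsf{RecoverEnc}$ on it with $S_2$ to get $\mathsf{Enc}(x'_j)$. The output of $S_1$ is $\prod_j\mathsf{Enc}(x'_j)$. The view $\mathsf{View}_{S_i}$ is the sequence of all messages that $S_i$ receives in a run, and $\mathsf{Output}$ is the output of $S_1$. **Statement.** Suppose that Paillier encryption with this key generation is CPA-secure and that $F$ is a pseudo-random function, both against PPT adversaries with polynomial-length advice. Let $W=\sum_{j:\,o_j=o}x_j$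 be the worst score of $o$ based on $H$. Let $\mathsf{EP}$ be the symmetric binary $(m+1)\times(m+1)$ matrix that records which of the objects $o,o_{\pi(1)},\dots,o_{\pi(m)}$ are equal, for a uniformly random permutation $\pi$. Then $\mathsf{SecWorst}$ privately realizes the worst-score functionality: there are PPT simulators $\mathsf{Sim}_{s_1},\mathsf{Sim}_{s_2}$ such that for all polynomial-size families of relations, queries, depths and lists as above, 1. $\big(\mathsf{Sim}_{s_2}(pk,|\mathsf{ER}|,|H|),\ \mathsf{Output}'\big)\approxeq\big(\mathsf{View}_{S_1},\ \mathsf{Output}\big)$, where $\mathsf{Output}'$ is the output of an independent execution of the protocol on the same input and the distinguisher is also given $pk$ and $\mathsf{ER}$; 2. $\mathsf{Sim}_{s_1}\big(pk,sk,|H|,\mathsf{EP}\big)\approxeq\mathsf{View}_{S_2}$, where the distinguisher is also given $pk$, $sk$ and $\mathsf{ER}$; 3. except with negligible probability, $\mathsf{Output}$ is a ciphertext that decrypts to $W \bmod N$. Likewise, for $\mathsf{RecoverEnc}$ on an input $Y=\mathsf E^2(\mathsf{Enc}(c))$ (fresh encryptions, $c\in\mathbb Z_N$) there are PPT simulators,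 one given only $pk$ and one given only $pk,sk$, with $(\mathsf{Sim}_{s_2}(pk),\mathsf{Output}')\approxeq(\mathsf{View}_{S_1},\mathsf{Output})$ for distinguishers that are also given $pk$ and $Y$, and $\mathsf{Sim}_{s_1}(pk,sk)\approxeq\mathsf{View}_{S_2}$ for distinguishers that are also given $pk,sk$ and $Y$; and, except with negligible probability, $\mathsf{Output}$ decrypts to $c$. -/

import Mathlib

namespace SecTopK

/-! ## Probabilistic polynomial-time algorithms, with an explicit step count -/

/-- The data that algorithms work on: binary trees whose leaves are natural numbers. -/
inductive Data where
  | nat (n : ℕ) : Data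
  | pair (a b : Data) : Data

namespace Data

/-- Length of an encoding: numbers are written in binary. -/
def size : Data → ℕ
  | nat n => Nat.size n + 1
  | pair a b => a.size + b.size + 1

def ofList : List Data → Data
  | [] => nat 0
  | a :: l => pair a (ofList l)

def ofFin {n : ℕ} (f : Fin n → Data) : Data := ofList (List.ofFn f)

/-- The number `n` in unary. -/
def unary (n : ℕ) : Data := ofList (List.replicate n (nat 0))

end Data

/-- Binary instructions on natural numbers. -/
inductive BinOp where
  | add | sub | mul | div | mod | lt | eq

def BinOp.eval : BinOp → ℕ → ℕ → ℕ
  | add, a, b => a + b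
  | sub, a, b => a - b
  | mul, a, b => a * b
  | div, a, b => a / b
  | mod, a, b => a % b
  | lt, a, b => if a < b then 1 else 0
  | eq, a, b => if a = b then 1 else 0

/-- Programs of a small randomised language with counted loops. Ill-formed operands give `0`. -/
inductive Prog where
  /-- `x ↦ x` -/
  | skip
  /-- `x ↦ n` -/
  | const (n : ℕ)
  /-- `(a, b) ↦ a` -/
  | fst
  /-- `(a, b) ↦ b` -/
  | snd
  /-- `x ↦ 1` if `x` is a pair, and `0` otherwise -/
  | isPair
  /-- `x ↦` the length of `x` -/
  | length
  /-- `(a, b) ↦ a o b` -/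
  | op (o : BinOp)
  /-- `(n, (a, b)) ↦ a ^ b mod n`, for `n ≠ 0` -/
  | powMod
  /-- `(n, a) ↦ a⁻¹ mod n` -/
  | invMod
  /-- `n ↦` a uniformly random element of `{0, …, n - 1}`, for `n ≠ 0` -/
  | rand
  /-- `n ↦ O(n)`, the answer of the oracle -/
  | query
  /-- `x ↦ (p x, q x)` -/
  | fork (p q : Prog)
  /-- `x ↦ q (p x)` -/
  | seq (p q : Prog)
  /-- `(c, x) ↦ p x` if `c ≠ 0`, and `q x` if `c = 0` -/
  | ite (p q : Prog)
  /-- `(n, x) ↦ p (p (… (p x)))`, with `n` rounds -/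
  | loop (p : Prog)

namespace Prog

/-- One instruction with operand `x` and result `y`. It is charged the cube of the length of its
operand, which covers the schoolbook algorithms, plus the length of the result. -/
noncomputable def instr (x y : Data) : PMF (Data × ℕ) := PMF.pure (y, x.size ^ 3 + y.size)

/-- Run `f` for `n` rounds and add up the costs (one unit of overhead per round). -/
noncomputable def rounds (f : Data → PMF (Data × ℕ)) : ℕ → Data → PMF (Data × ℕ)
  | 0, x => PMF.pure (x, 1)
  | n + 1, x => (f x).bind fun y => (rounds f n y.1).map fun z => (z.1, y.2 + z.2 + 1)

/-- The joint distribution of the result and of the number of steps of a program on an input, when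
queries are answered by `O`. -/
noncomputable def run (O : ℕ → ℕ) : Prog → Data → PMF (Data × ℕ)
  | skip, x => instr x x
  | const n, x => instr x (.nat n)
  | fst, x => instr x (match x with | .pair a _ => a | _ => .nat 0)
  | snd, x => instr x (match x with | .pair _ b => b | _ => .nat 0)
  | isPair, x => instr x (match x with | .pair _ _ => .nat 1 | _ => .nat 0)
  | length, x => instr x (.nat x.size)
  | op o, x => instr x (match x with
      | .pair (.nat a) (.nat b) => .nat (o.eval a b)
      | _ => .nat 0)
  | powMod, x => instr x (match x with
      | .pair (.nat n) (.pair (.nat a) (.nat b)) => .nat (if n = 0 then 0 else a ^ b % n)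
      | _ => .nat 0)
  | invMod, x => instr x (match x with
      | .pair (.nat n) (.nat a) => .nat (if n = 0 then 0 else ((a : ZMod n)⁻¹).val)
      | _ => .nat 0)
  | rand, x => match x with
      | .nat (n + 1) => (PMF.uniformOfFintype (Fin (n + 1))).bind fun i => instr x (.nat i)
      | _ => instr x (.nat 0)
  | query, x => instr x (match x with | .nat n => .nat (O n) | _ => .nat 0)
  | fork p q, x => (run O p x).bind fun y => (run O q x).map fun z =>
      (.pair y.1 z.1, y.2 + z.2 + x.size)
  | seq p q, x => (run O p x).bind fun y => (run O q y.1).map fun z => (z.1, y.2 + z.2 + 1)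
  | ite p q, x => match x with
      | .pair (.nat c) y => (if c ≠ 0 then run O p y else run O q y).map fun z =>
          (z.1, z.2 + x.size)
      | _ => instr x (.nat 0)
  | loop p, x => match x with
      | .pair (.nat n) y => (rounds (run O p) n y).map fun z => (z.1, z.2 + x.size)
      | _ => instr x (.nat 0)

/-- Distribution of the result with oracle `O`. -/
noncomputable def outO (O : ℕ → ℕ) (p : Prog) (x : Data) : PMF Data := (run O p x).map Prod.fst

/-- Distribution of the result of an ordinary algorithm (trivial oracle). -/
noncomputable def out (p : Prog) (x : Data) : PMF Data := outO (fun _ => 0) p x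

/-- Probabilistic polynomial time: for all random choices, the number of steps is bounded by a
polynomial in the length of the input (and, with an oracle, in the length of its answers). -/
def PPT (p : Prog) : Prop :=
  ∃ P : Polynomial ℕ, ∀ (O : ℕ → ℕ) (b : ℕ), (∀ n, Nat.size (O n) ≤ b) →
    ∀ x : Data, ∀ y ∈ (run O p x).support, y.2 ≤ P.eval (x.size + b)

end Prog

/-! ## Computational indistinguishability -/

def PolyBounded (f : ℕ → ℕ) : Prop := ∃ P : Polynomial ℕ, ∀ l, f l ≤ P.eval l

def Negligible (f : ℕ → ℝ) : Prop :=
  Asymptotics.SuperpolynomialDecay Filter.atTop (fun l : ℕ => (l : ℝ)) f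

/-- The probability that a bit is `1`. -/
noncomputable def prOne (X : PMF Data) : ℝ := (X (.nat 1)).toReal

/-- Two ensembles, indexed by the security parameter `l`, are computationally indistinguishable:
every PPT distinguisher with polynomial-length advice has negligible advantage. -/
def CompIndist (X Y : ℕ → PMF Data) : Prop :=
  ∀ D : Prog, D.PPT → ∀ a : ℕ → Data, PolyBounded (fun l => (a l).size) →
    Negligible fun l =>
      |prOne ((X l).bind fun x => D.out (.pair (.unary l) (.pair (a l) x)))
        - prOne ((Y l).bind fun y => D.out (.pair (.unary l) (.pair (a l) y)))|

/-! ## The Paillier and Damgård–Jurik cryptosystems -/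

/-- A Paillier key pair: the public key is `N = p * q`, the secret key is `(p, q)`. -/
structure Key where
  p : ℕ
  q : ℕ
  prime_p : p.Prime
  prime_q : q.Prime
  ne : p ≠ q
  coprime : Nat.Coprime (p * q) ((p - 1) * (q - 1))

namespace Key

def N (k : Key) : ℕ := k.p * k.q

instance (k : Key) : NeZero k.N := ⟨Nat.mul_ne_zero k.prime_p.ne_zero k.prime_q.ne_zero⟩

/-- `φ(N) = (p - 1)(q - 1)`. -/
def phi (k : Key) : ℕ := (k.p - 1) * (k.q - 1)

def pkData (k : Key) : Data := .nat k.N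

def skData (k : Key) : Data := .pair (.nat k.p) (.nat k.q)

end Key

/-- A number as a piece of data, for an element of `ℤ/n`. -/
def zdata {n : ℕ} (c : ZMod n) : Data := .nat c.val

/-- Paillier encryption of `m ∈ ℤ/N` with randomness `ρ ∈ (ℤ/N)ˣ`: `(1 + N)^m ρ^N mod N²`. -/
def enc {N : ℕ} (m : ZMod N) (ρ : (ZMod N)ˣ) : ZMod (N ^ 2) :=
  (1 + (N : ZMod (N ^ 2))) ^ m.val * (((ρ : ZMod N).val : ℕ) : ZMod (N ^ 2)) ^ N

/-- Damgård–Jurik encryption of `m ∈ ℤ/N²` with randomness `ρ`: `(1 + N)^m ρ^(N²) mod N³`. -/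
def enc2 {N : ℕ} (m : ZMod (N ^ 2)) (ρ : (ZMod N)ˣ) : ZMod (N ^ 3) :=
  (1 + (N : ZMod (N ^ 3))) ^ m.val * (((ρ : ZMod N).val : ℕ) : ZMod (N ^ 3)) ^ (N ^ 2)

/-- Re-encryption: multiplication by an encryption of zero. -/
def reenc {N : ℕ} (c : ZMod (N ^ 2)) (ρ : (ZMod N)ˣ) : ZMod (N ^ 2) := c * enc 0 ρ

def reenc2 {N : ℕ} (c : ZMod (N ^ 3)) (ρ : (ZMod N)ˣ) : ZMod (N ^ 3) := c * enc2 0 ρ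

/-- Paillier decryption: `L(c^φ mod N²) · φ⁻¹ mod N`, where `L(u) = (u - 1) / N`. -/
def dec (k : Key) (c : ZMod (k.N ^ 2)) : ZMod k.N :=
  ((((c ^ k.phi).val - 1) / k.N : ℕ) : ZMod k.N) * (k.phi : ZMod k.N)⁻¹

/-- Damgård–Jurik decryption. If `c ^ φ = (1 + N)^i mod N³`, then `L(c ^ φ mod N²) = i mod N` and
`L(c ^ φ mod N³) = i + (i choose 2) N mod N²`, which gives `i mod N²`; the plaintext is `i φ⁻¹`. -/
def dec2 (k : Key) (c : ZMod (k.N ^ 3)) : ZMod (k.N ^ 2) :=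
  let u : ℕ := (c ^ k.phi).val
  let i₁ : ℕ := (u % k.N ^ 2 - 1) / k.N
  ((((u - 1) / k.N : ℕ) : ZMod (k.N ^ 2)) - ((i₁.choose 2 * k.N : ℕ) : ZMod (k.N ^ 2)))
    * (k.phi : ZMod (k.N ^ 2))⁻¹

/-- A key generation algorithm: for security parameter `l` it draws two large primes, that is,
with at least `l` and at most polynomially many bits. -/
def IsKeyGen (K : ℕ → PMF Key) : Prop :=
  (∀ l, ∀ k ∈ (K l).support, 2 ^ l ≤ k.p ∧ 2 ^ l ≤ k.q) ∧
    ∃ P : Polynomial ℕ, ∀ l, ∀ k ∈ (K l).support, Nat.size k.N ≤ P.eval l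

/-- Read the two challenge messages and the state in the output of a CPA adversary. -/
def parseChallenge : Data → ℕ × ℕ × Data
  | .pair (.pair (.nat m₀) (.nat m₁)) st => (m₀, m₁, st)
  | st => (0, 0, st)

/-- The CPA experiment: `A₁` chooses two messages from the public key, `A₂` receives an encryption
of the second one if `b` holds and of the first one otherwise, and outputs a bit. -/
noncomputable def cpaGame (K : ℕ → PMF Key) (A₁ A₂ : Prog) (a : ℕ → Data) (b : Bool) (l : ℕ) :
    PMF Data :=
  (K l).bind fun k =>
  (A₁.out (.pair (.unary l) (.pair (a l) k.pkData))).bind fun y =>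
  (PMF.uniformOfFintype (ZMod k.N)ˣ).bind fun ρ =>
  let ch := parseChallenge y
  let m : ZMod k.N := if b then (ch.2.1 : ZMod k.N) else (ch.1 : ZMod k.N)
  A₂.out (.pair ch.2.2 (zdata (enc m ρ)))

/-- The Paillier cryptosystem with key generation `K` is CPA-secure (semantically secure). -/
def PaillierCPASecure (K : ℕ → PMF Key) : Prop :=
  ∀ A₁ A₂ : Prog, A₁.PPT → A₂.PPT → ∀ a : ℕ → Data, PolyBounded (fun l => (a l).size) →
    Negligible fun l =>
      |prOne (cpaGame K A₁ A₂ a true l) - prOne (cpaGame K A₁ A₂ a false l)|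

/-! ## Pseudo-random functions and the encrypted hash list -/

/-- A family of functions with `l`-bit keys, `dom l`-bit arguments and `len l`-bit values. -/
abbrev HashFamily (dom len : ℕ → ℕ) : Type :=
  ∀ l, Fin (2 ^ l) → Fin (2 ^ dom l) → Fin (2 ^ len l)

/-- The oracle that answers with the values of `f`. -/
def oracleOf {d e : ℕ} (f : Fin (2 ^ d) → Fin (2 ^ e)) (n : ℕ) : ℕ :=
  if h : n < 2 ^ d then (f ⟨n, h⟩ : ℕ) else 0

/-- `F` is pseudo-random: no PPT oracle algorithm can tell `F` with a random key from a uniformly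
random function. -/
def IsPRF {dom len : ℕ → ℕ} (F : HashFamily dom len) : Prop :=
  ∀ D : Prog, D.PPT → ∀ a : ℕ → Data, PolyBounded (fun l => (a l).size) →
    Negligible fun l =>
      |prOne ((PMF.uniformOfFintype (Fin (2 ^ l))).bind fun κ =>
            D.outO (oracleOf (F l κ)) (.pair (.unary l) (a l)))
        - prOne ((PMF.uniformOfFintype (Fin (2 ^ dom l) → Fin (2 ^ len l))).bind fun f =>
            D.outO (oracleOf f) (.pair (.unary l) (a l)))|

/-- An encrypted item `E(I) = (EHL(o), Enc(x))`, with hash lists of length `s`. -/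
structure EncItem (N s : ℕ) where
  ehl : Fin s → ZMod (N ^ 2)
  score : ZMod (N ^ 2)

def EncItem.data {N s : ℕ} (E : EncItem N s) : Data :=
  .pair (.ofFin fun i => zdata (E.ehl i)) (zdata E.score)

/-- Encryption of an item with hash values `h` and score `x`. -/
def encItem {N s : ℕ} (h : Fin s → ℕ) (x : ℕ) (ρ : (Fin s → (ZMod N)ˣ) × (ZMod N)ˣ) :
    EncItem N s :=
  ⟨fun i => enc (h i : ZMod N) (ρ.1 i), enc (x : ZMod N) ρ.2⟩

/-- The operation `EHL(x) ⊖ EHL(y) = ∏ᵢ (EHL(x)[i] · EHL(y)[i]⁻¹)^(rᵢ)`. -/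
def ehlSub {N s : ℕ} (x y : Fin s → ZMod (N ^ 2)) (r : Fin s → ZMod N) : ZMod (N ^ 2) :=
  ∏ i, (x i * (y i)⁻¹) ^ (r i).val

/-! ## The relation, its encryption, and the objects at one depth -/

/-- A relation given as `M` lists of `n` items (object, score); `obj i d` and `score i d` belong to
the item at depth `d` of list `i`. (That the lists are sorted plays no role here.) -/
structure Relation (dom : ℕ) where
  n : ℕ
  M : ℕ
  obj : Fin M → Fin n → Fin (2 ^ dom)
  score : Fin M → Fin n → ℕ

/-- An instance of the worst-score computation: a relation, a depth `d`, and the distinct lists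
selected by a query, `lists 0` being the one of the current item `I` and the `m` others being those
of the items of `H`. -/
structure Instance (dom : ℕ) where
  R : Relation dom
  m : ℕ
  lists : Fin (m + 1) ↪ Fin R.M
  d : Fin R.n

namespace Instance

variable {dom : ℕ}

/-- The objects at depth `d`: `object 0` is that of `I`, the others are those of `H`. -/
def object (I : Instance dom) (j : Fin (I.m + 1)) : Fin (2 ^ dom) := I.R.obj (I.lists j) I.d

/-- The worst score of the object of `I` based on `H`: the sum of the scores of the items of `H`
with the same object. -/
def worst (I : Instance dom) : ℕ :=
  ∑ j : Fin I.m, if I.object j.succ = I.object 0 then I.R.score (I.lists j.succ) I.d else 0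

/-- The size `|ER|` of the encrypted relation: number of objects and number of attributes. -/
def sizeER (I : Instance dom) : Data := .pair (.unary I.R.n) (.unary I.R.M)

/-- Equality pattern of the objects at depth `d`, the items of `H` being permuted by `π`:
a symmetric binary matrix with rows and columns `0` (the item `I`), `1, …, m`. -/
def eqPattern (I : Instance dom) (π : Equiv.Perm (Fin I.m)) : Data :=
  let o : Fin (I.m + 1) → Fin (2 ^ dom) := Fin.cons (I.object 0) fun j => I.object (π j).succ
  .ofFin fun a => .ofFin fun b => .nat (if o a = o b then 1 else 0)

/-- The instances of a family have polynomial size. -/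
def PolySize {dom : ℕ → ℕ} (I : ∀ l, Instance (dom l)) : Prop :=
  ∃ P : Polynomial ℕ, ∀ l, (I l).R.n ≤ P.eval l ∧ (I l).R.M ≤ P.eval l ∧
    ∀ i d, Nat.size ((I l).R.obj i d) ≤ P.eval l ∧ Nat.size ((I l).R.score i d) ≤ P.eval l

end Instance

/-- The encrypted relation `ER`: the encryptions of all items of all lists. -/
abbrev EncRel (N s : ℕ) {dom : ℕ} (R : Relation dom) : Type := Fin R.M → Fin R.n → EncItem N s

def EncRel.data {N s dom : ℕ} {R : Relation dom} (ER : EncRel N s R) : Data :=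
  .ofFin fun i => .ofFin fun d => (ER i d).data

/-- Encryption of a relation: fresh hash keys `κ₁, …, κ_s`, hash values `F(κᵢ, o) mod N`, and
independent fresh encryptions of hash values and scores. -/
noncomputable def encRel {dom len : ℕ → ℕ} (F : HashFamily dom len) (s l N : ℕ) [NeZero N]
    (R : Relation (dom l)) : PMF (EncRel N s R) :=
  (PMF.uniformOfFintype (Fin s → Fin (2 ^ l))).bind fun κ =>
  (PMF.uniformOfFintype (Fin R.M → Fin R.n → (Fin s → (ZMod N)ˣ) × (ZMod N)ˣ)).map fun ρ i d =>
    encItem (fun t => (F l (κ t) (R.obj i d) : ℕ)) (R.score i d) (ρ i d)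

/-! ## The protocols. Every ciphertext that a server sends is a fresh one: it is re-encrypted. -/

/-- What the servers send in one run of a protocol, in order, and the output of `S₁`, which is a
Paillier ciphertext. -/
structure Transcript where
  /-- the messages received by `S₁` -/
  viewS1 : Data
  /-- the messages received by `S₂` -/
  viewS2 : Data
  output : ℕ

/-- The random choices in `RecoverEnc`: `r` and the randomness of `Enc(r)`, the randomness of the
re-encryption by `S₁`, and that of the re-encryption by `S₂`. -/
abbrev RecoverCoins (N : ℕ) : Type := (ZMod N × (ZMod N)ˣ) × (ZMod N)ˣ × (ZMod N)ˣ

/-- The message to `S₂`, the answer to `S₁`, and the output of `RecoverEnc`. -/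
structure RecoverRun (N : ℕ) where
  toS2 : ZMod (N ^ 3)
  toS1 : ZMod (N ^ 2)
  output : ZMod (N ^ 2)

/-- `RecoverEnc` on `X = E₂(Enc(c))`: `S₁` sends `E₂(Enc(c + r)) = X ^ Enc(r)`, `S₂` removes the
outer layer and returns `Enc(c + r)`, and `S₁` outputs `Enc(c) = Enc(c + r) · Enc(r)⁻¹`. -/
def recoverEnc (k : Key) (X : ZMod (k.N ^ 3)) (ω : RecoverCoins k.N) : RecoverRun k.N :=
  let er := enc ω.1.1 ω.1.2
  let toS2 := reenc2 (X ^ er.val) ω.2.1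
  let toS1 := reenc (dec2 k toS2) ω.2.2
  ⟨toS2, toS1, toS1 * er⁻¹⟩

/-- A run of `SecWorst(E(I), H)`. -/
noncomputable def secWorst (k : Key) {s m : ℕ} (E : EncItem k.N s) (H : Fin m → EncItem k.N s) :
    PMF Transcript :=
  -- `S₁`: the permutation, the exponents of `⊖`, and the re-encryptions of the `Enc(bⱼ)`
  (PMF.uniformOfFintype (Equiv.Perm (Fin m))).bind fun π =>
  (PMF.uniformOfFintype (Fin m → Fin s → ZMod k.N)).bind fun r =>
  (PMF.uniformOfFintype (Fin m → (ZMod k.N)ˣ)).bind fun β =>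
  -- `S₂`: the randomness of the `E₂(tⱼ)`
  (PMF.uniformOfFintype (Fin m → (ZMod k.N)ˣ)).bind fun τ =>
  -- `S₁`: the randomness of the `E₂(1)` and of the `Enc(0)`; both: the runs of `RecoverEnc`
  (PMF.uniformOfFintype (Fin m → (ZMod k.N)ˣ)).bind fun one =>
  (PMF.uniformOfFintype (Fin m → (ZMod k.N)ˣ)).bind fun zero =>
  (PMF.uniformOfFintype (Fin m → RecoverCoins k.N)).bind fun ω =>
  let encB : Fin m → ZMod (k.N ^ 2) := fun j => reenc (ehlSub E.ehl (H (π j)).ehl (r j)) (β j)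
  let t : Fin m → ZMod (k.N ^ 2) := fun j => if dec k (encB j) = 0 then 1 else 0
  let encT : Fin m → ZMod (k.N ^ 3) := fun j => enc2 (t j) (τ j)
  let X : Fin m → ZMod (k.N ^ 3) := fun j =>
    encT j ^ (H (π j)).score.val * (enc2 1 (one j) * (encT j)⁻¹) ^ (enc 0 (zero j)).val
  let rec' : Fin m → RecoverRun k.N := fun j => recoverEnc k (X j) (ω j)
  PMF.pure
    { viewS1 := .ofFin fun j => .pair (zdata (encT j)) (zdata (rec' j).toS1)
      viewS2 := .ofFin fun j => .pair (zdata (encB j)) (zdata (rec' j).toS2)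
      output := (∏ j, (rec' j).output).val }

/-! ## Privacy between the servers -/

/-- A two-server protocol on a given (plaintext) instance: a random setup (keys, and the encrypted
input of `S₁`), what the servers and the simulators get, the execution, and the functionality. -/
structure Experiment where
  Setup : Type
  setup : PMF Setup
  pk : Setup → Data
  sk : Setup → Data
  /-- the encrypted data held by `S₁` -/
  input : Setup → Data
  exec : Setup → PMF Transcript
  /-- the leakage to `S₁` -/
  leakS1 : PMF Data
  /-- the leakage to `S₂` -/
  leakS2 : PMF Data
  /-- which outputs of `S₁` are encryptions of the value of the functionality -/
  IsResult : Setup → ℕ → Prop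

namespace Experiment

/-- Public key, input of `S₁`, simulated view of `S₁`, and the output of the protocol in an
independent execution. -/
noncomputable def idealS1 (X : Experiment) (l : ℕ) (sim : Prog) : PMF Data :=
  X.setup.bind fun σ => X.leakS1.bind fun z =>
  (sim.out (.pair (.unary l) (.pair (X.pk σ) z))).bind fun v =>
  (X.exec σ).map fun T => .pair (.pair (X.pk σ) (X.input σ)) (.pair v (.nat T.output))

/-- Public key, input of `S₁`, view of `S₁` and output of the same execution. -/
noncomputable def realS1 (X : Experiment) : PMF Data :=
  X.setup.bind fun σ =>
  (X.exec σ).map fun T => .pair (.pair (X.pk σ) (X.input σ)) (.pair T.viewS1 (.nat T.output))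

/-- Both keys, input of `S₁`, and the simulated view of `S₂`. -/
noncomputable def idealS2 (X : Experiment) (l : ℕ) (sim : Prog) : PMF Data :=
  X.setup.bind fun σ => X.leakS2.bind fun z =>
  (sim.out (.pair (.unary l) (.pair (X.pk σ) (.pair (X.sk σ) z)))).map fun v =>
    .pair (.pair (X.pk σ) (.pair (X.sk σ) (X.input σ))) v

/-- Both keys, input of `S₁`, and the view of `S₂`. -/
noncomputable def realS2 (X : Experiment) : PMF Data :=
  X.setup.bind fun σ =>
  (X.exec σ).map fun T => .pair (.pair (X.pk σ) (.pair (X.sk σ) (X.input σ))) T.viewS2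

/-- The probability that the output of `S₁` is not an encryption of the right value. -/
noncomputable def failure (X : Experiment) : ℝ :=
  ((X.setup.bind fun σ => (X.exec σ).map fun T => X.IsResult σ T.output) False).toReal

end Experiment

/-- A protocol, run on the instances `ι l`, privately realizes its functionality: there are PPT
simulators for the views of `S₁` and `S₂` such that for all admissible families of instances
the simulation is computationally indistinguishable from the real execution, and the output of `S₁`
is an encryption of the value of the functionality, except with negligible probability. -/
def PrivatelyRealizes {ι : ℕ → Type} (admissible : (∀ l, ι l) → Prop)
    (X : ∀ l, ι l → Experiment) : Prop :=
  ∃ simS1 simS2 : Prog, simS1.PPT ∧ simS2.PPT ∧ ∀ I : ∀ l, ι l, admissible I →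
    CompIndist (fun l => (X l (I l)).idealS1 l simS1) (fun l => (X l (I l)).realS1) ∧
    CompIndist (fun l => (X l (I l)).idealS2 l simS2) (fun l => (X l (I l)).realS2) ∧
    Negligible fun l => (X l (I l)).failure

/-- `SecWorst` at one depth of an encrypted relation. `S₁` holds `ER`. The simulator of its view
gets `|ER|` and the number `|H|` of inputs of the protocol; the simulator of the view of `S₂` gets
`|H|` and the equality pattern under a random permutation. -/
noncomputable def secWorstExperiment (K : ℕ → PMF Key) {dom len : ℕ → ℕ} (F : HashFamily dom len)
    (s l : ℕ) (I : Instance (dom l)) : Experiment where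
  Setup := Σ k : Key, EncRel k.N s I.R
  setup := (K l).bind fun k => (encRel F s l k.N I.R).map fun ER => ⟨k, ER⟩
  pk σ := σ.1.pkData
  sk σ := σ.1.skData
  input σ := σ.2.data
  exec σ := secWorst σ.1 (σ.2 (I.lists 0) I.d) (fun j : Fin I.m => σ.2 (I.lists j.succ) I.d)
  leakS1 := PMF.pure (.pair I.sizeER (.unary I.m))
  leakS2 := (PMF.uniformOfFintype (Equiv.Perm (Fin I.m))).map fun π =>
    .pair (.unary I.m) (I.eqPattern π)
  IsResult σ c := dec σ.1 (c : ZMod (σ.1.N ^ 2)) = (I.worst : ZMod σ.1.N)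

/-- `RecoverEnc` on `E₂(Enc(c))`, without leakage; `S₁` should obtain an encryption of `c`. -/
noncomputable def recoverExperiment (K : ℕ → PMF Key) (l c : ℕ) : Experiment where
  Setup := Σ k : Key, ZMod (k.N ^ 3)
  setup := (K l).bind fun k =>
    (PMF.uniformOfFintype ((ZMod k.N)ˣ × (ZMod k.N)ˣ)).map fun ρ =>
      ⟨k, enc2 (enc (c : ZMod k.N) ρ.1) ρ.2⟩
  pk σ := σ.1.pkData
  sk σ := σ.1.skData
  input σ := zdata σ.2
  exec σ := (PMF.uniformOfFintype (RecoverCoins σ.1.N)).map fun ω =>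
    let run := recoverEnc σ.1 σ.2 ω
    { viewS1 := zdata run.toS1, viewS2 := zdata run.toS2, output := run.output.val }
  leakS1 := PMF.pure (.nat 0)
  leakS2 := PMF.pure (.nat 0)
  IsResult σ x := dec σ.1 (x : ZMod (σ.1.N ^ 2)) = (c : ZMod σ.1.N)

end SecTopK

namespace SecTopK

open scoped ENNReal

/-! ## Expectations, statistical distance and uniform distributions -/

section Statistical

variable {α β γ : Type}

/-- Expectation of a nonnegative function. -/
noncomputable def Ex (X : PMF α) (f : α → ℝ≥0∞) : ℝ≥0∞ := ∑' a, X a * f a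

lemma Ex_pure (a : α) (f : α → ℝ≥0∞) : Ex (PMF.pure a) f = f a := by
  classical
  rw [Ex, tsum_eq_single a]
  · simp
  · intro b hb; simp [PMF.pure_apply, hb]

lemma Ex_bind (X : PMF α) (g : α → PMF β) (f : β → ℝ≥0∞) :
    Ex (X.bind g) f = Ex X fun a => Ex (g a) f := by
  simp only [Ex, PMF.bind_apply, ← ENNReal.tsum_mul_right, ← ENNReal.tsum_mul_left]
  rw [ENNReal.tsum_comm]
  simp only [mul_assoc]

lemma Ex_map (X : PMF α) (g : α → β) (f : β → ℝ≥0∞) : Ex (X.map g) f = Ex X (f ∘ g) := by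
  rw [← PMF.bind_pure_comp, Ex_bind]
  simp [Ex_pure, Function.comp_def]

lemma Ex_mono {X : PMF α} {f g : α → ℝ≥0∞} (h : ∀ a ∈ X.support, f a ≤ g a) : Ex X f ≤ Ex X g := by
  refine ENNReal.tsum_le_tsum fun a => ?_
  by_cases ha : X a = 0
  · simp [ha]
  · gcongr; exact h a ((PMF.mem_support_iff _ _).2 ha)

lemma Ex_add (X : PMF α) (f g : α → ℝ≥0∞) : Ex X (fun a => f a + g a) = Ex X f + Ex X g := by
  simp only [Ex, mul_add, ENNReal.tsum_add]

lemma Ex_const (X : PMF α) (c : ℝ≥0∞) : Ex X (fun _ => c) = c := by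
  simp [Ex, ENNReal.tsum_mul_right, X.tsum_coe]

lemma Ex_le_one {X : PMF α} {f : α → ℝ≥0∞} (h : ∀ a, f a ≤ 1) : Ex X f ≤ 1 :=
  (Ex_mono fun a _ => h a).trans (Ex_const X 1).le

lemma Ex_fintype [Fintype α] (X : PMF α) (f : α → ℝ≥0∞) : Ex X f = ∑ a, X a * f a := tsum_fintype _

lemma Ex_uniform [Fintype α] [Nonempty α] (f : α → ℝ≥0∞) :
    Ex (PMF.uniformOfFintype α) f = (Fintype.card α : ℝ≥0∞)⁻¹ * ∑ a, f a := by
  simp [Ex_fintype, Finset.mul_sum]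

lemma apply_eq_Ex (X : PMF α) (a : α) [DecidableEq α] : X a = Ex X fun b => if b = a then 1 else 0 := by
  simp [Ex]

lemma bind_apply_eq_Ex (X : PMF α) (g : α → PMF β) (b : β) : (X.bind g) b = Ex X fun a => g a b :=
  PMF.bind_apply _ _ _

/-- The statistical distance of `X` and `Y` is at most `ε`. -/
def SD (X Y : PMF α) (ε : ℝ≥0∞) : Prop :=
  ∀ f : α → ℝ≥0∞, (∀ a, f a ≤ 1) → Ex X f ≤ Ex Y f + ε ∧ Ex Y f ≤ Ex X f + ε

namespace SD

lemma refl (X : PMF α) (ε : ℝ≥0∞) : SD X X ε := fun _ _ => ⟨le_self_add, le_self_add⟩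

lemma of_eq {X Y : PMF α} (h : X = Y) (ε : ℝ≥0∞) : SD X Y ε := h ▸ refl X ε

lemma one (X Y : PMF α) : SD X Y 1 := fun _ hf =>
  ⟨(Ex_le_one hf).trans le_add_self, (Ex_le_one hf).trans le_add_self⟩

lemma symm {X Y : PMF α} {ε : ℝ≥0∞} (h : SD X Y ε) : SD Y X ε := fun f hf => (h f hf).symm

lemma mono {X Y : PMF α} {ε ε' : ℝ≥0∞} (h : SD X Y ε) (hε : ε ≤ ε') : SD X Y ε' := fun f hf =>
  ⟨(h f hf).1.trans (by gcongr), (h f hf).2.trans (by gcongr)⟩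

lemma trans {X Y Z : PMF α} {ε ε' : ℝ≥0∞} (h : SD X Y ε) (h' : SD Y Z ε') : SD X Z (ε + ε') := by
  intro f hf
  refine ⟨(h f hf).1.trans ?_, (h' f hf).2.trans ?_⟩
  · rw [add_comm ε, ← add_assoc]; gcongr; exact (h' f hf).1
  · rw [← add_assoc]; gcongr; exact (h f hf).2

lemma bind_left {X Y : PMF α} {ε : ℝ≥0∞} (h : SD X Y ε) (g : α → PMF β) :
    SD (X.bind g) (Y.bind g) ε := by
  intro f hf
  simp only [Ex_bind]
  exact h _ fun a => Ex_le_one hf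

lemma bind_right (X : PMF α) {g h : α → PMF β} {ε : α → ℝ≥0∞}
    (H : ∀ a ∈ X.support, SD (g a) (h a) (ε a)) : SD (X.bind g) (X.bind h) (Ex X ε) := by
  intro f hf
  simp only [Ex_bind, ← Ex_add]
  exact ⟨Ex_mono fun a ha => (H a ha f hf).1, Ex_mono fun a ha => (H a ha f hf).2⟩

lemma bind_const (X : PMF α) {g h : α → PMF β} {ε : ℝ≥0∞}
    (H : ∀ a ∈ X.support, SD (g a) (h a) ε) : SD (X.bind g) (X.bind h) ε := by
  have := bind_right X H
  rwa [Ex_const] at this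

lemma bind {X Y : PMF α} {g h : α → PMF β} {ε ε' : ℝ≥0∞} (H : SD X Y ε)
    (H' : ∀ a, SD (g a) (h a) ε') : SD (X.bind g) (Y.bind h) (ε + ε') :=
  (H.bind_left g).trans (bind_const Y fun a _ => H' a)

lemma map {X Y : PMF α} {ε : ℝ≥0∞} (h : SD X Y ε) (g : α → β) : SD (X.map g) (Y.map g) ε := by
  rw [← PMF.bind_pure_comp, ← PMF.bind_pure_comp]; exact h.bind_left _

/-- Experiments that agree outside of an event. -/
lemma bind_event (X : PMF α) {g h : α → PMF β} (B : α → Prop) [DecidablePred B]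
    (H : ∀ a ∈ X.support, ¬ B a → g a = h a) :
    SD (X.bind g) (X.bind h) (Ex X fun a => if B a then 1 else 0) := by
  refine bind_right X fun a ha => ?_
  split_ifs with hB
  · exact one _ _
  · exact of_eq (H a ha hB) _

lemma of_le {X Y : PMF α} {ε : ℝ≥0∞}
    (h : ∀ f : α → ℝ≥0∞, (∀ a, f a ≤ 1) → Ex X f ≤ Ex Y f + ε) : SD X Y ε := by
  intro f hf
  refine ⟨h f hf, ?_⟩
  have key : ∀ Z : PMF α, Ex Z f + Ex Z (fun a => 1 - f a) = 1 := fun Z => by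
    rw [← Ex_add, ← Ex_const Z 1]
    refine tsum_congr fun a => ?_
    beta_reduce
    rw [Ex_const, add_tsub_cancel_of_le (hf a)]
  have h1 := h (fun a => 1 - f a) fun a => tsub_le_self
  have hfin : Ex X (fun a => 1 - f a) ≠ ∞ :=
    ((Ex_le_one fun a => tsub_le_self).trans_lt ENNReal.one_lt_top).ne
  rw [← ENNReal.add_le_add_iff_right hfin]
  calc Ex Y f + Ex X (fun a => 1 - f a) ≤ Ex Y f + (Ex Y (fun a => 1 - f a) + ε) := by gcongr
    _ = Ex X f + Ex X (fun a => 1 - f a) + ε := by rw [← add_assoc, key, key]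
    _ = _ := by ring

lemma of_injective [Fintype α] [Nonempty α] [Fintype β] [Nonempty β] {i : α → β}
    (hi : Function.Injective i) {c : ℕ} (hc : Fintype.card β ≤ Fintype.card α + c) :
    SD ((PMF.uniformOfFintype α).map i) (PMF.uniformOfFintype β) (c / Fintype.card β) := by
  classical
  refine (of_le fun f hf => ?_).symm
  have hab : Fintype.card α ≤ Fintype.card β := Fintype.card_le_of_injective i hi
  have hsum : ∑ b, f b ≤ ∑ a, f (i a) + c := by
    rw [← Finset.sum_image (s := Finset.univ) (g := i) (f := f) (fun _ _ _ _ h => hi h),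
      ← Finset.sum_add_sum_compl (Finset.univ.image i) f]
    gcongr
    refine (Finset.sum_le_card_nsmul _ _ 1 fun b _ => hf b).trans ?_
    rw [Finset.card_compl, Finset.card_image_of_injective _ hi, Finset.card_univ, nsmul_eq_mul,
      mul_one]
    exact_mod_cast (by omega)
  rw [Ex_map, Ex_uniform, Ex_uniform]
  calc (Fintype.card β : ℝ≥0∞)⁻¹ * ∑ b, f b
      ≤ (Fintype.card β : ℝ≥0∞)⁻¹ * (∑ a, f (i a) + c) := by gcongr
    _ = (Fintype.card β : ℝ≥0∞)⁻¹ * ∑ a, f (i a) + c / Fintype.card β := by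
        rw [mul_add, ENNReal.div_eq_inv_mul]
    _ ≤ _ := by
        gcongr
        simp

end SD

lemma uniform_map_equiv [Fintype α] [Nonempty α] [Fintype β] [Nonempty β] (e : α ≃ β) :
    (PMF.uniformOfFintype α).map e = PMF.uniformOfFintype β := by
  classical
  ext b
  rw [PMF.map_apply, tsum_eq_single (e.symm b)]
  · simp [Fintype.card_congr e]
  · intro a ha
    rw [if_neg]; rintro rfl; simp at ha

lemma uniform_bind_equiv [Fintype α] [Nonempty α] [Fintype β] [Nonempty β] (e : α ≃ β)
    (f : β → PMF γ) :
    ((PMF.uniformOfFintype α).bind fun a => f (e a)) = (PMF.uniformOfFintype β).bind f := by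
  rw [← uniform_map_equiv e, PMF.bind_map]; rfl

lemma uniform_prod [Fintype α] [Nonempty α] [Fintype β] [Nonempty β] :
    PMF.uniformOfFintype (α × β) =
      (PMF.uniformOfFintype α).bind fun a => (PMF.uniformOfFintype β).map fun b => (a, b) := by
  classical
  ext ⟨a, b⟩
  rw [PMF.bind_apply, tsum_eq_single a]
  · rw [PMF.map_apply, tsum_eq_single b]
    · simp [ENNReal.mul_inv]
    · intro b' hb'; simp [Ne.symm hb']
  · intro a' ha'
    simp [PMF.map_apply, Ne.symm ha']

lemma uniform_prod_bind [Fintype α] [Nonempty α] [Fintype β] [Nonempty β] (f : α × β → PMF γ) :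
    (PMF.uniformOfFintype (α × β)).bind f =
      (PMF.uniformOfFintype α).bind fun a => (PMF.uniformOfFintype β).bind fun b => f (a, b) := by
  rw [uniform_prod, PMF.bind_bind]
  congr 1; ext1 a; rw [PMF.bind_map]; rfl

lemma uniform_pi_prod_bind {ι : Type} [Fintype ι] [DecidableEq ι] [Fintype α] [Nonempty α]
    [Fintype β] [Nonempty β] (f : (ι → α × β) → PMF γ) :
    (PMF.uniformOfFintype (ι → α × β)).bind f =
      (PMF.uniformOfFintype (ι → α)).bind fun a => (PMF.uniformOfFintype (ι → β)).bind fun b =>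
        f fun i => (a i, b i) := by
  rw [← uniform_bind_equiv (Equiv.arrowProdEquivProdArrow ι (fun _ => α) (fun _ => β)).symm f,
    uniform_prod_bind]
  rfl

lemma uniform_fin_succ_bind [Fintype α] [Nonempty α] (n : ℕ) (f : (Fin (n + 1) → α) → PMF γ) :
    (PMF.uniformOfFintype (Fin (n + 1) → α)).bind f =
      (PMF.uniformOfFintype α).bind fun a => (PMF.uniformOfFintype (Fin n → α)).bind fun g =>
        f (Fin.cons a g) := by
  rw [← uniform_bind_equiv (Fin.consEquiv fun _ : Fin (n + 1) => α) f, uniform_prod_bind]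
  rfl

/-- A surjective homomorphism maps the uniform distribution to the uniform distribution. -/
@[to_additive]
lemma uniform_map_monoidHom {G H : Type} [Group G] [Group H] [Fintype G] [Fintype H] (φ : G →* H)
    (hφ : Function.Surjective φ) :
    (PMF.uniformOfFintype G).map φ = PMF.uniformOfFintype H := by
  classical
  have inv : ∀ g h, ((PMF.uniformOfFintype G).map φ) (φ g * h) =
      ((PMF.uniformOfFintype G).map φ) h := fun g h => by
    conv_lhs => rw [← uniform_map_equiv (Equiv.mulLeft g), PMF.map_comp]
    simp [PMF.map_apply]
  have const : ∀ h, ((PMF.uniformOfFintype G).map φ) h =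
      ((PMF.uniformOfFintype G).map φ) 1 := fun h => by
    obtain ⟨g, rfl⟩ := hφ h
    simpa using inv g 1
  have hsum := ((PMF.uniformOfFintype G).map φ).tsum_coe
  rw [tsum_fintype, Finset.sum_congr rfl fun h _ => const h, Finset.sum_const,
    Finset.card_univ, nsmul_eq_mul] at hsum
  ext h
  rw [const, PMF.uniformOfFintype_apply]
  exact ENNReal.eq_inv_of_mul_eq_one_left (by rw [mul_comm]; exact hsum)

lemma uniform_bind_mul_left {G : Type} [Group G] [Fintype G] (g : G) (f : G → PMF γ) :
    ((PMF.uniformOfFintype G).bind fun x => f (g * x)) = (PMF.uniformOfFintype G).bind f :=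
  uniform_bind_equiv (Equiv.mulLeft g) f

end Statistical

/-! ## Negligible functions -/

section Negl

lemma Negligible.mono {f g : ℕ → ℝ} (hg : Negligible g) (h : ∀ l, |f l| ≤ g l) : Negligible f :=
  Asymptotics.SuperpolynomialDecay.trans_abs_le hg fun l => (h l).trans (le_abs_self _)

lemma Negligible.add {f g : ℕ → ℝ} (hf : Negligible f) (hg : Negligible g) :
    Negligible fun l => f l + g l := Asymptotics.SuperpolynomialDecay.add hf hg

lemma Negligible.const_mul {f : ℕ → ℝ} (hf : Negligible f) (c : ℝ) :
    Negligible fun l => c * f l := Asymptotics.SuperpolynomialDecay.const_mul hf c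

lemma Negligible.poly_mul {f : ℕ → ℝ} (hf : Negligible f) (hf0 : ∀ l, 0 ≤ f l) {n : ℕ → ℕ}
    (hn : PolyBounded n) : Negligible fun l => n l * f l := by
  obtain ⟨P, hP⟩ := hn
  have h := Asymptotics.SuperpolynomialDecay.polynomial_mul hf (P.map (Nat.castRingHom ℝ))
  refine Negligible.mono h fun l => ?_
  rw [abs_of_nonneg (mul_nonneg (Nat.cast_nonneg _) (hf0 l))]
  refine mul_le_mul_of_nonneg_right ?_ (hf0 l)
  have := hP l
  rw [Polynomial.eval_natCast_map, eq_natCast]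
  exact_mod_cast this

lemma negligible_two_pow : Negligible fun l => ((2 : ℝ) ^ l)⁻¹ := by
  intro n
  have := tendsto_pow_const_mul_const_pow_of_abs_lt_one n (r := (2 : ℝ)⁻¹)
    (by rw [abs_of_pos] <;> norm_num)
  simpa using this

lemma PolyBounded.mono {f g : ℕ → ℕ} (hg : PolyBounded g) (h : ∀ l, f l ≤ g l) : PolyBounded f :=
  let ⟨P, hP⟩ := hg; ⟨P, fun l => (h l).trans (hP l)⟩

lemma PolyBounded.add {f g : ℕ → ℕ} (hf : PolyBounded f) (hg : PolyBounded g) :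
    PolyBounded fun l => f l + g l :=
  let ⟨P, hP⟩ := hf; let ⟨Q, hQ⟩ := hg; ⟨P + Q, fun l => by
    simpa using add_le_add (hP l) (hQ l)⟩

lemma PolyBounded.mul {f g : ℕ → ℕ} (hf : PolyBounded f) (hg : PolyBounded g) :
    PolyBounded fun l => f l * g l :=
  let ⟨P, hP⟩ := hf; let ⟨Q, hQ⟩ := hg; ⟨P * Q, fun l => by
    simpa using Nat.mul_le_mul (hP l) (hQ l)⟩

lemma PolyBounded.const (c : ℕ) : PolyBounded fun _ => c := ⟨Polynomial.C c, fun l => by simp⟩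

/-- If a bounded family is negligible for every choice of parameters, then it is so uniformly. -/
lemma exists_uniform_negligible {C : ℕ → Type} [∀ l, Nonempty (C l)] (f : ∀ l, C l → ℝ) (B : ℝ)
    (h0 : ∀ l c, 0 ≤ f l c) (hB : ∀ l c, f l c ≤ B)
    (h : ∀ c : ∀ l, C l, Negligible fun l => f l (c l)) :
    ∃ ε : ℕ → ℝ, Negligible ε ∧ (∀ l, 0 ≤ ε l) ∧ ∀ l c, f l c ≤ ε l := by
  have hbdd : ∀ l, BddAbove (Set.range (f l)) := fun l => ⟨B, by rintro _ ⟨c, rfl⟩; exact hB l c⟩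
  have hc : ∀ l, ∃ c, (⨆ c, f l c) ≤ 2 * f l c := fun l => by
    by_contra! hcon
    have hle : (⨆ c, f l c) ≤ (⨆ c, f l c) / 2 := ciSup_le fun c => by linarith [hcon c]
    obtain ⟨c⟩ : Nonempty (C l) := inferInstance
    linarith [hcon c, h0 l c]
  choose c hc using hc
  refine ⟨fun l => 2 * f l (c l), (h c).const_mul 2, fun l => by linarith [h0 l (c l)],
    fun l d => (le_ciSup (hbdd l) d).trans (hc l)⟩

end Negl

/-! ## Computational indistinguishability -/

section Indist

lemma prOne_nonneg (X : PMF Data) : 0 ≤ prOne X := ENNReal.toReal_nonneg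

lemma prOne_le_one (X : PMF Data) : prOne X ≤ 1 :=
  ENNReal.toReal_le_of_le_ofReal zero_le_one (by simpa using X.coe_le_one _)

lemma abs_prOne_sub_le_one (X Y : PMF Data) : |prOne X - prOne Y| ≤ 1 := by
  rw [abs_le]
  constructor <;> linarith [prOne_nonneg X, prOne_le_one X, prOne_nonneg Y, prOne_le_one Y]

lemma SD.prOne {α : Type} {X Y : PMF α} {ε : ℝ≥0∞} (h : SD X Y ε) (hε : ε ≠ ∞)
    (g : α → PMF Data) : |prOne (X.bind g) - prOne (Y.bind g)| ≤ ε.toReal := by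
  obtain ⟨h1, h2⟩ := h (fun a => g a (.nat 1)) fun a => (g a).coe_le_one _
  simp only [SecTopK.prOne, bind_apply_eq_Ex]
  have hX := ((Ex_le_one (X := X) fun a => (g a).coe_le_one (.nat 1)).trans_lt
    ENNReal.one_lt_top).ne
  have hY := ((Ex_le_one (X := Y) fun a => (g a).coe_le_one (.nat 1)).trans_lt
    ENNReal.one_lt_top).ne
  have h1 := ENNReal.toReal_mono (ENNReal.add_ne_top.2 ⟨hY, hε⟩) h1
  have h2 := ENNReal.toReal_mono (ENNReal.add_ne_top.2 ⟨hX, hε⟩) h2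
  rw [ENNReal.toReal_add hY hε] at h1
  rw [ENNReal.toReal_add hX hε] at h2
  rw [abs_le]; constructor <;> linarith

lemma CompIndist.symm {X Y : ℕ → PMF Data} (h : CompIndist X Y) : CompIndist Y X := by
  intro D hD a ha
  simpa only [abs_sub_comm] using h D hD a ha

lemma CompIndist.trans {X Y Z : ℕ → PMF Data} (h : CompIndist X Y) (h' : CompIndist Y Z) :
    CompIndist X Z := by
  intro D hD a ha
  refine ((h D hD a ha).add (h' D hD a ha)).mono fun l => ?_
  rw [abs_abs]; exact abs_sub_le _ _ _

lemma CompIndist.of_SD {X Y : ℕ → PMF Data} {ε : ℕ → ℝ} (hε : Negligible ε) (hε0 : ∀ l, 0 ≤ ε l)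
    (h : ∀ l, SD (X l) (Y l) (ENNReal.ofReal (ε l))) : CompIndist X Y := by
  intro D _ a _
  refine hε.mono fun l => ?_
  rw [abs_abs]
  refine ((h l).prOne ENNReal.ofReal_ne_top _).trans ?_
  rw [ENNReal.toReal_ofReal (hε0 l)]

/-- The expectation of real-valued differences is at most their largest value. -/
lemma abs_prOne_bind_sub_le {α : Type} (X : PMF α) (g h : α → PMF Data) {ε : ℝ}
    (hε : ∀ a, |prOne (g a) - prOne (h a)| ≤ ε) (hε0 : 0 ≤ ε) :
    |prOne (X.bind g) - prOne (X.bind h)| ≤ ε := by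
  have key : ∀ g h : α → PMF Data, (∀ a, prOne (g a) ≤ prOne (h a) + ε) →
      prOne (X.bind g) ≤ prOne (X.bind h) + ε := fun g h H => by
    have hY := ((Ex_le_one (X := X) fun a => (h a).coe_le_one (.nat 1)).trans_lt
      ENNReal.one_lt_top).ne
    rw [prOne, prOne, bind_apply_eq_Ex, bind_apply_eq_Ex, ← ENNReal.toReal_ofReal hε0,
      ← ENNReal.toReal_add hY ENNReal.ofReal_ne_top]
    refine ENNReal.toReal_mono (ENNReal.add_ne_top.2 ⟨hY, ENNReal.ofReal_ne_top⟩) ?_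
    rw [← Ex_const X (ENNReal.ofReal ε), ← Ex_add]
    refine Ex_mono fun a _ => ?_
    have hg := ((g a).coe_le_one (.nat 1)).trans_lt ENNReal.one_lt_top
    have hh := ((h a).coe_le_one (.nat 1)).trans_lt ENNReal.one_lt_top
    rw [← ENNReal.ofReal_toReal hg.ne, ← ENNReal.ofReal_toReal hh.ne,
      ← ENNReal.ofReal_add ENNReal.toReal_nonneg hε0]
    exact ENNReal.ofReal_le_ofReal (H a)
  have h1 := key g h fun a => by linarith [(abs_le.1 (hε a)).2]
  have h2 := key h g fun a => by linarith [(abs_le.1 (hε a)).1]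
  rw [abs_le]; constructor <;> linarith

end Indist

/-! ## Running times -/

lemma eval_mono (P : Polynomial ℕ) {m n : ℕ} (h : m ≤ n) : P.eval m ≤ P.eval n := by
  rw [Polynomial.eval_eq_sum_range, Polynomial.eval_eq_sum_range]
  gcongr

namespace Data

lemma size_pos (x : Data) : 0 < x.size := by cases x <;> simp [size]

/-- The first component, or `0`. -/
def left : Data → Data
  | pair a _ => a
  | _ => nat 0

/-- The second component, or `0`. -/
def right : Data → Data
  | pair _ b => b
  | _ => nat 0

@[simp] lemma left_pair (a b : Data) : (pair a b).left = a := rfl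
@[simp] lemma right_pair (a b : Data) : (pair a b).right = b := rfl

lemma size_left_le (x : Data) : x.left.size ≤ x.size := by
  cases x <;> simp [left, size]; omega

lemma size_right_le (x : Data) : x.right.size ≤ x.size := by
  cases x <;> simp [right, size]; omega

end Data

lemma natSize_le_self (n : ℕ) : Nat.size n ≤ n := by
  rw [Nat.size_le]; exact Nat.lt_two_pow_self

lemma natSize_mono {m n : ℕ} (h : m ≤ n) : Nat.size m ≤ Nat.size n := Nat.size_le_size h

lemma natSize_add_le (a b : ℕ) : Nat.size (a + b) ≤ Nat.size a + Nat.size b + 1 := by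
  rw [Nat.size_le, pow_succ, pow_add]
  have ha := Nat.lt_size_self a
  have hb := Nat.lt_size_self b
  nlinarith

lemma natSize_mul_le (a b : ℕ) : Nat.size (a * b) ≤ Nat.size a + Nat.size b := by
  rw [Nat.size_le, pow_add]
  exact Nat.mul_lt_mul'' (Nat.lt_size_self a) (Nat.lt_size_self b)

lemma BinOp.size_eval_le (o : BinOp) (a b : ℕ) :
    Nat.size (o.eval a b) ≤ Nat.size a + Nat.size b + 1 := by
  cases o <;> simp only [BinOp.eval]
  · exact natSize_add_le a b
  · exact (natSize_mono (Nat.sub_le a b)).trans (by omega)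
  · exact (natSize_mul_le a b).trans (by omega)
  · exact (natSize_mono (Nat.div_le_self a b)).trans (by omega)
  · exact (natSize_mono (Nat.mod_le a b)).trans (by omega)
  · split_ifs <;> simp
  · split_ifs <;> simp

namespace Prog

lemma size_le_cost_rounds {f : Data → PMF (Data × ℕ)}
    (hf : ∀ x, ∀ y ∈ (f x).support, y.1.size ≤ y.2) (n : ℕ) :
    ∀ x, ∀ z ∈ (rounds f n x).support, z.1.size ≤ z.2 + x.size := by
  induction n with
  | zero => intro x z hz; simp [rounds] at hz; simp [hz]
  | succ n ih =>
    intro x z hz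
    simp only [rounds, PMF.mem_support_bind_iff, PMF.mem_support_map_iff] at hz
    obtain ⟨y, hy, w, hw, rfl⟩ := hz
    have := ih _ _ hw
    have := hf _ _ hy
    simp only; omega

/-- Writing the result takes time. -/
lemma size_le_cost (O : ℕ → ℕ) (p : Prog) :
    ∀ x, ∀ y ∈ (run O p x).support, y.1.size ≤ y.2 := by
  have hinstr : ∀ x z, ∀ y ∈ (instr x z).support, y.1.size ≤ y.2 := fun x z y hy => by
    simp [instr] at hy; simp [hy]
  induction p with
  | rand =>
    intro x y hy
    rcases x with (_ | n) | _
    · exact hinstr _ _ _ hy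
    · simp only [run, PMF.mem_support_bind_iff] at hy
      obtain ⟨i, -, hy⟩ := hy
      exact hinstr _ _ _ hy
    · exact hinstr _ _ _ hy
  | fork p q hp hq =>
    intro x y hy
    simp only [run, PMF.mem_support_bind_iff, PMF.mem_support_map_iff] at hy
    obtain ⟨u, hu, v, hv, rfl⟩ := hy
    have := hp _ _ hu
    have := hq _ _ hv
    have := x.size_pos
    simp only [Data.size]; omega
  | seq p q hp hq =>
    intro x y hy
    simp only [run, PMF.mem_support_bind_iff, PMF.mem_support_map_iff] at hy
    obtain ⟨u, hu, v, hv, rfl⟩ := hy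
    have := hq _ _ hv
    simp only; omega
  | ite p q hp hq =>
    intro x y hy
    rcases x with n | ⟨c | _, x⟩
    · exact hinstr _ _ _ hy
    · simp only [run, PMF.mem_support_map_iff] at hy
      obtain ⟨u, hu, rfl⟩ := hy
      split_ifs at hu
      · have := hp _ _ hu; simp only; omega
      · have := hq _ _ hu; simp only; omega
    · exact hinstr _ _ _ hy
  | loop p hp =>
    intro x y hy
    rcases x with n | ⟨c | _, x⟩
    · exact hinstr _ _ _ hy
    · simp only [run, PMF.mem_support_map_iff] at hy
      obtain ⟨u, hu, rfl⟩ := hy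
      have := size_le_cost_rounds hp _ _ _ hu
      simp only [Data.size]; omega
    · exact hinstr _ _ _ hy
  | _ => intro x y hy; exact hinstr _ _ _ hy

lemma PPT.of_instr {p : Prog} (c : ℕ)
    (h : ∀ (O : ℕ → ℕ) (b : ℕ), (∀ n, Nat.size (O n) ≤ b) → ∀ x, ∀ y ∈ (run O p x).support,
      ∃ z : Data, y = (z, x.size ^ 3 + z.size) ∧ z.size ≤ x.size + b + c) : p.PPT := by
  refine ⟨.X ^ 3 + .X + .C c, fun O b hb x y hy => ?_⟩
  obtain ⟨z, rfl, hz⟩ := h O b hb x y hy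
  simp only [Polynomial.eval_add, Polynomial.eval_pow, Polynomial.eval_X, Polynomial.eval_C]
  have : x.size ^ 3 ≤ (x.size + b) ^ 3 := Nat.pow_le_pow_left (by omega) 3
  omega

lemma mem_support_instr {x z : Data} {y : Data × ℕ} (hy : y ∈ (instr x z).support) :
    y = (z, x.size ^ 3 + z.size) := by simpa [instr] using hy

lemma ppt_skip : PPT skip := .of_instr 0 fun O b _ x y hy =>
  ⟨_, mem_support_instr hy, by omega⟩

lemma ppt_const (n : ℕ) : PPT (const n) := .of_instr (Nat.size n + 1) fun O b _ x y hy =>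
  ⟨_, mem_support_instr hy, by simp [Data.size]⟩

lemma ppt_fst : PPT fst := .of_instr 0 fun O b _ x y hy =>
  ⟨_, mem_support_instr hy, by have := x.size_left_le; cases x <;> simp_all [Data.left] <;> omega⟩

lemma ppt_snd : PPT snd := .of_instr 0 fun O b _ x y hy =>
  ⟨_, mem_support_instr hy, by have := x.size_right_le; cases x <;> simp_all [Data.right] <;> omega⟩

lemma ppt_isPair : PPT isPair := .of_instr 2 fun O b _ x y hy =>
  ⟨_, mem_support_instr hy, by cases x <;> simp [Data.size]⟩

lemma ppt_op (o : BinOp) : PPT (op o) := .of_instr 0 fun O b _ x y hy =>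
  ⟨_, mem_support_instr hy, by
    have := x.size_pos
    rcases x with n | ⟨a | _, c | _⟩
    on_goal 2 => have := o.size_eval_le a c
    all_goals simp [Data.size] at *; try omega⟩

lemma ppt_powMod : PPT powMod := .of_instr 0 fun O b _ x y hy =>
  ⟨_, mem_support_instr hy, by
    have := x.size_pos
    rcases x with n | ⟨n | _, _ | ⟨a | _, c | _⟩⟩
    case pair.nat.pair.nat.nat =>
      have : Nat.size (if n = 0 then 0 else a ^ c % n) ≤ Nat.size n := natSize_mono (by
        split_ifs with h
        · omega
        · exact (Nat.mod_lt _ (Nat.pos_of_ne_zero h)).le)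
      simp only [Data.size] at *; omega
    all_goals simp [Data.size] at *; try omega⟩

lemma ppt_rand : PPT rand := .of_instr 0 fun O b _ x y hy => by
  have := x.size_pos
  rcases x with (_ | n) | _
  · exact ⟨_, mem_support_instr hy, by simp [Data.size] at *⟩
  · simp only [run, PMF.mem_support_bind_iff] at hy
    obtain ⟨i, -, hy⟩ := hy
    refine ⟨_, mem_support_instr hy, ?_⟩
    have := natSize_mono i.2.le
    simp only [Data.size] at *; omega
  · exact ⟨_, mem_support_instr hy, by simp [Data.size] at *; omega⟩

lemma ppt_query : PPT query := .of_instr 1 fun O b hb x y hy =>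
  ⟨_, mem_support_instr hy, by
    rcases x with n | _
    · have := hb n; simp only [Data.size] at *; omega
    · simp [Data.size]⟩

lemma PPT.fork {p q : Prog} (hp : p.PPT) (hq : q.PPT) : (fork p q).PPT := by
  obtain ⟨P, hP⟩ := hp
  obtain ⟨Q, hQ⟩ := hq
  refine ⟨P + Q + .X, fun O b hb x y hy => ?_⟩
  simp only [run, PMF.mem_support_bind_iff, PMF.mem_support_map_iff] at hy
  obtain ⟨u, hu, v, hv, rfl⟩ := hy
  have := hP O b hb _ _ hu
  have := hQ O b hb _ _ hv
  simp only [Polynomial.eval_add, Polynomial.eval_X]; omega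

lemma PPT.seq {p q : Prog} (hp : p.PPT) (hq : q.PPT) : (seq p q).PPT := by
  obtain ⟨P, hP⟩ := hp
  obtain ⟨Q, hQ⟩ := hq
  refine ⟨P + Q.comp (P + .X) + 1, fun O b hb x y hy => ?_⟩
  simp only [run, PMF.mem_support_bind_iff, PMF.mem_support_map_iff] at hy
  obtain ⟨u, hu, v, hv, rfl⟩ := hy
  have h1 := hP O b hb _ _ hu
  have h2 := hQ O b hb _ _ hv
  have h3 := size_le_cost O p _ _ hu
  have h4 := eval_mono Q (show u.1.size + b ≤ P.eval (x.size + b) + (x.size + b) by omega)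
  simp only [Polynomial.eval_add, Polynomial.eval_X, Polynomial.eval_comp, Polynomial.eval_one]
  omega

lemma PPT.ite {p q : Prog} (hp : p.PPT) (hq : q.PPT) : (ite p q).PPT := by
  obtain ⟨P, hP⟩ := hp
  obtain ⟨Q, hQ⟩ := hq
  have hi : ∀ (b : ℕ) (x : Data) (y : Data × ℕ), y ∈ (instr x (.nat 0)).support →
      y.2 ≤ (P + Q + .X ^ 3 + .X + 1 : Polynomial ℕ).eval (x.size + b) := fun b x y hy => by
    rw [mem_support_instr hy]
    have : x.size ^ 3 ≤ (x.size + b) ^ 3 := Nat.pow_le_pow_left (by omega) 3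
    simp only [Polynomial.eval_add, Polynomial.eval_X, Polynomial.eval_pow, Polynomial.eval_one,
      Data.size, Nat.size_zero]; omega
  refine ⟨P + Q + .X ^ 3 + .X + 1, fun O b hb x y hy => ?_⟩
  rcases x with n | ⟨c | _, x⟩
  · exact hi _ _ _ hy
  · simp only [run, PMF.mem_support_map_iff] at hy
    obtain ⟨u, hu, rfl⟩ := hy
    have hle : x.size + b ≤ (Data.pair (.nat c) x).size + b := by simp only [Data.size]; omega
    have hp := eval_mono P hle
    have hq := eval_mono Q hle
    simp only [Polynomial.eval_add, Polynomial.eval_X, Polynomial.eval_pow, Polynomial.eval_one]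
    split_ifs at hu
    · have := hP O b hb _ _ hu; omega
    · have := hQ O b hb _ _ hu; omega
  · exact hi _ _ _ hy

/-- Repeat `p` as often as the input is long. -/
def iter (p : Prog) : Prog := seq (fork length skip) (loop p)

lemma PPT.iter {p : Prog} (hp : p.PPT) (S : Polynomial ℕ)
    (Inv : (ℕ → ℕ) → ℕ → Data → ℕ → Data → Prop)
    (h0 : ∀ O b, (∀ n, Nat.size (O n) ≤ b) → ∀ x, Inv O b x 0 x)
    (hstep : ∀ O b, (∀ n, Nat.size (O n) ≤ b) → ∀ x i y, i < x.size → Inv O b x i y →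
      ∀ z ∈ (run O p y).support, Inv O b x (i + 1) z.1)
    (hsize : ∀ O b x i y, i ≤ x.size → Inv O b x i y → y.size ≤ S.eval (x.size + b)) :
    (iter p).PPT := by
  obtain ⟨P, hP⟩ := hp
  have key : ∀ O b, (∀ n, Nat.size (O n) ≤ b) → ∀ x n i y, i + n ≤ x.size → Inv O b x i y →
      ∀ z ∈ (rounds (run O p) n y).support,
        z.2 ≤ n * (P.eval (S.eval (x.size + b) + b) + 1) + 1 := by
    intro O b hb x n
    induction n with
    | zero => intro i y _ _ z hz; simp [rounds] at hz; simp [hz]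
    | succ n ih =>
      intro i y hi hy z hz
      simp only [rounds, PMF.mem_support_bind_iff, PMF.mem_support_map_iff] at hz
      obtain ⟨u, hu, w, hw, rfl⟩ := hz
      have h1 := ih (i + 1) u.1 (by omega) (hstep O b hb x i y (by omega) hy u hu) w hw
      have h2 := hP O b hb _ _ hu
      have h3 := eval_mono P (Nat.add_le_add_right (hsize O b x i y (by omega) hy) b)
      rw [Nat.add_mul]; simp only; omega
  refine ⟨.X * (P.comp (S + .X) + 1) + 2 * .X ^ 3 + 6 * .X + 6, fun O b hb x y hy => ?_⟩
  simp only [Prog.iter, run, instr, PMF.mem_support_bind_iff, PMF.mem_support_map_iff,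
    PMF.mem_support_pure_iff] at hy
  obtain ⟨_, ⟨_, rfl, _, rfl, rfl⟩, _, hu, rfl⟩ := hy
  obtain ⟨w, hw, rfl⟩ := (PMF.mem_support_map_iff _ _ _).1 hu
  have h1 := key O b hb x x.size 0 x (by omega) (h0 O b hb x) w hw
  have h2 := eval_mono P (show S.eval (x.size + b) + b ≤ S.eval (x.size + b) + (x.size + b) by omega)
  have h3 := natSize_le_self x.size
  have h4 : x.size ^ 3 ≤ (x.size + b) ^ 3 := Nat.pow_le_pow_left (by omega) 3
  have h5 : x.size * (P.eval (S.eval (x.size + b) + b) + 1) ≤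
      (x.size + b) * (P.eval (S.eval (x.size + b) + (x.size + b)) + 1) :=
    Nat.mul_le_mul (by omega) (by omega)
  simp only [Polynomial.eval_add, Polynomial.eval_mul, Polynomial.eval_X, Polynomial.eval_comp,
    Polynomial.eval_pow, Polynomial.eval_one, Polynomial.eval_ofNat, Data.size]
  omega

/-! ## Results of programs -/

lemma outO_seq (O : ℕ → ℕ) (p q : Prog) (x : Data) :
    outO O (seq p q) x = (outO O p x).bind (outO O q) := by
  simp [outO, run, PMF.map_bind, PMF.bind_map, PMF.map_comp, Function.comp_def]

lemma outO_fork (O : ℕ → ℕ) (p q : Prog) (x : Data) :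
    outO O (fork p q) x =
      (outO O p x).bind fun a => (outO O q x).bind fun b => PMF.pure (.pair a b) := by
  simp only [outO, run, PMF.bind_bind, PMF.pure_bind, Function.comp_def, ← PMF.bind_pure_comp]

lemma outO_instr {O : ℕ → ℕ} {p : Prog} {x z : Data} (h : run O p x = instr x z) :
    outO O p x = PMF.pure z := by
  rw [outO, h, instr, PMF.pure_map]

lemma outO_skip (O : ℕ → ℕ) (x : Data) : outO O skip x = PMF.pure x := outO_instr rfl
lemma outO_const (O : ℕ → ℕ) (n : ℕ) (x : Data) : outO O (const n) x = PMF.pure (.nat n) :=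
  outO_instr rfl
lemma outO_fst (O : ℕ → ℕ) (x : Data) : outO O fst x = PMF.pure x.left :=
  outO_instr (by cases x <;> rfl)
lemma outO_snd (O : ℕ → ℕ) (x : Data) : outO O snd x = PMF.pure x.right :=
  outO_instr (by cases x <;> rfl)
lemma outO_isPair_pair (O : ℕ → ℕ) (a b : Data) :
    outO O isPair (.pair a b) = PMF.pure (.nat 1) := outO_instr rfl
lemma outO_isPair_nat (O : ℕ → ℕ) (n : ℕ) :
    outO O isPair (.nat n) = PMF.pure (.nat 0) := outO_instr rfl
lemma outO_length (O : ℕ → ℕ) (x : Data) : outO O length x = PMF.pure (.nat x.size) :=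
  outO_instr rfl
lemma outO_op (O : ℕ → ℕ) (o : BinOp) (a b : ℕ) :
    outO O (op o) (.pair (.nat a) (.nat b)) = PMF.pure (.nat (o.eval a b)) := outO_instr rfl
lemma outO_query (O : ℕ → ℕ) (n : ℕ) : outO O query (.nat n) = PMF.pure (.nat (O n)) :=
  outO_instr rfl
lemma outO_powMod (O : ℕ → ℕ) (n a b : ℕ) [NeZero n] :
    outO O powMod (.pair (.nat n) (.pair (.nat a) (.nat b))) = PMF.pure (.nat (a ^ b % n)) :=
  outO_instr (by simp [run, NeZero.ne n])

lemma outO_ite (O : ℕ → ℕ) (p q : Prog) (c : ℕ) (x : Data) :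
    outO O (ite p q) (.pair (.nat c) x) = if c = 0 then outO O q x else outO O p x := by
  simp only [outO, run, PMF.map_comp, Function.comp_def]
  by_cases h : c = 0 <;> simp [h]

end Prog

/-- A uniformly random number below `n`. -/
noncomputable def uniformNat (n : ℕ) [NeZero n] : PMF ℕ := (PMF.uniformOfFintype (Fin n)).map Fin.val

namespace Prog

lemma outO_rand (O : ℕ → ℕ) (n : ℕ) [NeZero n] :
    outO O rand (.nat n) = (uniformNat n).bind fun i => PMF.pure (.nat i) := by
  obtain ⟨n, rfl⟩ := Nat.exists_eq_succ_of_ne_zero (NeZero.ne n)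
  simp only [uniformNat, outO, run, PMF.map_bind, instr, PMF.pure_map, PMF.bind_map]
  rfl

/-- Iteration of a randomised function. -/
noncomputable def iterate (f : Data → PMF Data) : ℕ → Data → PMF Data
  | 0, x => PMF.pure x
  | n + 1, x => (f x).bind (iterate f n)

lemma outO_loop (O : ℕ → ℕ) (p : Prog) (n : ℕ) (x : Data) :
    outO O (loop p) (.pair (.nat n) x) = iterate (outO O p) n x := by
  have : ∀ x, (rounds (run O p) n x).map Prod.fst = iterate (outO O p) n x := by
    induction n with
    | zero => intro x; simp [rounds, iterate, PMF.pure_map]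
    | succ n ih =>
      intro x
      simp only [rounds, iterate, PMF.map_bind, PMF.map_comp, Function.comp_def, outO,
        PMF.bind_map]
      congr 1; ext1 y; exact ih y.1
  rw [← this]
  simp [outO, run, PMF.map_comp, Function.comp_def]

/-! ## Folding over a list -/

/-- The entries `list` and `acc` of `(env, (list, acc))`. -/
def getList : Prog := seq snd fst
def getAcc : Prog := seq snd snd

/-- One step of a fold: `(env, (d :: l, acc)) ↦ (l, comb (d, (val (env, d), acc)))`. -/
def foldStep (val comb : Prog) : Prog :=
  fork (seq getList snd)
    (seq (fork (seq getList fst) (fork (seq (fork fst (seq getList fst)) val) getAcc)) comb)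

def foldBody (val comb : Prog) : Prog :=
  fork fst (seq (fork (seq getList isPair) skip) (ite (foldStep val comb) snd))

/-- `(env, (l, acc)) ↦ acc'`, where every entry `d` of `l` changes `acc` to
`comb (d, (val (env, d), acc))`. -/
def fold (val comb : Prog) : Prog := seq (iter (foldBody val comb)) getAcc

/-- The meaning of `fold`. -/
noncomputable def foldSem (val : Data → PMF Data) (comb : Data → PMF Data) :
    List Data → Data → PMF Data
  | [], acc => PMF.pure acc
  | d :: l, acc => (val d).bind fun v =>
      (comb (.pair d (.pair v acc))).bind fun acc' => foldSem val comb l acc'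

lemma outO_foldBody_cons (O : ℕ → ℕ) (val comb : Prog) (env d l acc : Data) :
    outO O (foldBody val comb) (.pair env (.pair (.pair d l) acc)) =
      (outO O val (.pair env d)).bind fun v =>
        (outO O comb (.pair d (.pair v acc))).bind fun acc' =>
          PMF.pure (.pair env (.pair l acc')) := by
  simp [foldBody, foldStep, getList, getAcc, outO_fork, outO_seq, outO_fst, outO_snd,
    outO_isPair_pair, outO_skip, outO_ite, PMF.pure_bind, PMF.bind_bind]

lemma outO_foldBody_nil (O : ℕ → ℕ) (val comb : Prog) (env acc : Data) (n : ℕ) :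
    outO O (foldBody val comb) (.pair env (.pair (.nat n) acc)) =
      PMF.pure (.pair env (.pair (.nat n) acc)) := by
  simp [foldBody, getList, outO_fork, outO_seq, outO_fst, outO_snd,
    outO_isPair_nat, outO_skip, outO_ite, PMF.pure_bind]

lemma length_le_size_ofList (l : List Data) : l.length ≤ (Data.ofList l).size := by
  induction l with
  | nil => simp
  | cons d l ih => simp only [List.length_cons, Data.ofList, Data.size]; omega

lemma outO_fold (O : ℕ → ℕ) (val comb : Prog) (env : Data) (l : List Data) (acc : Data) :
    outO O (fold val comb) (.pair env (.pair (Data.ofList l) acc)) =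
      foldSem (fun d => outO O val (.pair env d)) (outO O comb) l acc := by
  have key : ∀ (n : ℕ) (l : List Data) (acc : Data), l.length ≤ n →
      (iterate (outO O (foldBody val comb)) n (.pair env (.pair (Data.ofList l) acc))).bind
        (outO O getAcc) = foldSem (fun d => outO O val (.pair env d)) (outO O comb) l acc := by
    intro n
    induction n with
    | zero =>
      intro l acc hl
      obtain rfl : l = [] := List.eq_nil_of_length_eq_zero (by omega)
      simp [iterate, foldSem, getAcc, outO_seq, outO_snd, PMF.pure_bind]
    | succ n ih =>
      intro l acc hl
      cases l with
      | nil =>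
        simp only [iterate, Data.ofList, outO_foldBody_nil, PMF.pure_bind]
        exact ih [] acc (by simp)
      | cons d l =>
        simp only [iterate, Data.ofList, outO_foldBody_cons, PMF.bind_bind, PMF.pure_bind, foldSem]
        congr 1; ext1 v; congr 1; ext1 acc'
        exact ih l acc' (by simpa using hl)
  rw [fold, iter, outO_seq, outO_seq, outO_fork]
  simp only [outO_length, outO_skip, PMF.pure_bind, outO_loop]
  refine key _ l acc ?_
  have := length_le_size_ofList l
  simp only [Data.size]; omega

lemma ppt_getList : PPT getList := ppt_snd.seq ppt_fst
lemma ppt_getAcc : PPT getAcc := ppt_snd.seq ppt_snd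

lemma PPT.fold {val comb : Prog} (hval : val.PPT) (hcomb : comb.PPT) (c : ℕ)
    (hc : ∀ O x, ∀ y ∈ (outO O comb x).support, y.size ≤ x.size + c) : (fold val comb).PPT := by
  obtain ⟨V, hV⟩ := hval
  have hval : val.PPT := ⟨V, hV⟩
  have hbody : (foldBody val comb).PPT :=
    ppt_fst.fork (((ppt_getList.seq ppt_isPair).fork ppt_skip).seq
      (((ppt_getList.seq ppt_snd).fork (((ppt_getList.seq ppt_fst).fork
        (((ppt_fst.fork (ppt_getList.seq ppt_fst)).seq hval).fork ppt_getAcc)).seq hcomb)).ite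
          ppt_snd))
  have hout : ∀ O p x, ∀ y ∈ (run O p x).support, y.1 ∈ (outO O p x).support := fun O p x y hy =>
    (PMF.mem_support_map_iff _ _ _).2 ⟨y, hy, rfl⟩
  refine PPT.seq (PPT.iter hbody (.X + .X * (V.comp (3 * .X + 3) + .C (c + 2)))
    (fun O b x i y => y.left.size ≤ x.size ∧ y.right.left.size ≤ x.size ∧
      y.size ≤ x.size + i * (V.eval (3 * (x.size + b) + 3) + (c + 2))) ?_ ?_ ?_) ppt_getAcc
  · intro O b _ x
    exact ⟨x.size_left_le, x.right.size_left_le.trans x.size_right_le, by simp⟩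
  · intro O b hb x i y _ ⟨h1, h2, h3⟩ z hz
    have hx := x.size_pos
    have hz := hout _ _ _ _ hz
    generalize z.1 = z at hz
    rw [Nat.add_mul]
    have get : ∀ y, outO O (Prog.seq getList isPair) y =
        ((outO O snd y).bind (outO O fst)).bind (outO O isPair) := fun y => by
      rw [outO_seq]; unfold getList; rw [outO_seq]
    have nonpair : ∀ e f : Data, outO O fst y = PMF.pure e → outO O snd y = PMF.pure f →
        outO O (Prog.seq getList isPair) y = PMF.pure (.nat 0) → z = .pair e f := by
      intro e f he hf hg
      rw [foldBody, outO_fork, he, PMF.pure_bind, outO_seq, outO_fork, hg, PMF.pure_bind,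
        outO_skip, PMF.pure_bind, PMF.pure_bind, outO_ite, if_pos rfl, hf, PMF.pure_bind] at hz
      exact (PMF.mem_support_pure_iff _ _).1 hz
    rcases y with n | ⟨e, n | ⟨n | ⟨d, l⟩, acc⟩⟩
    · rw [nonpair (.nat 0) (.nat 0) (outO_instr rfl) (outO_instr rfl)
        (by rw [get, outO_snd, PMF.pure_bind,
              outO_fst, PMF.pure_bind]; exact outO_isPair_nat _ _)]
      simp only [Data.left, Data.right, Data.size, Nat.size_zero] at *
      omega
    · rw [nonpair e (.nat n) (outO_instr rfl) (outO_instr rfl)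
        (by rw [get, outO_snd, PMF.pure_bind,
              outO_fst, PMF.pure_bind]; exact outO_isPair_nat _ _)]
      simp only [Data.left, Data.right, Data.size, Nat.size_zero] at *
      omega
    · rw [outO_foldBody_nil, PMF.mem_support_pure_iff] at hz
      subst hz
      simp only [Data.left, Data.right, Data.size] at *
      omega
    · rw [outO_foldBody_cons] at hz
      simp only [PMF.mem_support_bind_iff, PMF.mem_support_pure_iff] at hz
      obtain ⟨v, hv, acc', hacc', rfl⟩ := hz
      obtain ⟨w, hw, rfl⟩ := (PMF.mem_support_map_iff _ _ _).1 hv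
      have h4 := hc _ _ _ hacc'
      have h5 := (size_le_cost O val _ _ hw).trans (hV O b hb _ _ hw)
      have h6 := eval_mono V (show (Data.pair e d).size + b ≤ 3 * (x.size + b) + 3 by
        simp only [Data.left, Data.right, Data.size] at *; omega)
      simp only [Data.left, Data.right, Data.size] at *
      omega
  · intro O b x i y hi ⟨_, _, h⟩
    refine h.trans ?_
    simp only [Polynomial.eval_add, Polynomial.eval_mul, Polynomial.eval_X, Polynomial.eval_comp,
      Polynomial.eval_C, Polynomial.eval_ofNat]
    have : i * (V.eval (3 * (x.size + b) + 3) + (c + 2)) ≤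
      (x.size + b) * (V.eval (3 * (x.size + b) + 3) + (c + 2)) := Nat.mul_le_mul_right _ (by omega)
    omega

end Prog

/-! ## Arithmetic of the cryptosystems -/

section Arith

variable {N : ℕ}

/-- `a ≡ b mod N` implies `a ^ (N ^ e) ≡ b ^ (N ^ e) mod N ^ (e + 1)`. -/
lemma pow_pow_eq_of_dvd_sub {e : ℕ} {a b : ZMod (N ^ (e + 1))}
    (h : (N : ZMod (N ^ (e + 1))) ∣ a - b) : a ^ N ^ e = b ^ N ^ e := by
  have := dvd_sub_pow_of_dvd_sub h e
  rw [← Nat.cast_pow, ZMod.natCast_self, zero_dvd_iff, sub_eq_zero] at this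
  exact this

lemma cast_dvd_sub_of_modEq {e a b : ℕ} (h : a ≡ b [MOD N]) :
    (N : ZMod (N ^ e)) ∣ (a : ZMod (N ^ e)) - b := by
  obtain ⟨c, hc⟩ := (Nat.modEq_iff_dvd.1 h.symm)
  exact ⟨c, by exact_mod_cast congrArg (Int.cast : ℤ → ZMod (N ^ e)) hc⟩

lemma one_add_pow_card (N e : ℕ) : (1 + (N : ZMod (N ^ (e + 1)))) ^ N ^ e = 1 := by
  rw [pow_pow_eq_of_dvd_sub (b := 1), one_pow]; simp

/-- The ciphertext `(1 + N) ^ m * r ^ (N ^ e) mod N ^ (e + 1)`. -/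
def ciph (N e m r : ℕ) : ZMod (N ^ (e + 1)) := (1 + (N : ZMod (N ^ (e + 1)))) ^ m * (r : ZMod _) ^ N ^ e

lemma ciph_congr {e m m' r r' : ℕ} (hm : m ≡ m' [MOD N ^ e]) (hr : r ≡ r' [MOD N]) :
    ciph N e m r = ciph N e m' r' := by
  have h1 : (1 + (N : ZMod (N ^ (e + 1)))) ^ m = (1 + (N : ZMod (N ^ (e + 1)))) ^ m' :=
    pow_eq_pow_of_modEq hm (one_add_pow_card N e)
  rw [ciph, ciph, h1, pow_pow_eq_of_dvd_sub (cast_dvd_sub_of_modEq hr)]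

lemma ciph_mul (e m m' r r' : ℕ) :
    ciph N e m r * ciph N e m' r' = ciph N e (m + m') (r * r') := by
  simp only [ciph, pow_add, Nat.cast_mul, mul_pow]; ring

lemma ciph_pow (e m r n : ℕ) : ciph N e m r ^ n = ciph N e (n * m) (r ^ n) := by
  simp only [ciph, mul_pow, Nat.cast_pow, ← pow_mul, mul_comm n]

lemma enc_eq_ciph (m : ZMod N) (ρ : (ZMod N)ˣ) : enc m ρ = ciph N 1 m.val (ρ : ZMod N).val := by
  simp [enc, ciph]

lemma enc2_eq_ciph (m : ZMod (N ^ 2)) (ρ : (ZMod N)ˣ) :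
    enc2 m ρ = ciph N 2 m.val (ρ : ZMod N).val := rfl

variable [NeZero N]

lemma val_add_modEq (n : ℕ) [NeZero n] (a b : ZMod n) : (a + b).val ≡ a.val + b.val [MOD n] := by
  rw [← ZMod.natCast_eq_natCast_iff]; simp

lemma val_mul_modEq (n : ℕ) [NeZero n] (a b : ZMod n) : (a * b).val ≡ a.val * b.val [MOD n] := by
  rw [← ZMod.natCast_eq_natCast_iff]; simp

lemma val_pow_modEq (n : ℕ) [NeZero n] (a : ZMod n) (j : ℕ) : (a ^ j).val ≡ a.val ^ j [MOD n] := by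
  rw [← ZMod.natCast_eq_natCast_iff]; simp

lemma val_natCast_modEq (n : ℕ) [NeZero n] (a : ℕ) : (a : ZMod n).val ≡ a [MOD n] := by
  rw [← ZMod.natCast_eq_natCast_iff]; simp

lemma enc_mul (m m' : ZMod N) (ρ ρ' : (ZMod N)ˣ) :
    enc m ρ * enc m' ρ' = enc (m + m') (ρ * ρ') := by
  simp only [enc_eq_ciph, ciph_mul]
  exact (ciph_congr (by simpa using val_add_modEq N m m') (val_mul_modEq N _ _)).symm

lemma enc_zero_one : enc (0 : ZMod N) 1 = 1 := by
  rw [enc_eq_ciph, ciph_congr (m' := 0) (r' := 1)]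
  · simp [ciph]
  · simp [Nat.ModEq.refl]
  · simpa using val_natCast_modEq N 1

lemma enc2_mul (m m' : ZMod (N ^ 2)) (ρ ρ' : (ZMod N)ˣ) :
    enc2 m ρ * enc2 m' ρ' = enc2 (m + m') (ρ * ρ') := by
  simp only [enc2_eq_ciph, ciph_mul]
  exact (ciph_congr (val_add_modEq _ m m') (val_mul_modEq N _ _)).symm

lemma enc2_zero_one : enc2 (0 : ZMod (N ^ 2)) 1 = 1 := by
  rw [enc2_eq_ciph, ciph_congr (m' := 0) (r' := 1)]
  · simp [ciph]
  · simp [Nat.ModEq.refl]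
  · simpa using val_natCast_modEq N 1

lemma zmod_inv_eq {n : ℕ} {a b : ZMod n} (h : a * b = 1) : a⁻¹ = b := ZMod.inv_eq_of_mul_eq_one n a b h

lemma enc_inv (m : ZMod N) (ρ : (ZMod N)ˣ) : (enc m ρ)⁻¹ = enc (-m) ρ⁻¹ :=
  zmod_inv_eq (by rw [enc_mul, add_neg_cancel, mul_inv_cancel, enc_zero_one])

lemma enc2_inv (m : ZMod (N ^ 2)) (ρ : (ZMod N)ˣ) : (enc2 m ρ)⁻¹ = enc2 (-m) ρ⁻¹ :=
  zmod_inv_eq (by rw [enc2_mul, add_neg_cancel, mul_inv_cancel, enc2_zero_one])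

lemma enc_pow (m : ZMod N) (ρ : (ZMod N)ˣ) (n : ℕ) : enc m ρ ^ n = enc ((n : ZMod N) * m) (ρ ^ n) := by
  induction n with
  | zero => simp [enc_zero_one]
  | succ n ih => rw [pow_succ (enc m ρ) n, ih, enc_mul, pow_succ ρ n]; congr 1; push_cast; ring

lemma enc2_pow (m : ZMod (N ^ 2)) (ρ : (ZMod N)ˣ) (n : ℕ) :
    enc2 m ρ ^ n = enc2 ((n : ZMod (N ^ 2)) * m) (ρ ^ n) := by
  induction n with
  | zero => simp [enc2_zero_one]
  | succ n ih => rw [pow_succ (enc2 m ρ) n, ih, enc2_mul, pow_succ ρ n]; congr 1; push_cast; ring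

lemma enc_prod {ι : Type} (s : Finset ι) (m : ι → ZMod N) (ρ : ι → (ZMod N)ˣ) :
    ∏ i ∈ s, enc (m i) (ρ i) = enc (∑ i ∈ s, m i) (∏ i ∈ s, ρ i) := by
  classical
  induction s using Finset.induction_on with
  | empty => simp [enc_zero_one]
  | insert a s ha ih => rw [Finset.prod_insert ha, ih, enc_mul, Finset.sum_insert ha,
      Finset.prod_insert ha]

end Arith

/-! ## Decryption -/

namespace Key

variable (k : Key)

lemma one_lt_N : 1 < k.N :=
  Nat.lt_of_lt_of_le k.prime_p.one_lt (Nat.le_mul_of_pos_right _ k.prime_q.pos)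

lemma odd_N : Odd k.N := by
  have key : ∀ p q : ℕ, p.Prime → q.Prime → p ≠ q → Nat.Coprime (p * q) ((p - 1) * (q - 1)) →
      Odd p := fun p q hp hq hne hc => by
    by_contra hodd
    have hp2 : p = 2 := (Nat.Prime.even_iff hp).1 (Nat.not_odd_iff_even.1 hodd)
    have hq2 : Odd q := hq.odd_of_ne_two (by omega)
    have h2 : 2 ∣ (p - 1) * (q - 1) := (Nat.Odd.sub_odd hq2 odd_one).two_dvd.mul_left _
    have := Nat.dvd_gcd (show 2 ∣ p * q from hp2 ▸ Dvd.intro _ rfl) h2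
    rw [hc] at this
    omega
  refine (key _ _ k.prime_p k.prime_q k.ne k.coprime).mul
    (key _ _ k.prime_q k.prime_p k.ne.symm ?_)
  rw [mul_comm, mul_comm (k.q - 1)]; exact k.coprime

lemma totient_N : k.N.totient = k.phi := by
  rw [N, phi, Nat.totient_mul ((Nat.coprime_primes k.prime_p k.prime_q).2 k.ne),
    Nat.totient_prime k.prime_p, Nat.totient_prime k.prime_q]

lemma card_units : Fintype.card (ZMod k.N)ˣ = k.phi := by
  rw [ZMod.card_units_eq_totient, totient_N]

lemma coprime_phi : k.phi.Coprime k.N := k.coprime.symm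

lemma ciph_pow_phi (e m : ℕ) (ρ : (ZMod k.N)ˣ) :
    ciph k.N e m (ρ : ZMod k.N).val ^ k.phi = ciph k.N e (k.phi * m) 1 := by
  rw [ciph_pow]
  refine ciph_congr rfl ?_
  rw [← ZMod.natCast_eq_natCast_iff]
  have := congrArg (fun u : (ZMod k.N)ˣ => (u : ZMod k.N)) (ZMod.pow_totient ρ)
  simpa [totient_N] using this

end Key

lemma one_add_pow_eq (N e i : ℕ) (he : e ≤ 2) :
    (1 + (N : ZMod (N ^ (e + 1)))) ^ i = 1 + i * N + (i.choose 2 : ℕ) * N ^ 2 := by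
  have hN : (N : ZMod (N ^ (e + 1))) ^ 3 = 0 := by
    have h0 : (N : ZMod (N ^ (e + 1))) ^ (e + 1) = 0 := by rw [← Nat.cast_pow, ZMod.natCast_self]
    have h1 := pow_add (N : ZMod (N ^ (e + 1))) (e + 1) (2 - e)
    rwa [h0, zero_mul, show e + 1 + (2 - e) = 3 by omega] at h1
  induction i with
  | zero => simp
  | succ i ih =>
    rw [pow_succ (1 + (N : ZMod (N ^ (e + 1)))) i, ih, Nat.choose_succ_succ' i 1, Nat.choose_one_right]
    push_cast
    linear_combination ((i.choose 2 : ℕ) : ZMod (N ^ (e + 1))) * hN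

lemma dec_enc (k : Key) (m : ZMod k.N) (ρ : (ZMod k.N)ˣ) : dec k (enc m ρ) = m := by
  have hN := k.one_lt_N
  have hval : ((enc m ρ) ^ k.phi).val = 1 + (k.phi * m.val % k.N) * k.N := by
    rw [enc_eq_ciph, k.ciph_pow_phi, ciph_congr (m' := k.phi * m.val % k.N) (by
      rw [pow_one]; exact (Nat.mod_modEq _ _).symm) rfl]
    have h2 : ((k.N : ZMod (k.N ^ (1 + 1)))) ^ 2 = 0 := by
      rw [← Nat.cast_pow, ZMod.natCast_self]
    rw [ciph, one_add_pow_eq _ _ _ (by omega), h2]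
    have hlt : 1 + (k.phi * m.val % k.N) * k.N < k.N ^ 2 := by
      have := Nat.mod_lt (k.phi * m.val) (by omega : k.N > 0)
      nlinarith
    generalize k.phi * m.val % k.N = j at hlt ⊢
    rw [← Nat.mod_eq_of_lt hlt, ← ZMod.val_natCast]
    congr 1
    push_cast
    ring
  rw [dec, hval, Nat.add_sub_cancel_left, Nat.mul_div_cancel _ (by omega), ZMod.natCast_mod]
  push_cast
  have := ZMod.coe_mul_inv_eq_one k.phi k.coprime_phi
  rw [ZMod.natCast_val, ZMod.cast_id', id]
  linear_combination m * this

lemma choose_two_mul_modEq {N a b : ℕ} (hN : Odd N) (h : a ≡ b [MOD N]) :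
    a.choose 2 * N ≡ b.choose 2 * N [MOD N ^ 2] := by
  have h2 : Nat.gcd N 2 = 1 := Nat.coprime_two_right.2 hN
  have : a.choose 2 ≡ b.choose 2 [MOD N] := by
    refine Nat.ModEq.cancel_left_of_coprime (c := 2) h2 ?_
    have key : ∀ a : ℕ, (2 * a.choose 2 : ℤ) = a * (a - 1) := fun a => by
      have := Nat.triangle_succ (a - 1)
      rcases a with _ | a
      · simp
      · have h := Nat.choose_two_right (a + 1)
        have h3 := Nat.div_mul_cancel (Nat.even_mul_pred_self (a + 1)).two_dvd
        rw [← h] at h3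
        push_cast
        have : ((a + 1).choose 2 * 2 : ℤ) = (a + 1) * a := by exact_mod_cast h3
        linarith
    rw [← Int.natCast_modEq_iff]
    push_cast
    rw [key, key]
    have h' := Int.natCast_modEq_iff.2 h
    exact h'.mul (h'.sub_right 1)
  rw [pow_two]
  exact this.mul_right' N

lemma dec2_enc2 (k : Key) (m : ZMod (k.N ^ 2)) (ρ : (ZMod k.N)ˣ) : dec2 k (enc2 m ρ) = m := by
  have hN := k.one_lt_N
  set i := k.phi * m.val with hi
  obtain ⟨w, hw⟩ : ∃ w : ℕ, w = (i + i.choose 2 * k.N) % k.N ^ 2 := ⟨_, rfl⟩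
  have hval : ((enc2 m ρ) ^ k.phi).val = 1 + w * k.N := by
    rw [enc2_eq_ciph, k.ciph_pow_phi, ← hi, ciph, one_add_pow_eq _ _ _ (by omega)]
    have hlt : 1 + w * k.N < k.N ^ 3 := by
      have := Nat.mod_lt (i + i.choose 2 * k.N) (by positivity : k.N ^ 2 > 0)
      have : (w + 1) * k.N ≤ k.N ^ 2 * k.N := Nat.mul_le_mul_right _ (by omega)
      nlinarith
    rw [← Nat.mod_eq_of_lt hlt, ← ZMod.val_natCast]
    congr 1
    have : ((w * k.N : ℕ) : ZMod (k.N ^ 3)) = ((i + i.choose 2 * k.N) * k.N : ℕ) := by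
      rw [ZMod.natCast_eq_natCast_iff, hw, pow_succ]
      exact (Nat.mod_modEq _ _).mul_right' _
    push_cast at this ⊢
    rw [this]
    ring
  have h1 : (1 + w * k.N) % k.N ^ 2 = 1 + (i % k.N) * k.N := by
    have hwi : w % k.N = i % k.N := by
      rw [hw, Nat.mod_mod_of_dvd _ (Dvd.intro_left _ rfl : k.N ∣ k.N ^ 2), Nat.add_mul_mod_self_right]
    have hlt : 1 + (i % k.N) * k.N < k.N ^ 2 := by
      have := Nat.mod_lt i (by omega : k.N > 0)
      nlinarith
    rw [← Nat.mod_eq_of_lt hlt, ← hwi]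
    refine Nat.ModEq.add_left 1 ?_
    rw [pow_two]
    exact ((Nat.mod_modEq w k.N).symm).mul_right' _
  simp only [dec2, hval, h1, Nat.add_sub_cancel_left, Nat.mul_div_cancel _ (by omega : 0 < k.N)]
  have h2 : (((i % k.N).choose 2 * k.N : ℕ) : ZMod (k.N ^ 2)) = (i.choose 2 * k.N : ℕ) := by
    rw [ZMod.natCast_eq_natCast_iff]
    exact choose_two_mul_modEq k.odd_N (Nat.mod_modEq _ _)
  rw [h2, hw, ZMod.natCast_mod, hi]
  have := ZMod.coe_mul_inv_eq_one k.phi (k.coprime_phi.pow_right 2)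
  push_cast
  rw [ZMod.natCast_val, ZMod.cast_id', id]
  linear_combination m * this

/-! ## Random units -/

instance (N : ℕ) [NeZero N] (e : ℕ) : NeZero (N ^ e) := inferInstance

lemma uniform_zmod_map_val (N : ℕ) [NeZero N] :
    (PMF.uniformOfFintype (ZMod N)).map ZMod.val = uniformNat N := by
  obtain ⟨n, rfl⟩ := Nat.exists_eq_succ_of_ne_zero (NeZero.ne N)
  rw [uniformNat]
  congr 1

/-- The least residue of a random unit modulo `N`. -/
noncomputable def unitNat (N : ℕ) [NeZero N] : PMF ℕ :=
  (PMF.uniformOfFintype (ZMod N)ˣ).map fun ρ : (ZMod N)ˣ => (ρ : ZMod N).val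

/-- The statistical distance between random units and random residues. -/
noncomputable def unitErr (l : ℕ) : ℝ≥0∞ := 2 * ((2 : ℝ≥0∞) ^ l)⁻¹

lemma sd_unitNat (k : Key) {l : ℕ} (hp : 2 ^ l ≤ k.p) (hq : 2 ^ l ≤ k.q) :
    SD (unitNat k.N) (uniformNat k.N) (unitErr l) := by
  have h := SD.of_injective (i := fun ρ : (ZMod k.N)ˣ => (ρ : ZMod k.N)) Units.val_injective
    (c := k.p + k.q) (by
      rw [k.card_units, ZMod.card, Key.N, Key.phi]
      obtain ⟨a, ha⟩ := Nat.exists_eq_succ_of_ne_zero k.prime_p.ne_zero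
      obtain ⟨b, hb⟩ := Nat.exists_eq_succ_of_ne_zero k.prime_q.ne_zero
      rw [ha, hb]; simp only [Nat.succ_eq_add_one, Nat.add_sub_cancel]; nlinarith)
  have h := (h.map ZMod.val)
  rw [uniform_zmod_map_val, PMF.map_comp] at h
  refine h.mono ?_
  rw [ZMod.card, Key.N, unitErr, ← div_eq_mul_inv, ENNReal.div_le_iff_le_mul (by
    left; exact_mod_cast (Nat.mul_pos k.prime_p.pos k.prime_q.pos).ne') (by
    left; exact ENNReal.natCast_ne_top _), mul_comm, ← mul_div_assoc,
    ENNReal.le_div_iff_mul_le (by left; positivity) (by left; finiteness)]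
  have : (k.p + k.q) * 2 ^ l ≤ k.p * k.q * 2 := by nlinarith
  exact_mod_cast this

lemma unit_pow_bijective (k : Key) : Function.Bijective fun ρ : (ZMod k.N)ˣ => ρ ^ k.N := by
  have : (Nat.card (ZMod k.N)ˣ).Coprime k.N := by
    rw [Nat.card_eq_fintype_card, k.card_units]; exact k.coprime_phi
  exact (powCoprime this).bijective

/-! ## Ciphertexts as numbers -/

/-- Paillier encryption of `m` with randomness `r`. -/
def encN (N m r : ℕ) : ℕ := (1 + N) ^ m % N ^ 2 * (r ^ N % N ^ 2) % N ^ 2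

/-- Damgård–Jurik encryption of `m` with randomness `r`. -/
def enc2N (N m r : ℕ) : ℕ := (1 + N) ^ m % N ^ 3 * (r ^ N ^ 2 % N ^ 3) % N ^ 3

/-- A Damgård–Jurik ciphertext obtained from a Paillier encryption `c` of zero. -/
def raiseN (N t c : ℕ) : ℕ := (1 + N) ^ t % N ^ 3 * (c ^ N % N ^ 3) % N ^ 3

section Nat

variable {N : ℕ}

lemma pow_modEq_cube {a b : ℕ} (h : a ≡ b [MOD N ^ 2]) : a ^ N ≡ b ^ N [MOD N ^ 3] := by
  rw [Nat.modEq_iff_dvd] at h ⊢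
  push_cast at h ⊢
  rw [← (Commute.all (b : ℤ) a).geom_sum₂_mul, show (N : ℤ) ^ 3 = N * N ^ 2 by ring]
  refine mul_dvd_mul ?_ h
  have hab : (b : ℤ) ≡ a [ZMOD N] :=
    ((Int.modEq_iff_dvd.2 ((Dvd.intro_left _ (pow_two (N : ℤ)).symm).trans h)).symm)
  have : ∑ i ∈ Finset.range N, (b : ℤ) ^ i * (a : ℤ) ^ (N - 1 - i) ≡
      ∑ i ∈ Finset.range N, (a : ℤ) ^ (N - 1) [ZMOD N] := by
    refine Int.ModEq.sum fun i hi => ?_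
    have : (a : ℤ) ^ (N - 1) = (a : ℤ) ^ i * (a : ℤ) ^ (N - 1 - i) := by
      rw [← pow_add]; congr 1; have := Finset.mem_range.1 hi; omega
    rw [this]
    exact (hab.pow i).mul_right _
  rw [Finset.sum_const, Finset.card_range, nsmul_eq_mul] at this
  exact Int.modEq_zero_iff_dvd.1 (this.trans (Int.modEq_zero_iff_dvd.2 (dvd_mul_right _ _)))

lemma val_ciph_one (m r : ℕ) : (ciph N 1 m r).val = encN N m r := by
  rw [encN, ← Nat.mul_mod, ← ZMod.val_natCast, ciph]; push_cast; simp

lemma val_ciph_two (m r : ℕ) : (ciph N 2 m r).val = enc2N N m r := by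
  rw [enc2N, ← Nat.mul_mod, ← ZMod.val_natCast, ciph]; push_cast; simp

lemma val_enc (m : ZMod N) (ρ : (ZMod N)ˣ) : (enc m ρ).val = encN N m.val (ρ : ZMod N).val := by
  rw [enc_eq_ciph]; exact val_ciph_one _ _

lemma val_enc2 (m : ZMod (N ^ 2)) (ρ : (ZMod N)ˣ) :
    (enc2 m ρ).val = enc2N N m.val (ρ : ZMod N).val := by
  rw [enc2_eq_ciph]; exact val_ciph_two _ _

lemma encN_congr {m m' r r' : ℕ} (hm : m ≡ m' [MOD N]) (hr : r ≡ r' [MOD N]) :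
    encN N m r = encN N m' r' := by
  rw [← val_ciph_one, ← val_ciph_one, ciph_congr (by simpa using hm) hr]

lemma raiseN_encN (t a r : ℕ) : raiseN N t (encN N a r) = enc2N N (t + a * N) r := by
  have h1 : encN N a r ≡ (1 + N) ^ a * r ^ N [MOD N ^ 2] := by
    rw [encN, ← Nat.mul_mod]; exact Nat.mod_modEq _ _
  rw [raiseN, enc2N, ← Nat.mul_mod, ← Nat.mul_mod]
  refine ((pow_modEq_cube h1).mul_left _).trans ?_
  rw [mul_pow, ← pow_mul, ← pow_mul, ← mul_assoc, ← pow_add, pow_two]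

end Nat

/-- Raising a random ciphertext gives a uniformly random lift of a fresh ciphertext. -/
lemma raise_random_eq_lift (k : Key) (t : ℕ) :
    ((unitNat k.N).bind fun r => (uniformNat k.N).map fun a => raiseN k.N t (encN k.N a r)) =
      (unitNat k.N).bind fun r => (uniformNat k.N).map fun j => encN k.N t r + k.N ^ 2 * j := by
  have hN := k.one_lt_N
  simp only [unitNat, ← uniform_zmod_map_val, PMF.bind_map, PMF.map_comp, Function.comp_def]
  conv_rhs => rw [← uniform_bind_equiv (Equiv.ofBijective _ (unit_pow_bijective k))]
  congr 1; ext1 ρ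
  obtain ⟨w, hw⟩ : ∃ w : ℕ, w = (1 + k.N) ^ t * (ρ : ZMod k.N).val ^ k.N ^ 2 := ⟨_, rfl⟩
  have hwu : ((w : ZMod k.N)) = ((ρ ^ k.N ^ 2 : (ZMod k.N)ˣ) : ZMod k.N) := by
    rw [hw]; simp
  have hc : encN k.N t ((ρ ^ k.N : (ZMod k.N)ˣ) : ZMod k.N).val = w % k.N ^ 2 := by
    rw [Units.val_pow_eq_pow_val, encN_congr rfl (val_pow_modEq k.N _ _), encN, ← Nat.mul_mod, hw,
      pow_two, ← pow_mul]
  have hval : ∀ a : ZMod k.N, raiseN k.N t (encN k.N a.val (ρ : ZMod k.N).val) =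
      w % k.N ^ 2 + k.N ^ 2 * (((w / k.N ^ 2 : ℕ) : ZMod k.N) + a * (w : ZMod k.N)).val := fun a => by
    have hlt : w % k.N ^ 2 + k.N ^ 2 * (((w / k.N ^ 2 : ℕ) : ZMod k.N) + a * (w : ZMod k.N)).val < k.N ^ 3 := by
      have h1 := Nat.mod_lt w (by positivity : k.N ^ 2 > 0)
      have h2 := ZMod.val_lt (((w / k.N ^ 2 : ℕ) : ZMod k.N) + a * (w : ZMod k.N))
      have h3 : k.N ^ 2 * ((((w / k.N ^ 2 : ℕ) : ZMod k.N) + a * (w : ZMod k.N)).val + 1) ≤ k.N ^ 2 * k.N :=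
        Nat.mul_le_mul_left _ h2
      rw [pow_succ k.N 2]; linarith
    rw [raiseN_encN, enc2N, ← Nat.mul_mod, ← Nat.mod_eq_of_lt hlt]
    have e1 : (1 + k.N) ^ (t + a.val * k.N) * (ρ : ZMod k.N).val ^ k.N ^ 2 ≡
        w + k.N ^ 2 * (a.val * w) [MOD k.N ^ 3] := by
      rw [← ZMod.natCast_eq_natCast_iff]
      have h3 : ((k.N : ZMod (k.N ^ 3))) ^ 3 = 0 := by rw [← Nat.cast_pow, ZMod.natCast_self]
      have h4 : (1 + (k.N : ZMod (k.N ^ 3))) ^ (a.val * k.N) = 1 + a.val * k.N ^ 2 := by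
        rw [mul_comm, pow_mul]
        have h5 : (1 + (k.N : ZMod (k.N ^ 3))) ^ k.N = 1 + k.N ^ 2 := by
          rw [one_add_pow_eq k.N 2 k.N (by omega)]
          obtain ⟨c, hc⟩ := k.odd_N
          have : k.N.choose 2 = c * k.N := by
            rw [Nat.choose_two_right, hc, Nat.add_sub_cancel, mul_comm, mul_assoc,
              Nat.mul_div_cancel_left _ (by norm_num)]
          rw [this]; push_cast
          linear_combination (c : ZMod (k.N ^ 3)) * h3
        rw [h5]
        generalize a.val = j
        induction j with
        | zero => simp
        | succ j ih => rw [pow_succ (1 + (k.N : ZMod (k.N ^ 3)) ^ 2) j, ih]; push_cast; linear_combination (j * k.N : ZMod (k.N ^ 3)) * h3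
      rw [hw]; push_cast
      rw [pow_add, h4]; ring
    refine e1.trans ?_
    have e2 : (((w / k.N ^ 2 : ℕ) : ZMod k.N) + a * (w : ZMod k.N)).val ≡ w / k.N ^ 2 + a.val * w [MOD k.N] := by
      rw [← ZMod.natCast_eq_natCast_iff]; simp
    have e3 := (e2.mul_left' (k.N ^ 2)).add_left (w % k.N ^ 2)
    rw [← pow_succ] at e3
    refine Nat.ModEq.trans ?_ e3.symm
    rw [mul_add, ← add_assoc, Nat.mod_add_div]
  have hbij : Function.Bijective fun a : ZMod k.N => ((w / k.N ^ 2 : ℕ) : ZMod k.N) + a * (w : ZMod k.N) := by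
    rw [hwu]
    exact (Equiv.addLeft _).bijective.comp (Units.mulRight (ρ ^ k.N ^ 2)).bijective
  simp only [hval, Equiv.ofBijective_apply, hc]
  conv_rhs => rw [← uniform_map_equiv (Equiv.ofBijective _ hbij)]
  rw [PMF.map_comp]; rfl

/-! ## Programs for the cryptosystems -/

namespace Prog

/-- Apply a binary operation to two results. -/
def bin (o : BinOp) (p q : Prog) : Prog := seq (fork p q) (op o)

/-- `p x ^ q x mod n x`. -/
def powModOf (n p q : Prog) : Prog := seq (fork n (fork p q)) powMod

def square (p : Prog) : Prog := bin .mul p p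

def cube (p : Prog) : Prog := bin .mul (bin .mul p p) p

/-- `p x` if `sel x = n`, and `q x` otherwise. -/
def caseOn (sel : Prog) (n : ℕ) (p q : Prog) : Prog :=
  seq (fork (bin .eq sel (const n)) skip) (ite p q)

/-- `(N, m) ↦ (1 + N) ^ m * r ^ N mod N²` with `r` random. -/
def encP : Prog :=
  bin .mod (bin .mul (powModOf (square fst) (bin .add (const 1) fst) snd)
    (powModOf (square fst) (seq fst rand) fst)) (square fst)

/-- `(N, m) ↦ (1 + N) ^ m * r ^ (N²) mod N³` with `r` random. -/
def enc2P : Prog :=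
  bin .mod (bin .mul (powModOf (cube fst) (bin .add (const 1) fst) snd)
    (powModOf (cube fst) (seq fst rand) (square fst))) (cube fst)

/-- `N ↦` an encryption of a random message. -/
def encRandP : Prog := seq (fork skip rand) encP

/-- `(N, (t, c)) ↦ (1 + N) ^ t * c ^ N mod N³`. -/
def raiseP : Prog :=
  bin .mod (bin .mul (powModOf (cube fst) (bin .add (const 1) fst) (seq snd fst))
    (powModOf (cube fst) (seq snd snd) fst)) (cube fst)

/-- `(N, c) ↦ c + N² * j` with `j` random. -/
def liftP : Prog := bin .add snd (bin .mul (square fst) (seq fst rand))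

lemma PPT.bin {p q : Prog} (o : BinOp) (hp : p.PPT) (hq : q.PPT) : (bin o p q).PPT :=
  (hp.fork hq).seq (ppt_op o)

lemma PPT.powModOf {n p q : Prog} (hn : n.PPT) (hp : p.PPT) (hq : q.PPT) :
    (powModOf n p q).PPT := (hn.fork (hp.fork hq)).seq ppt_powMod

lemma PPT.square {p : Prog} (hp : p.PPT) : (square p).PPT := hp.bin _ hp

lemma PPT.cube {p : Prog} (hp : p.PPT) : (cube p).PPT := (hp.bin _ hp).bin _ hp

lemma PPT.caseOn {sel p q : Prog} (n : ℕ) (hs : sel.PPT) (hp : p.PPT) (hq : q.PPT) :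
    (caseOn sel n p q).PPT := ((hs.bin _ (ppt_const n)).fork ppt_skip).seq (hp.ite hq)

lemma ppt_encP : encP.PPT :=
  ((ppt_fst.square.powModOf ((ppt_const 1).bin _ ppt_fst) ppt_snd).bin _
    (ppt_fst.square.powModOf (ppt_fst.seq ppt_rand) ppt_fst)).bin _ ppt_fst.square

lemma ppt_enc2P : enc2P.PPT :=
  ((ppt_fst.cube.powModOf ((ppt_const 1).bin _ ppt_fst) ppt_snd).bin _
    (ppt_fst.cube.powModOf (ppt_fst.seq ppt_rand) ppt_fst.square)).bin _ ppt_fst.cube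

lemma ppt_encRandP : encRandP.PPT := (ppt_skip.fork ppt_rand).seq ppt_encP

lemma ppt_raiseP : raiseP.PPT :=
  ((ppt_fst.cube.powModOf ((ppt_const 1).bin _ ppt_fst) (ppt_snd.seq ppt_fst)).bin _
    (ppt_fst.cube.powModOf (ppt_snd.seq ppt_snd) ppt_fst)).bin _ ppt_fst.cube

lemma ppt_liftP : liftP.PPT :=
  ppt_snd.bin _ (ppt_fst.square.bin _ (ppt_fst.seq ppt_rand))

lemma outO_bin (O : ℕ → ℕ) (o : BinOp) (p q : Prog) (x : Data) :
    outO O (bin o p q) x = (outO O p x).bind fun a => (outO O q x).bind fun b =>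
      outO O (op o) (.pair a b) := by
  simp only [bin, outO_seq, outO_fork, PMF.bind_bind, PMF.pure_bind]

lemma outO_powModOf (O : ℕ → ℕ) (n p q : Prog) (x : Data) :
    outO O (powModOf n p q) x = (outO O n x).bind fun c => (outO O p x).bind fun a =>
      (outO O q x).bind fun b => outO O powMod (.pair c (.pair a b)) := by
  simp only [powModOf, outO_seq, outO_fork, PMF.bind_bind, PMF.pure_bind]

lemma outO_caseOn (O : ℕ → ℕ) {sel : Prog} (n : ℕ) (p q : Prog) {x : Data} {c : ℕ}
    (h : outO O sel x = PMF.pure (.nat c)) :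
    outO O (caseOn sel n p q) x = if c = n then outO O p x else outO O q x := by
  simp only [caseOn, outO_seq, outO_fork, outO_bin, h, PMF.pure_bind, outO_const, outO_op,
    BinOp.eval, outO_skip, outO_ite]
  split_ifs <;> simp_all

section

variable (O : ℕ → ℕ) (N : ℕ) [NeZero N]

lemma outO_square {p : Prog} {x : Data} {n : ℕ} (h : outO O p x = PMF.pure (.nat n)) :
    outO O (square p) x = PMF.pure (.nat (n ^ 2)) := by
  simp only [square, outO_bin, h, PMF.pure_bind, outO_op, BinOp.eval, pow_two]

lemma outO_cube {p : Prog} {x : Data} {n : ℕ} (h : outO O p x = PMF.pure (.nat n)) :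
    outO O (cube p) x = PMF.pure (.nat (n ^ 3)) := by
  simp only [cube, outO_bin, h, PMF.pure_bind, outO_op, BinOp.eval, pow_succ, pow_zero, one_mul]

lemma outO_encP (m : ℕ) :
    outO O encP (.pair (.nat N) (.nat m)) =
      (uniformNat N).bind fun r => PMF.pure (.nat (encN N m r)) := by
  have hs := outO_square O (p := fst) (x := .pair (.nat N) (.nat m)) (outO_fst _ _)
  simp only [encP, outO_bin, outO_powModOf, hs, outO_seq, outO_fst, outO_snd, Data.left_pair,
    Data.right_pair, PMF.bind_bind, PMF.pure_bind, outO_const, outO_op, BinOp.eval, outO_powMod,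
    outO_rand, encN]

lemma outO_enc2P (m : ℕ) :
    outO O enc2P (.pair (.nat N) (.nat m)) =
      (uniformNat N).bind fun r => PMF.pure (.nat (enc2N N m r)) := by
  have hs := outO_square O (p := fst) (x := .pair (.nat N) (.nat m)) (outO_fst _ _)
  have hc := outO_cube O (p := fst) (x := .pair (.nat N) (.nat m)) (outO_fst _ _)
  simp only [enc2P, outO_bin, outO_powModOf, hs, hc, outO_seq, outO_fst, outO_snd, Data.left_pair,
    Data.right_pair, PMF.bind_bind, PMF.pure_bind, outO_const, outO_op, BinOp.eval, outO_powMod,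
    outO_rand, enc2N]

lemma outO_encRandP :
    outO O encRandP (.nat N) = (uniformNat N).bind fun m =>
      (uniformNat N).bind fun r => PMF.pure (.nat (encN N m r)) := by
  simp only [encRandP, outO_seq, outO_fork, outO_skip, outO_rand, PMF.bind_bind, PMF.pure_bind,
    outO_encP]

lemma outO_raiseP (t c : ℕ) :
    outO O raiseP (.pair (.nat N) (.pair (.nat t) (.nat c))) =
      PMF.pure (.nat (raiseN N t c)) := by
  have hc := outO_cube O (p := fst) (x := .pair (.nat N) (.pair (.nat t) (.nat c))) (outO_fst _ _)
  simp only [raiseP, outO_bin, outO_powModOf, hc, outO_seq, outO_fst, outO_snd, Data.left_pair,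
    Data.right_pair, PMF.pure_bind, outO_const, outO_op, BinOp.eval, outO_powMod, raiseN]

lemma outO_liftP (c : ℕ) :
    outO O liftP (.pair (.nat N) (.nat c)) =
      (uniformNat N).bind fun j => PMF.pure (.nat (c + N ^ 2 * j)) := by
  have hs := outO_square O (p := fst) (x := .pair (.nat N) (.nat c)) (outO_fst _ _)
  simp only [liftP, outO_bin, hs, outO_seq, outO_fst, outO_snd, Data.left_pair,
    Data.right_pair, PMF.bind_bind, PMF.pure_bind, outO_op, BinOp.eval, outO_rand]

end

end Prog

/-! ## A stack machine that builds data from ciphertexts -/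

/-- Where a number comes from. -/
inductive Src where
  | rnd | plain (n : ℕ) | pk | enc (m : ℕ)

/-- What is done with it. -/
inductive Post where
  | lift | none | raise (t : ℕ)

/-- Instructions: combine the two topmost entries of the stack, push a number, or push a number
computed from the challenge. -/
inductive Ins where
  | pair | leaf (s : Src) (p : Post) | chal (p : Post)

/-- The number named by `s`, when units are drawn from `U`. -/
noncomputable def Src.sem (U : PMF ℕ) (N : ℕ) [NeZero N] : Src → PMF ℕ
  | rnd => (uniformNat N).bind fun m => U.bind fun r => PMF.pure (encN N m r)
  | plain n => PMF.pure n
  | pk => PMF.pure N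
  | enc m => U.bind fun r => PMF.pure (encN N m r)

noncomputable def Post.sem (N : ℕ) [NeZero N] : Post → ℕ → PMF ℕ
  | lift, c => (uniformNat N).bind fun j => PMF.pure (c + N ^ 2 * j)
  | none, c => PMF.pure c
  | raise t, c => PMF.pure (raiseN N t c)

noncomputable def leafSem (U : PMF ℕ) (N : ℕ) [NeZero N] (s : Src) (p : Post) : PMF ℕ :=
  (s.sem U N).bind (p.sem N)

def pairTop (st : Data) : Data := .pair (.pair st.right.left st.left) st.right.right

noncomputable def Ins.sem (U : PMF ℕ) (N c : ℕ) [NeZero N] : Ins → Data → PMF Data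
  | pair, st => PMF.pure (pairTop st)
  | leaf s p, st => (leafSem U N s p).bind fun v => PMF.pure (.pair (.nat v) st)
  | chal p, st => (p.sem N c).bind fun v => PMF.pure (.pair (.nat v) st)

noncomputable def runIns (U : PMF ℕ) (N c : ℕ) [NeZero N] : List Ins → Data → PMF Data
  | [], st => PMF.pure st
  | i :: L, st => (i.sem U N c st).bind (runIns U N c L)

def Src.encode : Src → Data
  | rnd => .pair (.nat 0) (.nat 0)
  | plain n => .pair (.nat 1) (.nat n)
  | pk => .pair (.nat 2) (.nat 0)
  | enc m => .pair (.nat 3) (.nat m)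

def Post.encode : Post → Data
  | lift => .pair (.nat 0) (.nat 0)
  | none => .pair (.nat 1) (.nat 0)
  | raise t => .pair (.nat 2) (.nat t)

def Ins.encode : Ins → Data
  | pair => .pair (.nat 0) (.nat 0)
  | leaf s p => .pair (.nat 1) (.pair s.encode p.encode)
  | chal p => .pair (.nat 1) (.pair (.pair (.nat 4) (.nat 0)) p.encode)

namespace Prog

/-- `((N, c), s) ↦` the number named by `s`. -/
def srcP : Prog :=
  let tag := seq snd fst
  let arg := seq snd snd
  let N := seq fst fst
  caseOn tag 0 (seq N encRandP) (caseOn tag 1 arg (caseOn tag 2 N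
    (caseOn tag 3 (seq (fork N arg) encP) (seq fst snd))))

/-- `(N, (p, c)) ↦` the result of `p` on `c`. -/
def postP : Prog :=
  let tag := seq snd (seq fst fst)
  let arg := seq snd (seq fst snd)
  let c := seq snd snd
  caseOn tag 0 (seq (fork fst c) liftP) (caseOn tag 1 c (seq (fork fst (fork arg c)) raiseP))

/-- `((N, c), i) ↦` the number that `i` pushes, if any. -/
def valP : Prog :=
  caseOn (seq snd fst) 0 (const 0)
    (seq (fork (seq fst fst) (fork (seq snd (seq snd snd))
      (seq (fork fst (seq snd (seq snd fst))) srcP))) postP)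

/-- `(i, (v, st)) ↦` the new stack. -/
def pushP : Prog :=
  caseOn (seq fst fst) 0
    (seq (seq snd snd) (fork (fork (seq snd fst) fst) (seq snd snd))) snd

/-- `((N, c), (L, st)) ↦` the stack after execution of the instructions `L`. -/
def machineP : Prog := fold valP pushP

lemma ppt_srcP : srcP.PPT := by
  have tag := ppt_snd.seq ppt_fst
  have arg := ppt_snd.seq ppt_snd
  have N := ppt_fst.seq ppt_fst
  exact tag.caseOn _ (N.seq ppt_encRandP) (tag.caseOn _ arg (tag.caseOn _ N
    (tag.caseOn _ ((N.fork arg).seq ppt_encP) (ppt_fst.seq ppt_snd))))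

lemma ppt_postP : postP.PPT := by
  have tag := ppt_snd.seq (ppt_fst.seq ppt_fst)
  have arg := ppt_snd.seq (ppt_fst.seq ppt_snd)
  have c := ppt_snd.seq ppt_snd
  exact tag.caseOn _ ((ppt_fst.fork c).seq ppt_liftP)
    (tag.caseOn _ c ((ppt_fst.fork (arg.fork c)).seq ppt_raiseP))

lemma ppt_valP : valP.PPT :=
  (ppt_snd.seq ppt_fst).caseOn _ (ppt_const 0)
    (((ppt_fst.seq ppt_fst).fork ((ppt_snd.seq (ppt_snd.seq ppt_snd)).fork
      ((ppt_fst.fork (ppt_snd.seq (ppt_snd.seq ppt_fst))).seq ppt_srcP))).seq ppt_postP)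

lemma ppt_pushP : pushP.PPT :=
  (ppt_fst.seq ppt_fst).caseOn _ ((ppt_snd.seq ppt_snd).seq
    (((ppt_snd.seq ppt_fst).fork ppt_fst).fork (ppt_snd.seq ppt_snd))) ppt_snd

lemma outO_caseOn_cases (O : ℕ → ℕ) (sel : Prog) (n : ℕ) (p q : Prog) (x y : Data)
    (hs : ∃ d, outO O sel x = PMF.pure d) (hy : y ∈ (outO O (caseOn sel n p q) x).support) :
    y ∈ (outO O p x).support ∨ y ∈ (outO O q x).support ∨ y = .nat 0 := by
  obtain ⟨d, hd⟩ := hs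
  rcases d with c | ⟨a, b⟩
  · rw [outO_caseOn O n p q hd] at hy
    split_ifs at hy <;> tauto
  · have : outO O (op .eq) (.pair (.pair a b) (.nat n)) = PMF.pure (.nat 0) := outO_instr rfl
    simp only [caseOn, outO_seq, outO_fork, outO_bin, hd, PMF.pure_bind, outO_const, this,
      outO_skip, outO_ite, if_true] at hy
    tauto

lemma size_pushP (O : ℕ → ℕ) (x y : Data) (hy : y ∈ (outO O pushP x).support) :
    y.size ≤ x.size + 5 := by
  rcases outO_caseOn_cases O _ _ _ _ x y ⟨x.left.left, by simp [outO_seq, outO_fst]⟩ hy with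
    h | h | h
  · simp only [outO_seq, outO_fork, outO_fst, outO_snd, PMF.pure_bind,
      PMF.mem_support_pure_iff] at h
    subst h
    have h0 := x.size_right_le
    have h1 := x.right.size_right_le
    generalize x.right.right = y at *
    generalize x.right = z at *
    rcases y with _ | ⟨a, _ | ⟨b, c⟩⟩ <;>
      simp only [Data.size, Data.left, Data.right, Nat.size_zero] at h1 ⊢ <;> omega
  · simp only [outO_snd, PMF.mem_support_pure_iff] at h
    subst h
    have := x.size_right_le
    omega
  · subst h; simp [Data.size]

lemma ppt_machineP : machineP.PPT := ppt_valP.fold ppt_pushP 5 size_pushP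

lemma outO_srcP_chal (O : ℕ → ℕ) (N c : ℕ) :
    outO O srcP (.pair (.pair (.nat N) (.nat c)) (.pair (.nat 4) (.nat 0))) =
      PMF.pure (.nat c) := by
  have tag : ∀ (n a : ℕ) (e : Data), outO O (seq snd fst) (.pair e (.pair (.nat n) (.nat a))) =
      PMF.pure (.nat n) := fun n a e => by simp [outO_seq, outO_fst, outO_snd]
  simp [srcP, outO_caseOn O _ _ _ (tag _ _ _), outO_seq, outO_fst, outO_snd]

variable (O : ℕ → ℕ) (N c : ℕ) [NeZero N]

lemma outO_srcP (s : Src) :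
    outO O srcP (.pair (.pair (.nat N) (.nat c)) s.encode) =
      (s.sem (uniformNat N) N).bind fun v => PMF.pure (.nat v) := by
  have tag : ∀ (n a : ℕ) (e : Data), outO O (seq snd fst) (.pair e (.pair (.nat n) (.nat a))) =
      PMF.pure (.nat n) := fun n a e => by simp [outO_seq, outO_fst, outO_snd]
  cases s <;> simp [srcP, outO_caseOn O _ _ _ (tag _ _ _), Src.encode, Src.sem, outO_seq,
    outO_fork, outO_fst, outO_snd, outO_encRandP, outO_encP]

lemma outO_postP (p : Post) :
    outO O postP (.pair (.nat N) (.pair p.encode (.nat c))) =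
      (p.sem N c).bind fun v => PMF.pure (.nat v) := by
  have tag : ∀ (n a : ℕ) (e f : Data),
      outO O (seq snd (seq fst fst)) (.pair e (.pair (.pair (.nat n) (.nat a)) f)) =
        PMF.pure (.nat n) := fun n a e f => by simp [outO_seq, outO_fst, outO_snd]
  cases p <;> simp [postP, outO_caseOn O _ _ _ (tag _ _ _ _), Post.encode, Post.sem, outO_seq,
    outO_fork, outO_fst, outO_snd, outO_liftP, outO_raiseP]

lemma outO_machine_step (i : Ins) (st : Data) :
    ((outO O valP (.pair (.pair (.nat N) (.nat c)) i.encode)).bind fun v =>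
      outO O pushP (.pair i.encode (.pair v st))) = i.sem (uniformNat N) N c st := by
  have tag : ∀ (n : ℕ) (e f : Data), outO O (seq snd fst) (.pair e (.pair (.nat n) f)) =
      PMF.pure (.nat n) := fun n e f => by simp [outO_seq, outO_fst, outO_snd]
  have tag' : ∀ (n : ℕ) (e f : Data), outO O (seq fst fst) (.pair (.pair (.nat n) f) e) =
      PMF.pure (.nat n) := fun n e f => by simp [outO_seq, outO_fst]
  cases i with
  | pair =>
    simp [valP, pushP, outO_caseOn O _ _ _ (tag _ _ _), outO_caseOn O _ _ _ (tag' _ _ _),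
      Ins.encode, Ins.sem, outO_const, outO_seq, outO_fork, outO_fst, outO_snd, pairTop]
  | leaf s p =>
    simp [valP, pushP, outO_caseOn O _ _ _ (tag _ _ _), outO_caseOn O _ _ _ (tag' _ _ _),
      Ins.encode, Ins.sem, outO_seq, outO_fork, outO_fst, outO_snd, outO_srcP, outO_postP,
      leafSem, PMF.bind_bind]
  | chal p =>
    simp [valP, pushP, outO_caseOn O _ _ _ (tag _ _ _), outO_caseOn O _ _ _ (tag' _ _ _),
      Ins.encode, Ins.sem, outO_seq, outO_fork, outO_fst, outO_snd, outO_srcP_chal, outO_postP,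
      PMF.bind_bind]

lemma outO_machineP (L : List Ins) (st : Data) :
    outO O machineP (.pair (.pair (.nat N) (.nat c)) (.pair (Data.ofList (L.map Ins.encode)) st)) =
      runIns (uniformNat N) N c L st := by
  rw [machineP, outO_fold]
  induction L generalizing st with
  | nil => rfl
  | cons i L ih =>
    simp only [List.map_cons, foldSem, runIns, ← outO_machine_step O N c i st, PMF.bind_bind]
    congr 1; ext1 v; congr 1; ext1 st'; exact ih st'

end Prog

/-! ## Ensembles built from ciphertexts are pseudo-random -/

/-- Length of the encoding of a list of instructions. -/
def codeSize (L : List Ins) : ℕ := (Data.ofList (L.map Ins.encode)).size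

lemma codeSize_cons (i : Ins) (L : List Ins) :
    codeSize (i :: L) = i.encode.size + codeSize L + 1 := rfl

lemma codeSize_append (L L' : List Ins) : codeSize (L ++ L') + 1 = codeSize L + codeSize L' := by
  induction L with
  | nil => simp [codeSize, Data.ofList, Data.size]; omega
  | cons i L ih => rw [List.cons_append, codeSize_cons, codeSize_cons]; omega

lemma length_le_codeSize (L : List Ins) : L.length ≤ codeSize L := by
  have := Prog.length_le_size_ofList (L.map Ins.encode)
  rwa [List.length_map] at this

lemma runIns_append (U : PMF ℕ) (N c : ℕ) [NeZero N] (L L' : List Ins) (st : Data) :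
    runIns U N c (L ++ L') st = (runIns U N c L st).bind (runIns U N c L') := by
  induction L generalizing st with
  | nil => simp [runIns]
  | cons i L ih =>
    simp only [List.cons_append, runIns, PMF.bind_bind]
    congr 1; ext1 st'; exact ih st'

/-- The instructions do not use the challenge. -/
def NoChal (L : List Ins) : Prop := ∀ i ∈ L, ∀ p, i ≠ .chal p

lemma runIns_noChal (U : PMF ℕ) (N c c' : ℕ) [NeZero N] {L : List Ins} (h : NoChal L) (st : Data) :
    runIns U N c L st = runIns U N c' L st := by
  induction L generalizing st with
  | nil => rfl
  | cons i L ih =>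
    have hi : i.sem U N c st = i.sem U N c' st := by
      cases i with
      | chal p => exact absurd rfl (h (.chal p) (by simp) p)
      | _ => rfl
    simp only [runIns, hi]
    congr 1; ext1 st'
    exact ih (fun j hj => h j (by simp [hj])) st'

/-- The result of a run with a challenge drawn from `C`. -/
noncomputable def machine (N : ℕ) [NeZero N] (C : PMF ℕ) (L : List Ins) : PMF Data :=
  (C.bind fun c => runIns (uniformNat N) N c L (.nat 0)).map Data.left

namespace Prog

/-- The challenge messages: `m` given in the advice, and a random one. -/
def cpaChoose : Prog :=
  fork (fork (seq snd (seq fst (seq snd snd))) (seq (seq snd snd) rand)) skip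

/-- Run the instructions in the advice on the challenge, and then the distinguisher `D`. -/
def cpaGuess (D : Prog) : Prog :=
  let adv := seq fst (seq snd fst)
  let N := seq fst (seq snd snd)
  seq (fork (seq fst fst) (fork (seq adv fst)
    (seq (seq (fork (fork N snd) (fork (seq adv (seq snd fst)) (const 0))) machineP) fst))) D

lemma ppt_cpaChoose : cpaChoose.PPT :=
  ((ppt_snd.seq (ppt_fst.seq (ppt_snd.seq ppt_snd))).fork
    ((ppt_snd.seq ppt_snd).seq ppt_rand)).fork ppt_skip

lemma ppt_cpaGuess {D : Prog} (hD : D.PPT) : (cpaGuess D).PPT := by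
  have adv := ppt_fst.seq (ppt_snd.seq ppt_fst)
  have N := ppt_fst.seq (ppt_snd.seq ppt_snd)
  exact ((ppt_fst.seq ppt_fst).fork ((adv.seq ppt_fst).fork
    ((((N.fork ppt_snd).fork ((adv.seq (ppt_snd.seq ppt_fst)).fork (ppt_const 0))).seq
      ppt_machineP).seq ppt_fst))).seq hD

lemma out_cpaChoose (u a L : Data) (m N : ℕ) [NeZero N] :
    out cpaChoose (.pair u (.pair (.pair a (.pair L (.nat m))) (.nat N))) =
      (uniformNat N).bind fun j => PMF.pure (.pair (.pair (.nat m) (.nat j))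
        (.pair u (.pair (.pair a (.pair L (.nat m))) (.nat N)))) := by
  simp [out, cpaChoose, outO_fork, outO_seq, outO_fst, outO_snd, outO_rand, outO_skip]

lemma out_cpaGuess (D : Prog) (u a : Data) (L : List Ins) (m N c : ℕ) [NeZero N] :
    out (cpaGuess D) (.pair (.pair u (.pair (.pair a (.pair (Data.ofList (L.map Ins.encode))
      (.nat m))) (.nat N))) (.nat c)) =
      ((runIns (uniformNat N) N c L (.nat 0)).map Data.left).bind fun x =>
        D.out (.pair u (.pair a x)) := by
  simp [out, cpaGuess, outO_fork, outO_seq, outO_fst, outO_snd, outO_const, outO_machineP,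
    PMF.bind_bind, PMF.bind_map, Function.comp_def]

end Prog

section CPA

variable {K : ℕ → PMF Key}

/-- Under CPA-security, the challenge may be replaced by an encryption of a random message. -/
lemma compIndist_challenge (hE : PaillierCPASecure K) (L : ℕ → List Ins) (m : ℕ → ℕ)
    (hL : PolyBounded fun l => codeSize (L l)) (hm : PolyBounded fun l => Nat.size (m l)) :
    CompIndist
      (fun l => (K l).bind fun k => machine k.N ((Src.enc (m l)).sem (unitNat k.N) k.N) (L l))
      (fun l => (K l).bind fun k => machine k.N (Src.rnd.sem (unitNat k.N) k.N) (L l)) := by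
  intro D hD a ha
  let a' : ℕ → Data := fun l =>
    .pair (a l) (.pair (Data.ofList ((L l).map Ins.encode)) (.nat (m l)))
  have ha' : PolyBounded fun l => (a' l).size := by
    refine ((ha.add (hL.add hm)).add (PolyBounded.const 3)).mono fun l => ?_
    simp only [a', Data.size, codeSize]; omega
  refine (hE _ _ Prog.ppt_cpaChoose (Prog.ppt_cpaGuess hD) a' ha').mono fun l => ?_
  rw [abs_abs, abs_sub_comm]
  refine le_of_eq ?_
  congr 3
  · simp only [cpaGame, PMF.bind_bind, a', Key.pkData, Prog.out_cpaChoose, PMF.pure_bind,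
      parseChallenge, zdata, Prog.out_cpaGuess, machine, PMF.bind_map, PMF.map_bind, Src.sem,
      unitNat, if_true, Function.comp_def, val_enc]
    congr 1; ext1 k; congr 1; ext1 j; congr 1; ext1 ρ
    rw [encN_congr (val_natCast_modEq k.N j) rfl]
  · simp only [cpaGame, PMF.bind_bind, a', Key.pkData, Prog.out_cpaChoose, PMF.pure_bind,
      parseChallenge, zdata, Prog.out_cpaGuess, machine, PMF.bind_map, PMF.map_bind, Src.sem,
      unitNat, Bool.false_eq_true, if_false, Function.comp_def, val_enc, PMF.bind_const]
    congr 1; ext1 k; congr 1; ext1 ρ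
    rw [encN_congr (val_natCast_modEq k.N (m l)) rfl]

/-- The result of a run in which one instruction pushes a number drawn from `V`. -/
noncomputable def slot (N : ℕ) [NeZero N] (L : List Ins) (V : PMF ℕ) (L' : List Ins) : PMF Data :=
  (runIns (uniformNat N) N 0 L (.nat 0)).bind fun st => V.bind fun v =>
    (runIns (uniformNat N) N 0 L' (.pair (.nat v) st)).map Data.left

lemma machine_chal (N : ℕ) [NeZero N] (C : PMF ℕ) {L L' : List Ins} (h : NoChal L)
    (h' : NoChal L') (p : Post) :
    machine N C (L ++ .chal p :: L') = slot N L (C.bind (p.sem N)) L' := by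
  simp only [machine, slot, runIns_append, runIns, Ins.sem, PMF.map_bind, PMF.bind_bind,
    PMF.pure_bind]
  conv_rhs => rw [PMF.bind_comm]
  congr 1; ext1 c
  rw [runIns_noChal _ N c 0 h]
  congr 1; ext1 st; congr 1; ext1 v
  rw [runIns_noChal _ N c 0 h']

lemma machine_leaf (N c : ℕ) [NeZero N] {L L' : List Ins} (h : NoChal L)
    (h' : NoChal L') (s : Src) (p : Post) :
    machine N (PMF.pure c) (L ++ .leaf s p :: L') =
      slot N L (leafSem (uniformNat N) N s p) L' := by
  simp only [machine, slot, runIns_append, runIns, Ins.sem, PMF.map_bind, PMF.bind_bind,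
    PMF.pure_bind]
  rw [runIns_noChal _ N c 0 h]
  congr 1; ext1 st; congr 1; ext1 v
  rw [runIns_noChal _ N c 0 h']

lemma SD.slot {N : ℕ} [NeZero N] {V V' : PMF ℕ} {ε : ℝ≥0∞} (h : SD V V' ε) (L L' : List Ins) :
    SD (slot N L V L') (slot N L V' L') ε := SD.bind_const _ fun _ _ => h.bind_left _

lemma unitErr_eq (l : ℕ) : unitErr l = ENNReal.ofReal (2 * ((2 : ℝ) ^ l)⁻¹) := by
  rw [ENNReal.ofReal_mul (by norm_num), ENNReal.ofReal_inv_of_pos (by positivity),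
    ENNReal.ofReal_pow (by norm_num), unitErr]
  simp

lemma sd_leafSem (k : Key) {l : ℕ} (hp : 2 ^ l ≤ k.p) (hq : 2 ^ l ≤ k.q) (s : Src) (p : Post) :
    SD (leafSem (unitNat k.N) k.N s p) (leafSem (uniformNat k.N) k.N s p) (unitErr l) := by
  refine SD.bind_left ?_ _
  cases s with
  | rnd => exact SD.bind_const _ fun _ _ => (sd_unitNat k hp hq).bind_left _
  | enc m => exact (sd_unitNat k hp hq).bind_left _
  | _ => exact SD.refl _ _

/-- The instruction that pushes a Damgård–Jurik encryption of `t` pushes a random number instead. -/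
def Ins.hide : Ins → Ins
  | leaf (.enc 0) (.raise _) => leaf .rnd .lift
  | i => i

lemma Post.raise_rnd (k : Key) (t : ℕ) :
    leafSem (unitNat k.N) k.N .rnd (.raise t) = leafSem (unitNat k.N) k.N (.enc t) .lift := by
  have := raise_random_eq_lift k t
  simp only [leafSem, Src.sem, Post.sem, PMF.bind_bind, PMF.pure_bind]
  rw [PMF.bind_comm]
  simpa only [← PMF.bind_pure_comp, Function.comp_def] using this

lemma compIndist_raise (hK : IsKeyGen K) (hE : PaillierCPASecure K) (L L' : ℕ → List Ins)
    (t : ℕ → ℕ) (h : ∀ l, NoChal (L l)) (h' : ∀ l, NoChal (L' l))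
    (hL : PolyBounded fun l => codeSize (L l)) (hL' : PolyBounded fun l => codeSize (L' l))
    (ht : PolyBounded fun l => Nat.size (t l)) :
    CompIndist
      (fun l => (K l).bind fun k => slot k.N (L l)
        (leafSem (uniformNat k.N) k.N (.enc 0) (.raise (t l))) (L' l))
      (fun l => (K l).bind fun k => slot k.N (L l)
        (leafSem (uniformNat k.N) k.N .rnd .lift) (L' l)) := by
  have hneg : Negligible fun l => 2 * ((2 : ℝ) ^ l)⁻¹ := negligible_two_pow.const_mul 2
  have stat : ∀ (s : Src) (p : ℕ → Post), CompIndist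
      (fun l => (K l).bind fun k => slot k.N (L l) (leafSem (uniformNat k.N) k.N s (p l)) (L' l))
      (fun l => (K l).bind fun k => slot k.N (L l) (leafSem (unitNat k.N) k.N s (p l)) (L' l)) := by
    intro s p
    refine CompIndist.of_SD hneg (fun l => by positivity) fun l => ?_
    rw [← unitErr_eq]
    refine SD.bind_const _ fun k hk => ((sd_leafSem k ?_ ?_ s (p l)).slot _ _).symm
    · exact (hK.1 l k hk).1
    · exact (hK.1 l k hk).2
  have size : ∀ p : ℕ → Post, PolyBounded (fun l => (p l).encode.size) →
      PolyBounded fun l => codeSize (L l ++ .chal (p l) :: L' l) := fun p hp =>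
    ((hL.add (hL'.add hp)).add (PolyBounded.const 20)).mono fun l => by
      have := codeSize_append (L l) (.chal (p l) :: L' l)
      rw [codeSize_cons] at this
      simp only [Ins.encode, Data.size, Nat.size_zero] at this
      have h1 : Nat.size 1 = 1 := rfl
      have h4 : Nat.size 4 = 3 := rfl
      omega
  have cpa : ∀ (m : ℕ → ℕ) (p : ℕ → Post), PolyBounded (fun l => Nat.size (m l)) →
      PolyBounded (fun l => (p l).encode.size) → CompIndist
      (fun l => (K l).bind fun k => slot k.N (L l)
        (leafSem (unitNat k.N) k.N (.enc (m l)) (p l)) (L' l))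
      (fun l => (K l).bind fun k => slot k.N (L l)
        (leafSem (unitNat k.N) k.N .rnd (p l)) (L' l)) := by
    intro m p hm hp
    have := compIndist_challenge hE _ m (size p hp) hm
    simp only [machine_chal _ _ (h _) (h' _)] at this
    exact this
  have h1 := cpa (fun _ => 0) (fun l => .raise (t l)) (PolyBounded.const _)
    ((ht.add (PolyBounded.const 10)).mono fun l => by
      have : Nat.size 2 = 2 := rfl
      simp only [Post.encode, Data.size]; omega)
  have h2 := cpa t (fun _ => .lift) ht (PolyBounded.const _)
  simp only [Post.raise_rnd] at h1
  exact (stat (.enc 0) fun l => .raise (t l)).trans (h1.trans (h2.trans (stat .rnd fun _ => .lift).symm))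

lemma noChal_map_hide {L : List Ins} (h : NoChal L) : NoChal (L.map Ins.hide) := by
  intro i hi p
  obtain ⟨j, hj, rfl⟩ := List.mem_map.1 hi
  have := h j hj p
  unfold Ins.hide
  split <;> simp_all

lemma size_encode_hide_le (i : Ins) : i.hide.encode.size ≤ i.encode.size := by
  unfold Ins.hide
  split
  · have h2 : Nat.size 2 = 2 := rfl
    have h3 : Nat.size 3 = 2 := rfl
    simp only [Ins.encode, Src.encode, Post.encode, Data.size, Nat.size_zero]
    omega
  · exact le_rfl

lemma codeSize_map_hide_le (L : List Ins) : codeSize (L.map Ins.hide) ≤ codeSize L := by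
  induction L with
  | nil => exact le_rfl
  | cons i L ih =>
    have := size_encode_hide_le i
    rw [List.map_cons, codeSize_cons, codeSize_cons]; omega

lemma codeSize_take_le (L : List Ins) (i : ℕ) : codeSize (L.take i) ≤ codeSize L := by
  have h := codeSize_append (L.take i) (L.drop i)
  have : 0 < codeSize (L.drop i) := Data.size_pos _
  rw [List.take_append_drop] at h; omega

lemma codeSize_drop_le (L : List Ins) (i : ℕ) : codeSize (L.drop i) ≤ codeSize L := by
  have h := codeSize_append (L.take i) (L.drop i)
  have : 0 < codeSize (L.take i) := Data.size_pos _
  rw [List.take_append_drop] at h; omega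

/-- All Damgård–Jurik encryptions may be replaced by random numbers. -/
theorem compIndist_hide (hK : IsKeyGen K) (hE : PaillierCPASecure K) (L : ℕ → List Ins)
    (h : ∀ l, NoChal (L l)) (hL : PolyBounded fun l => codeSize (L l)) :
    CompIndist (fun l => (K l).bind fun k => machine k.N (PMF.pure 0) (L l))
      (fun l => (K l).bind fun k => machine k.N (PMF.pure 0) ((L l).map Ins.hide)) := by
  intro D hD a ha
  let adv : ∀ l, (Key → PMF Data) → ℝ := fun l X =>
    prOne (((K l).bind X).bind fun x => D.out (.pair (.unary l) (.pair (a l) x)))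
  let hyb : ∀ l, ℕ → List Ins := fun l i => ((L l).take i).map Ins.hide ++ (L l).drop i
  let δ : ∀ l, ℕ → ℝ := fun l i => |adv l (fun k => machine k.N (PMF.pure 0) (hyb l i))
    - adv l (fun k => machine k.N (PMF.pure 0) (hyb l (i + 1)))|
  have step : ∀ i : ℕ → ℕ, Negligible fun l => δ l (i l) := by
    intro i
    let t : ℕ → ℕ := fun l => match (L l)[i l]? with
      | some (.leaf (.enc 0) (.raise t)) => t
      | _ => 0
    have ht : ∀ l, Nat.size (t l) ≤ codeSize (L l) := by
      intro l
      have key : ∀ (L : List Ins) (j : Ins), j ∈ L → j.encode.size ≤ codeSize L := by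
        intro L j hj
        induction L with
        | nil => simp at hj
        | cons j' L ih =>
          rw [codeSize_cons]
          rcases List.mem_cons.1 hj with rfl | hj
          · omega
          · have := ih hj; omega
      simp only [t]
      split
      · rename_i t' heq
        have := key _ _ (List.mem_of_getElem? heq)
        simp only [Ins.encode, Post.encode, Data.size] at this
        omega
      · simp
    have main := compIndist_raise hK hE (fun l => ((L l).take (i l)).map Ins.hide)
      (fun l => (L l).drop (i l + 1)) t
      (fun l => noChal_map_hide fun j hj => h l j (List.mem_of_mem_take hj))
      (fun l j hj => h l j (List.mem_of_mem_drop hj))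
      (hL.mono fun l => (codeSize_map_hide_le _).trans (codeSize_take_le _ _))
      (hL.mono fun l => codeSize_drop_le _ _) (hL.mono ht) D hD a ha
    refine main.mono fun l => ?_
    rw [abs_abs]
    have h1 : NoChal (((L l).take (i l)).map Ins.hide) :=
      noChal_map_hide fun j hj => h l j (List.mem_of_mem_take hj)
    have h2 : NoChal ((L l).drop (i l + 1)) := fun j hj => h l j (List.mem_of_mem_drop hj)
    by_cases hi : i l < (L l).length
    · have e1 : hyb l (i l) = ((L l).take (i l)).map Ins.hide ++
          (L l)[i l] :: (L l).drop (i l + 1) := by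
        simp only [hyb]; rw [List.drop_eq_getElem_cons hi]
      have e2 : hyb l (i l + 1) = ((L l).take (i l)).map Ins.hide ++
          ((L l)[i l]).hide :: (L l).drop (i l + 1) := by
        simp only [hyb]; rw [List.take_succ_eq_append_getElem hi]
        simp only [List.map_append, List.map_cons, List.map_nil, List.append_assoc,
          List.singleton_append]
      have e3 : (L l)[i l]? = some (L l)[i l] := List.getElem?_eq_getElem hi
      simp only [e1, e2]
      by_cases hcase : ∃ t', (L l)[i l] = .leaf (.enc 0) (.raise t')
      · obtain ⟨t', ht'⟩ := hcase
        have e4 : t l = t' := by simp only [t, e3, ht']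
        rw [ht', Ins.hide]
        simp only [machine_leaf _ 0 h1 h2, adv, e4]
        exact le_rfl
      · have : ((L l)[i l]).hide = (L l)[i l] := by
          unfold Ins.hide
          split
          · rename_i t' heq; exact absurd ⟨t', heq⟩ hcase
          · rfl
        rw [this, sub_self, abs_zero]; exact abs_nonneg _
    · have : hyb l (i l) = hyb l (i l + 1) := by
        simp only [hyb]
        rw [List.take_of_length_le (by omega), List.take_of_length_le (by omega),
          List.drop_of_length_le (by omega), List.drop_of_length_le (by omega)]
      simp only [this, sub_self, abs_zero]; exact abs_nonneg _
  obtain ⟨ε, hε, hε0, hle⟩ := exists_uniform_negligible (C := fun _ => ℕ) δ 1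
    (fun l i => abs_nonneg _) (fun l i => abs_prOne_sub_le_one _ _) step
  refine (hε.poly_mul hε0 (hL.mono fun l => length_le_codeSize (L l))).mono fun l => ?_
  rw [abs_abs]
  have tele : ∀ n, |adv l (fun k => machine k.N (PMF.pure 0) (hyb l 0))
      - adv l (fun k => machine k.N (PMF.pure 0) (hyb l n))| ≤ n * ε l := by
    intro n
    induction n with
    | zero => simp
    | succ n ih =>
      push_cast
      refine (abs_sub_le _ (adv l (fun k => machine k.N (PMF.pure 0) (hyb l n))) _).trans ?_
      have := hle l n
      simp only [δ] at this
      linarith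
  have h0 : hyb l 0 = L l := by simp [hyb]
  have hn : hyb l (L l).length = (L l).map Ins.hide := by simp [hyb]
  have := tele (L l).length
  rwa [h0, hn] at this

end CPA

/-! ## Expressions -/

/-- Trees with numbers at the leaves. -/
inductive Tm where
  | leaf (s : Src) (p : Post) | pair (a b : Tm)

namespace Tm

noncomputable def sem (U : PMF ℕ) (N : ℕ) [NeZero N] : Tm → PMF Data
  | leaf s p => (leafSem U N s p).bind fun v => PMF.pure (.nat v)
  | pair a b => (a.sem U N).bind fun x => (b.sem U N).bind fun y => PMF.pure (.pair x y)

def code : Tm → List Ins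
  | leaf s p => [.leaf s p]
  | pair a b => a.code ++ b.code ++ [.pair]

/-- Replace all Damgård–Jurik encryptions by random numbers. -/
def hide : Tm → Tm
  | leaf (.enc 0) (.raise _) => leaf .rnd .lift
  | leaf s p => leaf s p
  | pair a b => pair a.hide b.hide

/-- Size of the code. -/
def csize (e : Tm) : ℕ := codeSize e.code

def leaves : Tm → ℕ
  | leaf _ _ => 1
  | pair a b => a.leaves + b.leaves

lemma code_hide (e : Tm) : e.hide.code = e.code.map Ins.hide := by
  induction e with
  | leaf s p => unfold hide; split <;> simp_all [code, Ins.hide]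
  | pair a b iha ihb => simp [hide, code, iha, ihb, Ins.hide]

lemma noChal_code (e : Tm) : NoChal e.code := by
  induction e with
  | leaf s p => intro i hi p; simp [code] at hi; simp [hi]
  | pair a b iha ihb =>
    intro i hi p
    simp only [code, List.mem_append, List.mem_singleton] at hi
    rcases hi with (hi | hi) | rfl
    · exact iha i hi p
    · exact ihb i hi p
    · simp

lemma runIns_code (U : PMF ℕ) (N c : ℕ) [NeZero N] (e : Tm) (st : Data) :
    runIns U N c e.code st = (e.sem U N).bind fun d => PMF.pure (.pair d st) := by
  induction e generalizing st with
  | leaf s p => simp [code, runIns, Ins.sem, sem, PMF.bind_bind]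
  | pair a b iha ihb =>
    simp [code, runIns_append, iha, ihb, runIns, Ins.sem, pairTop, sem, PMF.bind_bind]

lemma machine_code (N : ℕ) [NeZero N] (e : Tm) :
    machine N (PMF.pure 0) e.code = e.sem (uniformNat N) N := by
  simp [machine, runIns_code, PMF.map_bind, PMF.pure_map]

lemma csize_pair (a b : Tm) : (pair a b).csize = a.csize + b.csize + 3 := by
  have h1 := codeSize_append (a.code ++ b.code) [.pair]
  have h2 := codeSize_append a.code b.code
  have h3 : codeSize [Ins.pair] = 5 := rfl
  simp only [csize, code]; omega

lemma leaves_le_csize (e : Tm) : e.leaves ≤ e.csize := by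
  induction e with
  | leaf s p => exact Data.size_pos _
  | pair a b iha ihb => rw [csize_pair, leaves]; omega

lemma sd_sem (k : Key) {l : ℕ} (hp : 2 ^ l ≤ k.p) (hq : 2 ^ l ≤ k.q) (e : Tm) :
    SD (e.sem (unitNat k.N) k.N) (e.sem (uniformNat k.N) k.N) (e.leaves * unitErr l) := by
  induction e with
  | leaf s p =>
    rw [leaves, Nat.cast_one, one_mul]
    exact (sd_leafSem k hp hq s p).bind_left _
  | pair a b iha ihb =>
    rw [leaves, Nat.cast_add, add_mul]
    exact iha.bind fun x => ihb.bind_left _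

end Tm

/-- Expressions of polynomial size may be replaced by expressions without Damgård–Jurik
encryptions. -/
theorem compIndist_sem_hide {K : ℕ → PMF Key} (hK : IsKeyGen K) (hE : PaillierCPASecure K)
    (e : ℕ → Tm) (he : PolyBounded fun l => (e l).csize) :
    CompIndist (fun l => (K l).bind fun k => (e l).sem (unitNat k.N) k.N)
      (fun l => (K l).bind fun k => (e l).hide.sem (unitNat k.N) k.N) := by
  have stat : ∀ e : ℕ → Tm, PolyBounded (fun l => (e l).csize) → CompIndist
      (fun l => (K l).bind fun k => (e l).sem (unitNat k.N) k.N)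
      (fun l => (K l).bind fun k => (e l).sem (uniformNat k.N) k.N) := by
    intro e he
    refine CompIndist.of_SD ((negligible_two_pow.const_mul 2).poly_mul (fun l => by positivity)
      (he.mono fun l => (e l).leaves_le_csize)) (fun l => by positivity) fun l => ?_
    rw [ENNReal.ofReal_mul (by positivity), ← unitErr_eq, ENNReal.ofReal_natCast]
    exact SD.bind_const _ fun k hk => (e l).sd_sem k (hK.1 l k hk).1 (hK.1 l k hk).2
  have main := compIndist_hide hK hE (fun l => (e l).code) (fun l => (e l).noChal_code) he
  simp only [← Tm.code_hide, Tm.machine_code] at main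
  refine (stat e he).trans (main.trans (stat _ (he.mono fun l => ?_)).symm)
  rw [Tm.csize, Tm.code_hide]; exact codeSize_map_hide_le _

/-! ## Collisions of a pseudo-random function -/

section PRF

lemma card_fin_mod_le (n P c : ℕ) (hP : 0 < P) :
    ((Finset.univ : Finset (Fin n)).filter fun u : Fin n => (u : ℕ) % P = c).card ≤ n / P + 1 := by
  have h1 : ((Finset.univ : Finset (Fin n)).filter fun u : Fin n => (u : ℕ) % P = c).card =
      ((Finset.range n).filter fun u => u % P = c).card := by
    rw [Finset.card_filter, Finset.card_filter,
      Fin.sum_univ_eq_sum_range (fun u => if u % P = c then 1 else 0)]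
  rw [h1]
  by_cases hc : c < P
  · have h2 := Nat.count_modEq_card n hP c
    rw [Nat.count_eq_card_filter_range] at h2
    have h3 : ((Finset.range n).filter fun u => u % P = c) =
        (Finset.range n).filter fun u => u ≡ c [MOD P] := by
      refine Finset.filter_congr fun u _ => ?_
      rw [Nat.ModEq, Nat.mod_eq_of_lt hc]
    rw [h3, h2]
    split_ifs <;> omega
  · rw [Finset.filter_false_of_mem, Finset.card_empty]
    · exact Nat.zero_le _
    · intro u _ h
      exact hc (h ▸ Nat.mod_lt u hP)

/-- Collisions of a random function modulo `P`. -/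
lemma random_collision {α : Type} [Fintype α] [DecidableEq α] {n : ℕ} [NeZero n] {P : ℕ}
    (hP : 0 < P) {o o' : α} (ho : o ≠ o') :
    Ex (PMF.uniformOfFintype (α → Fin n))
      (fun f => if (f o : ℕ) % P = (f o' : ℕ) % P then 1 else 0) ≤
        ((n / P + 1 : ℕ) : ℝ≥0∞) / n := by
  have h1 : PMF.uniformOfFintype (α → Fin n) = (PMF.uniformOfFintype (α → Fin n)).bind PMF.pure :=
    (PMF.bind_pure _).symm
  rw [h1, ← uniform_bind_equiv (Equiv.funSplitAt o (Fin n)).symm, uniform_prod_bind, PMF.bind_comm,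
    Ex_bind, ← Ex_const (PMF.uniformOfFintype ({j // j ≠ o} → Fin n)) (((n / P + 1 : ℕ) : ℝ≥0∞) / n)]
  refine Ex_mono fun g _ => ?_
  have e : ∀ u : Fin n, (Equiv.funSplitAt o (Fin n)).symm (u, g) o = u := fun u => by
    simp [Equiv.funSplitAt]
  have e' : ∀ u : Fin n, (Equiv.funSplitAt o (Fin n)).symm (u, g) o' = g ⟨o', ho.symm⟩ := fun u => by
    simp [Equiv.funSplitAt, ho.symm]
  simp only [Ex_bind, Ex_pure, Ex_uniform, e, e', Fintype.card_fin]
  rw [Finset.sum_boole, ENNReal.div_eq_inv_mul]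
  gcongr
  exact card_fin_mod_le n P _ hP

/-- `(u, (P, (o, o'))) ↦ 1` if the answers to `o` and `o'` agree modulo `P`. -/
def Prog.collide : Prog :=
  let P := seq snd fst
  let o := seq snd (seq snd fst)
  let o' := seq snd (seq snd snd)
  bin .eq (bin .mod (seq o query) P) (bin .mod (seq o' query) P)

lemma Prog.ppt_collide : collide.PPT := by
  have P := ppt_snd.seq ppt_fst
  have o := ppt_snd.seq (ppt_snd.seq ppt_fst)
  have o' := ppt_snd.seq (ppt_snd.seq ppt_snd)
  exact ((o.seq ppt_query).bin _ P).bin _ ((o'.seq ppt_query).bin _ P)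

lemma Prog.outO_collide (O : ℕ → ℕ) (u : Data) (P o o' : ℕ) :
    outO O collide (.pair u (.pair (.nat P) (.pair (.nat o) (.nat o')))) =
      PMF.pure (.nat (if O o % P = O o' % P then 1 else 0)) := by
  simp [collide, outO_bin, outO_seq, outO_fst, outO_snd, outO_query, outO_op, BinOp.eval]

lemma prOne_bind_ite {α : Type} (X : PMF α) (c : α → Prop) [DecidablePred c] :
    prOne (X.bind fun a => PMF.pure (.nat (if c a then 1 else 0))) =
      (Ex X fun a => if c a then 1 else 0).toReal := by
  rw [prOne, bind_apply_eq_Ex]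
  congr 2; ext a
  by_cases h : c a <;> simp [h, PMF.pure_apply]

lemma oracleOf_apply {d e : ℕ} (f : Fin (2 ^ d) → Fin (2 ^ e)) (o : Fin (2 ^ d)) :
    oracleOf f o = f o := by simp [oracleOf]

/-- Values of a pseudo-random function collide modulo large numbers with negligible probability
only. -/
lemma exists_collision_bound {dom len : ℕ → ℕ} (hlen : ∀ l, l ≤ len l) {F : HashFamily dom len}
    (hF : IsPRF F) {B : ℕ → ℕ} (hB : PolyBounded B) :
    ∃ ε : ℕ → ℝ, Negligible ε ∧ (∀ l, 0 ≤ ε l) ∧ ∀ (l P : ℕ) (o o' : Fin (2 ^ dom l)),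
      2 ^ l ≤ P → Nat.size P ≤ B l → Nat.size o ≤ B l → Nat.size o' ≤ B l → o ≠ o' →
      Ex (PMF.uniformOfFintype (Fin (2 ^ l)))
        (fun κ => if (F l κ o : ℕ) % P = (F l κ o' : ℕ) % P then 1 else 0) ≤ ENNReal.ofReal (ε l) := by
  classical
  let cond : ∀ l, ℕ × Fin (2 ^ dom l) × Fin (2 ^ dom l) → Prop := fun l c =>
    2 ^ l ≤ c.1 ∧ Nat.size c.1 ≤ B l ∧ Nat.size c.2.1 ≤ B l ∧ Nat.size c.2.2 ≤ B l ∧ c.2.1 ≠ c.2.2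
  let pr : ∀ l, ℕ × Fin (2 ^ dom l) × Fin (2 ^ dom l) → ℝ≥0∞ := fun l c =>
    Ex (PMF.uniformOfFintype (Fin (2 ^ l)))
      (fun κ => if (F l κ c.2.1 : ℕ) % c.1 = (F l κ c.2.2 : ℕ) % c.1 then 1 else 0)
  have hpr : ∀ l c, pr l c ≤ 1 := fun l c => Ex_le_one fun κ => by split_ifs <;> simp
  obtain ⟨ε, hε, hε0, hle⟩ := exists_uniform_negligible
    (fun l c => if cond l c then (pr l c).toReal else 0) 1
    (fun l c => by split_ifs <;> simp)
    (fun l c => by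
      split_ifs
      · exact ENNReal.toReal_le_of_le_ofReal zero_le_one (by simpa using hpr l c)
      · exact zero_le_one) (by
    intro c
    let a : ℕ → Data := fun l => if cond l (c l) then
      .pair (.nat (c l).1) (.pair (.nat (c l).2.1) (.nat (c l).2.2)) else .nat 0
    have ha : PolyBounded fun l => (a l).size := by
      refine (((PolyBounded.const 3).mul hB).add (PolyBounded.const 5)).mono fun l => ?_
      simp only [a]
      split_ifs with h
      · obtain ⟨-, h1, h2, h3, -⟩ := h
        simp only [Data.size]; omega
      · simp [Data.size]
    refine ((hF _ Prog.ppt_collide a ha).add (negligible_two_pow.const_mul 2)).mono fun l => ?_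
    by_cases h : cond l (c l)
    swap
    · rw [if_neg h, abs_zero]; positivity
    rw [if_pos h, abs_of_nonneg ENNReal.toReal_nonneg]
    simp only [a, if_pos h, Prog.outO_collide, prOne_bind_ite, oracleOf_apply]
    obtain ⟨hP, -, -, -, hne⟩ := h
    have hP0 : 0 < (c l).1 := lt_of_lt_of_le (by positivity) hP
    have hr := random_collision (α := Fin (2 ^ dom l)) (n := 2 ^ len l) hP0 hne
    have hr' : ((2 ^ len l / (c l).1 + 1 : ℕ) : ℝ≥0∞) / (2 ^ len l : ℕ) ≤
        ENNReal.ofReal (2 * ((2 : ℝ) ^ l)⁻¹) := by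
      rw [← unitErr_eq, unitErr, ← div_eq_mul_inv, ENNReal.div_le_iff_le_mul (by
        left; positivity) (by left; finiteness), mul_comm, ← mul_div_assoc,
        ENNReal.le_div_iff_mul_le (by left; positivity) (by left; finiteness)]
      have h1 : 2 ^ len l / (c l).1 * 2 ^ l ≤ 2 ^ len l :=
        (Nat.mul_le_mul_left _ hP).trans (Nat.div_mul_le_self _ _)
      have h2 : 2 ^ l ≤ 2 ^ len l := Nat.pow_le_pow_right (by norm_num) (hlen l)
      have h3 : (2 ^ len l / (c l).1 + 1) * 2 ^ l ≤ 2 ^ len l * 2 := by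
        rw [Nat.add_mul]; omega
      exact_mod_cast h3
    have hr2 := ENNReal.toReal_mono ENNReal.ofReal_ne_top (hr.trans hr')
    rw [ENNReal.toReal_ofReal (by positivity)] at hr2
    have := le_abs_self ((pr l (c l)).toReal - (Ex (PMF.uniformOfFintype
      (Fin (2 ^ dom l) → Fin (2 ^ len l))) (fun f => if (f (c l).2.1 : ℕ) % (c l).1 =
        (f (c l).2.2 : ℕ) % (c l).1 then 1 else 0)).toReal)
    simp only [pr] at this ⊢
    linarith)
  refine ⟨ε, hε, hε0, fun l P o o' h1 h2 h3 h4 h5 => ?_⟩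
  have hc : cond l (P, o, o') := ⟨h1, h2, h3, h4, h5⟩
  have := hle l (P, o, o')
  rw [if_pos hc] at this
  exact (ENNReal.le_ofReal_iff_toReal_le ((hpr l _).trans_lt ENNReal.one_lt_top).ne (hε0 l)).2 this

lemma isUnit_sub_of_not_modEq (k : Key) {a b : ℕ} (hp : ¬ a % k.p = b % k.p)
    (hq : ¬ a % k.q = b % k.q) : IsUnit ((a : ZMod k.N) - b) := by
  have key : ∀ p : ℕ, p.Prime → ¬ a % p = b % p → IsCoprime (p : ℤ) ((a : ℤ) - b) := by
    intro p hp h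
    rw [(Nat.prime_iff_prime_int.1 hp).irreducible.coprime_iff_not_dvd]
    exact fun hd => h ((Nat.modEq_iff_dvd.2 hd).symm)
  have h := (key _ k.prime_p hp).mul_left (key _ k.prime_q hq)
  have h2 := (ZMod.coe_int_isUnit_iff_isCoprime ((a : ℤ) - b) k.N).2 (by
    rw [Key.N]; push_cast; exact h)
  simpa using h2

end PRF

/-! ## Random lists -/

/-- The list of independent results. -/
noncomputable def ofListM : List (PMF Data) → PMF Data
  | [] => PMF.pure (.nat 0)
  | p :: l => p.bind fun d => (ofListM l).bind fun D => PMF.pure (.pair d D)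

noncomputable def ofFinM {n : ℕ} (f : Fin n → PMF Data) : PMF Data := ofListM (List.ofFn f)

lemma ofFinM_succ {n : ℕ} (f : Fin (n + 1) → PMF Data) :
    ofFinM f = (f 0).bind fun d => (ofFinM fun i => f i.succ).bind fun D =>
      PMF.pure (.pair d D) := by
  simp [ofFinM, List.ofFn_succ, ofListM]

lemma Data.ofFin_succ {n : ℕ} (f : Fin (n + 1) → Data) :
    Data.ofFin f = .pair (f 0) (Data.ofFin fun i => f i.succ) := by
  simp [ofFin, List.ofFn_succ, ofList]

lemma uniform_ofFin {α : Type} [Fintype α] [Nonempty α] {n : ℕ} (g : Fin n → α → Data) :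
    ((PMF.uniformOfFintype (Fin n → α)).bind fun a => PMF.pure (Data.ofFin fun i => g i (a i))) =
      ofFinM fun i => (PMF.uniformOfFintype α).bind fun a => PMF.pure (g i a) := by
  induction n with
  | zero =>
    have : ∀ a : Fin 0 → α, Data.ofFin (fun i => g i (a i)) = .nat 0 := fun a => rfl
    simp only [this, PMF.bind_const]; rfl
  | succ n ih =>
    rw [uniform_fin_succ_bind, ofFinM_succ, ← ih, PMF.bind_bind]
    simp only [Data.ofFin_succ, Fin.cons_zero, Fin.cons_succ, PMF.bind_bind, PMF.pure_bind]

lemma SD.ofFinM {n : ℕ} {f g : Fin n → PMF Data} {ε : ℝ≥0∞} (h : ∀ i, SD (f i) (g i) ε) :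
    SD (ofFinM f) (ofFinM g) (n * ε) := by
  induction n with
  | zero => simp only [SecTopK.ofFinM, List.ofFn_zero]; exact SD.refl _ _
  | succ n ih =>
    rw [ofFinM_succ, ofFinM_succ, Nat.cast_succ, add_mul, one_mul, add_comm ((n : ℝ≥0∞) * ε)]
    exact (h 0).bind fun d => (ih fun i => h i.succ).bind_left _

namespace Tm

def ofFin {n : ℕ} (f : Fin n → Tm) : Tm :=
  (List.ofFn f).foldr pair (leaf (.plain 0) .none)

lemma ofFin_succ {n : ℕ} (f : Fin (n + 1) → Tm) :
    ofFin f = pair (f 0) (ofFin fun i => f i.succ) := by simp [ofFin, List.ofFn_succ]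

lemma sem_ofFin (U : PMF ℕ) (N : ℕ) [NeZero N] {n : ℕ} (f : Fin n → Tm) :
    (ofFin f).sem U N = ofFinM fun i => (f i).sem U N := by
  induction n with
  | zero => simp [ofFin, ofFinM, ofListM, sem, leafSem, Src.sem, Post.sem]
  | succ n ih => rw [ofFin_succ, sem, ih, ofFinM_succ]

lemma hide_ofFin {n : ℕ} (f : Fin n → Tm) : (ofFin f).hide = ofFin fun i => (f i).hide := by
  induction n with
  | zero => simp [ofFin, hide]
  | succ n ih => rw [ofFin_succ, hide, ih, ofFin_succ]

lemma csize_ofFin_le {n B : ℕ} {f : Fin n → Tm} (h : ∀ i, (f i).csize ≤ B) :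
    (ofFin f).csize ≤ n * (B + 3) + 14 := by
  induction n with
  | zero =>
    rw [Nat.zero_mul]
    exact (by decide : (leaf (.plain 0) .none).csize ≤ 0 + 14)
  | succ n ih =>
    rw [ofFin_succ, csize_pair, Nat.add_mul]
    have := ih fun i => h i.succ
    have := h 0
    omega

lemma csize_leaf (s : Src) (p : Post) : (leaf s p).csize = s.encode.size + p.encode.size + 6 := by
  have : Nat.size 1 = 1 := rfl
  simp only [csize, code, codeSize, List.map, Data.ofList, Ins.encode, Data.size, Nat.size_zero]
  omega

end Tm

/-! ## Simulators -/

namespace Prog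

lemma foldSem_append (val comb : Data → PMF Data) (l l' : List Data) (acc : Data) :
    foldSem val comb (l ++ l') acc = (foldSem val comb l acc).bind (foldSem val comb l') := by
  induction l generalizing acc with
  | nil => simp [foldSem]
  | cons d l ih =>
    simp only [List.cons_append, foldSem, PMF.bind_bind]
    congr 1; ext1 v; congr 1; ext1 acc'; exact ih acc'

lemma foldSem_reverse (O : ℕ → ℕ) (val : Data → PMF Data) (l : List Data) :
    foldSem val (outO O snd) l.reverse (.nat 0) = ofListM (l.map val) := by
  induction l with
  | nil => rfl
  | cons d l ih =>
    rw [List.reverse_cons, foldSem_append, ih, List.map_cons, ofListM, PMF.bind_comm]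
    simp [foldSem, outO_snd]

lemma ofListM_pure (l : List Data) : ofListM (l.map PMF.pure) = PMF.pure (Data.ofList l) := by
  induction l with
  | nil => rfl
  | cons d l ih => simp [ofListM, ih, Data.ofList]

/-- `(env, l) ↦` the list of the results of `val` on `(env, d)` for the entries `d` of `l`. -/
def mapList (val : Prog) : Prog :=
  seq (fork fst (fork (seq (fork (const 0) (fork snd (const 0))) (fold snd snd)) (const 0)))
    (fold val snd)

lemma PPT.mapList {val : Prog} (h : val.PPT) : (mapList val).PPT := by
  have hsnd : ∀ O x, ∀ y ∈ (outO O snd x).support, y.size ≤ x.size + 0 := fun O x y hy => by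
    rw [outO_snd, PMF.mem_support_pure_iff] at hy
    exact hy ▸ x.size_right_le
  exact ((ppt_fst.fork ((((ppt_const 0).fork (ppt_snd.fork (ppt_const 0))).seq
    (ppt_snd.fold ppt_snd 0 hsnd)).fork (ppt_const 0))).seq (h.fold ppt_snd 0 hsnd))

lemma outO_mapList (O : ℕ → ℕ) (val : Prog) (env : Data) (l : List Data) :
    outO O (mapList val) (.pair env (Data.ofList l)) =
      ofListM (l.map fun d => outO O val (.pair env d)) := by
  have h := foldSem_reverse O PMF.pure l.reverse
  rw [List.reverse_reverse, ofListM_pure] at h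
  simp only [mapList, outO_seq, outO_fork, outO_fst, outO_const, outO_snd, Data.left_pair,
    Data.right_pair, PMF.pure_bind, outO_fold, h, foldSem_reverse]

/-- `N ↦` a random lift of an encryption of a random message. -/
def randomP : Prog := seq (fork skip encRandP) liftP

lemma ppt_randomP : randomP.PPT := (ppt_skip.fork ppt_encRandP).seq ppt_liftP

lemma outO_encRandP_eq (O : ℕ → ℕ) (N : ℕ) [NeZero N] :
    outO O encRandP (.nat N) = (Tm.leaf .rnd .none).sem (uniformNat N) N := by
  simp [outO_encRandP, Tm.sem, leafSem, Src.sem, Post.sem]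

lemma outO_randomP (O : ℕ → ℕ) (N : ℕ) [NeZero N] :
    outO O randomP (.nat N) = (Tm.leaf .rnd .lift).sem (uniformNat N) N := by
  simp [randomP, outO_seq, outO_fork, outO_skip, outO_encRandP, outO_liftP, Tm.sem, leafSem,
    Src.sem, Post.sem]

/-- Simulator of the view of `S₁` in `SecWorst`. -/
def simWorstS1 : Prog :=
  seq (fork (seq snd fst) (seq snd (seq snd snd))) (mapList (seq fst (fork randomP encRandP)))

lemma ppt_simWorstS1 : simWorstS1.PPT :=
  ((ppt_snd.seq ppt_fst).fork (ppt_snd.seq (ppt_snd.seq ppt_snd))).seq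
    (ppt_fst.seq (ppt_randomP.fork ppt_encRandP)).mapList

lemma out_simWorstS1 (u z : Data) (N m : ℕ) [NeZero N] :
    out simWorstS1 (.pair u (.pair (.nat N) (.pair z (.unary m)))) =
      (Tm.ofFin fun _ : Fin m => .pair (.leaf .rnd .lift) (.leaf .rnd .none)).sem
        (uniformNat N) N := by
  simp [out, simWorstS1, outO_seq, outO_fork, outO_fst, outO_snd, Data.unary, outO_mapList,
    Tm.sem_ofFin, ofFinM, Tm.sem.eq_2, outO_encRandP_eq, outO_randomP, List.ofFn_const]

/-- `(N, t) ↦` an encryption of zero if `t ≠ 0` and of a random message if `t = 0`, and a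
Damgård–Jurik encryption of a random ciphertext. -/
def simWorstS2Entry : Prog :=
  fork (caseOn snd 0 (seq fst encRandP) (seq (fork fst (const 0)) encP))
    (seq (fork fst (seq fst encRandP)) enc2P)

/-- Simulator of the view of `S₂` in `SecWorst`. -/
def simWorstS2 : Prog :=
  let z := seq snd (seq snd snd)
  seq (fork (seq snd fst) (seq z (seq snd (seq fst snd)))) (mapList simWorstS2Entry)

lemma ppt_simWorstS2Entry : simWorstS2Entry.PPT :=
  (ppt_snd.caseOn _ (ppt_fst.seq ppt_encRandP) ((ppt_fst.fork (ppt_const 0)).seq ppt_encP)).fork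
    ((ppt_fst.fork (ppt_fst.seq ppt_encRandP)).seq ppt_enc2P)

lemma ppt_simWorstS2 : simWorstS2.PPT :=
  ((ppt_snd.seq ppt_fst).fork ((ppt_snd.seq (ppt_snd.seq ppt_snd)).seq
    (ppt_snd.seq (ppt_fst.seq ppt_snd)))).seq ppt_simWorstS2Entry.mapList

/-- Simulators for `RecoverEnc`. -/
def simRecoverS1 : Prog := seq (seq snd fst) encRandP

def simRecoverS2 : Prog :=
  seq (seq snd fst) (seq (fork skip encRandP) enc2P)

lemma ppt_simRecoverS1 : simRecoverS1.PPT := (ppt_snd.seq ppt_fst).seq ppt_encRandP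

lemma ppt_simRecoverS2 : simRecoverS2.PPT :=
  (ppt_snd.seq ppt_fst).seq ((ppt_skip.fork ppt_encRandP).seq ppt_enc2P)

lemma out_simRecoverS1 (u z : Data) (N : ℕ) [NeZero N] :
    out simRecoverS1 (.pair u (.pair (.nat N) z)) =
      (Tm.leaf .rnd .none).sem (uniformNat N) N := by
  simp [out, simRecoverS1, outO_seq, outO_fst, outO_snd, outO_encRandP_eq]

end Prog

/-- A Damgård–Jurik encryption of an encryption of a random message, with units from `U`. -/
noncomputable def doubleEnc (U : PMF ℕ) (N : ℕ) [NeZero N] : PMF Data :=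
  (uniformNat N).bind fun m => U.bind fun r => U.bind fun r' =>
    PMF.pure (.nat (enc2N N (encN N m r) r'))

/-- An encryption of zero or of a random message, and a double encryption. -/
noncomputable def entryS2 (U : PMF ℕ) (N : ℕ) [NeZero N] (eq : Prop) [Decidable eq] : PMF Data :=
  (if eq then (Tm.leaf (.enc 0) .none).sem U N else (Tm.leaf .rnd .none).sem U N).bind fun a =>
    (doubleEnc U N).bind fun b => PMF.pure (.pair a b)

lemma Prog.out_simRecoverS2 (u z : Data) (N : ℕ) [NeZero N] :
    out simRecoverS2 (.pair u (.pair (.nat N) z)) = doubleEnc (uniformNat N) N := by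
  simp [out, simRecoverS2, outO_seq, outO_fork, outO_skip, outO_fst, outO_snd, outO_encRandP,
    outO_enc2P, doubleEnc]

lemma Prog.outO_simWorstS2Entry (O : ℕ → ℕ) (N : ℕ) [NeZero N] (eq : Prop) [Decidable eq] :
    outO O simWorstS2Entry (.pair (.nat N) (.nat (if eq then 1 else 0))) =
      entryS2 (uniformNat N) N eq := by
  have h : outO O snd (.pair (.nat N) (.nat (if eq then 1 else 0))) =
    PMF.pure (.nat (if eq then 1 else 0)) := outO_snd _ _
  rw [simWorstS2Entry, outO_fork, outO_caseOn O _ _ _ h]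
  by_cases heq : eq <;>
  simp [outO_fork, heq, outO_seq, outO_fst, outO_const,
    outO_encP, outO_encRandP, outO_enc2P, entryS2, doubleEnc, Tm.sem, leafSem, Src.sem,
    Post.sem]

lemma Prog.out_simWorstS2 {dom : ℕ} (I : Instance dom) (π : Equiv.Perm (Fin I.m)) (u s w : Data)
    (N : ℕ) [NeZero N] :
    out simWorstS2 (.pair u (.pair (.nat N) (.pair s (.pair w (I.eqPattern π))))) =
      ofFinM fun j => entryS2 (uniformNat N) N (I.object 0 = I.object (π j).succ) := by
  have h : (I.eqPattern π).left.right = Data.ofFin fun j =>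
      .nat (if I.object 0 = I.object (π j).succ then 1 else 0) := by
    simp only [Instance.eqPattern, Data.ofFin_succ, Data.left_pair, Data.right_pair,
      Fin.cons_zero, Fin.cons_succ]
  simp only [out, simWorstS2, outO_seq, outO_fork, outO_fst, outO_snd, PMF.pure_bind,
    Data.left_pair, Data.right_pair, h]
  rw [Data.ofFin, outO_mapList, ofFinM, List.map_ofFn]
  congr 2; ext1 j
  exact outO_simWorstS2Entry _ _ _

lemma sd_doubleEnc (k : Key) {l : ℕ} (hp : 2 ^ l ≤ k.p) (hq : 2 ^ l ≤ k.q) :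
    SD (doubleEnc (unitNat k.N) k.N) (doubleEnc (uniformNat k.N) k.N) (2 * unitErr l) := by
  have h := sd_unitNat k hp hq
  rw [two_mul]
  exact SD.bind_const _ fun m _ => h.bind fun r => h.bind_left _

lemma sd_entryS2 (k : Key) {l : ℕ} (hp : 2 ^ l ≤ k.p) (hq : 2 ^ l ≤ k.q) (eq : Prop)
    [Decidable eq] :
    SD (entryS2 (unitNat k.N) k.N eq) (entryS2 (uniformNat k.N) k.N eq) (3 * unitErr l) := by
  rw [show (3 : ℝ≥0∞) = 1 + 2 by norm_num, add_mul, one_mul]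
  refine SD.bind ?_ fun a => (sd_doubleEnc k hp hq).bind_left _
  split_ifs
  · exact (sd_leafSem k hp hq _ _).bind_left _
  · exact (sd_leafSem k hp hq _ _).bind_left _

/-! ## The messages of the protocols -/

section Messages

lemma zdata_one_enc {N : ℕ} (m : ZMod N) (ρ : (ZMod N)ˣ) :
    zdata (enc m ρ) = .nat (encN N m.val (ρ : ZMod N).val) := by rw [zdata, val_enc]

lemma natCast_val_self {n : ℕ} [NeZero n] (a : ZMod n) : ((a.val : ℕ) : ZMod n) = a := by simp

/-- `RecoverEnc` on an encryption of `Enc(c)`. -/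
lemma recoverEnc_enc2 (k : Key) (c : ZMod k.N) (γ δ : (ZMod k.N)ˣ) (ω : RecoverCoins k.N) :
    recoverEnc k (enc2 (enc c γ) δ) ω =
      ⟨enc2 (enc (c + ω.1.1) (γ * ω.1.2)) (δ ^ (enc ω.1.1 ω.1.2).val * ω.2.1),
        enc (c + ω.1.1) (γ * ω.1.2 * ω.2.2), enc c (γ * ω.2.2)⟩ := by
  have h1 : reenc2 (enc2 (enc c γ) δ ^ (enc ω.1.1 ω.1.2).val) ω.2.1 =
      enc2 (enc (c + ω.1.1) (γ * ω.1.2)) (δ ^ (enc ω.1.1 ω.1.2).val * ω.2.1) := by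
    rw [reenc2, enc2_pow, enc2_mul, add_zero, natCast_val_self, mul_comm (enc ω.1.1 ω.1.2),
      enc_mul]
  have h2 : reenc (enc (c + ω.1.1) (γ * ω.1.2)) ω.2.2 =
      enc (c + ω.1.1) (γ * ω.1.2 * ω.2.2) := by rw [reenc, enc_mul, add_zero]
  simp only [recoverEnc, h1, dec2_enc2, h2, enc_inv, enc_mul]
  congr 2
  · ring
  · rw [mul_right_comm, mul_assoc _ ω.1.2, mul_inv_cancel, mul_one]

lemma ehlSub_encItem {N s : ℕ} [NeZero N] (h h' : Fin s → ℕ) (x x' : ℕ)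
    (ρ ρ' : (Fin s → (ZMod N)ˣ) × (ZMod N)ˣ) (r : Fin s → ZMod N) :
    ehlSub (encItem h x ρ).ehl (encItem h' x' ρ').ehl r =
      enc (∑ i, r i * ((h i : ZMod N) - (h' i : ZMod N))) (∏ i, (ρ.1 i * (ρ'.1 i)⁻¹) ^ (r i).val) := by
  rw [← enc_prod, ehlSub]
  refine Finset.prod_congr rfl fun i _ => ?_
  simp only [encItem]
  rw [enc_inv, enc_mul, enc_pow, natCast_val_self, sub_eq_add_neg]

/-- The ciphertext on which `RecoverEnc` is run selects one of two ciphertexts. -/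
lemma select_enc2 {N : ℕ} [NeZero N] (t : Prop) [Decidable t] (a b : ZMod (N ^ 2))
    (τ one : (ZMod N)ˣ) :
    enc2 (if t then 1 else 0) τ ^ a.val *
        (enc2 1 one * (enc2 (if t then 1 else 0) τ)⁻¹) ^ b.val =
      enc2 (if t then a else b) (τ ^ a.val * (one * τ⁻¹) ^ b.val) := by
  rw [enc2_inv, enc2_mul, enc2_pow, enc2_pow, enc2_mul, natCast_val_self, natCast_val_self]
  congr 1
  split_ifs <;> ring

variable {s m : ℕ}

/-- The messages and the output of `SecWorst` for fixed coins. -/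
lemma secWorst_messages (k : Key) (b x : Fin m → ZMod k.N) (β ρ τ one zero : Fin m → (ZMod k.N)ˣ)
    (ω : Fin m → RecoverCoins k.N) (B : Fin m → ZMod (k.N ^ 2)) (hB : ∀ j, B j = enc (b j) (β j)) :
    let encT : Fin m → ZMod (k.N ^ 3) := fun j => enc2 (if dec k (B j) = 0 then 1 else 0) (τ j)
    let rec' : Fin m → RecoverRun k.N := fun j => recoverEnc k (encT j ^ (enc (x j) (ρ j)).val *
      (enc2 1 (one j) * (encT j)⁻¹) ^ (enc 0 (zero j)).val) (ω j)
    let c : Fin m → ZMod k.N := fun j => if b j = 0 then x j else 0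
    let γ : Fin m → (ZMod k.N)ˣ := fun j => if b j = 0 then ρ j else zero j
    let δ : Fin m → (ZMod k.N)ˣ := fun j =>
      τ j ^ (enc (x j) (ρ j)).val * (one j * (τ j)⁻¹) ^ (enc 0 (zero j)).val
    (⟨.ofFin fun j => .pair (zdata (encT j)) (zdata (rec' j).toS1),
      .ofFin fun j => .pair (zdata (B j)) (zdata (rec' j).toS2),
      (∏ j, (rec' j).output).val⟩ : Transcript) =
    ⟨.ofFin fun j => .pair (zdata (enc2 (if b j = 0 then 1 else 0) (τ j)))
        (zdata (enc (c j + (ω j).1.1) (γ j * (ω j).1.2 * (ω j).2.2))),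
      .ofFin fun j => .pair (zdata (enc (b j) (β j)))
        (zdata (enc2 (enc (c j + (ω j).1.1) (γ j * (ω j).1.2))
          (δ j ^ (enc (ω j).1.1 (ω j).1.2).val * (ω j).2.1))),
      (enc (∑ j, c j) (∏ j, γ j * (ω j).2.2)).val⟩ := by
  intro encT rec' c γ δ
  have hT : ∀ j, encT j = enc2 (if b j = 0 then 1 else 0) (τ j) := fun j => by
    simp only [encT, hB, dec_enc]
  have hR : ∀ j, rec' j = recoverEnc k (enc2 (enc (c j) (γ j)) (δ j)) (ω j) := fun j => by
    have h : (if b j = 0 then enc (x j) (ρ j) else enc 0 (zero j)) = enc (c j) (γ j) := by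
      simp only [c, γ]; split_ifs <;> rfl
    rw [← h, ← select_enc2, ← hT]
  simp only [hR, hT, hB, recoverEnc_enc2, enc_prod]

/-- A run of `SecWorst` on fresh encryptions. -/
lemma secWorst_encItem (k : Key) (h : Fin s → ℕ) (x : ℕ) (h' : Fin m → Fin s → ℕ) (x' : Fin m → ℕ)
    (ρ : (Fin s → (ZMod k.N)ˣ) × (ZMod k.N)ˣ)
    (ρ' : Fin m → (Fin s → (ZMod k.N)ˣ) × (ZMod k.N)ˣ) :
    secWorst k (encItem h x ρ) (fun j => encItem (h' j) (x' j) (ρ' j)) =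
      (PMF.uniformOfFintype (Equiv.Perm (Fin m))).bind fun π =>
      (PMF.uniformOfFintype (Fin m → Fin s → ZMod k.N)).bind fun r =>
      (PMF.uniformOfFintype (Fin m → (ZMod k.N)ˣ)).bind fun β =>
      (PMF.uniformOfFintype (Fin m → (ZMod k.N)ˣ)).bind fun τ =>
      (PMF.uniformOfFintype (Fin m → (ZMod k.N)ˣ)).bind fun one =>
      (PMF.uniformOfFintype (Fin m → (ZMod k.N)ˣ)).bind fun zero =>
      (PMF.uniformOfFintype (Fin m → RecoverCoins k.N)).bind fun ω =>
      let b : Fin m → ZMod k.N := fun j => ∑ i, r j i * ((h i : ZMod k.N) - (h' (π j) i : ZMod k.N))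
      let c : Fin m → ZMod k.N := fun j => if b j = 0 then (x' (π j) : ZMod k.N) else 0
      let γ : Fin m → (ZMod k.N)ˣ := fun j => if b j = 0 then (ρ' (π j)).2 else zero j
      let δ : Fin m → (ZMod k.N)ˣ := fun j =>
        τ j ^ (enc (x' (π j) : ZMod k.N) (ρ' (π j)).2).val *
          (one j * (τ j)⁻¹) ^ (enc 0 (zero j)).val
      PMF.pure
        { viewS1 := .ofFin fun j => .pair (zdata (enc2 (if b j = 0 then 1 else 0) (τ j)))
            (zdata (enc (c j + (ω j).1.1) (γ j * (ω j).1.2 * (ω j).2.2)))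
          viewS2 := .ofFin fun j => .pair
            (zdata (enc (b j) ((∏ i, (ρ.1 i * ((ρ' (π j)).1 i)⁻¹) ^ (r j i).val) * β j)))
            (zdata (enc2 (enc (c j + (ω j).1.1) (γ j * (ω j).1.2))
              (δ j ^ (enc (ω j).1.1 (ω j).1.2).val * (ω j).2.1)))
          output := (enc (∑ j, c j) (∏ j, γ j * (ω j).2.2)).val } := by
  unfold secWorst
  refine congrArg (PMF.bind _) (funext fun π => congrArg (PMF.bind _) (funext fun r =>
    congrArg (PMF.bind _) (funext fun β => congrArg (PMF.bind _) (funext fun τ =>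
    congrArg (PMF.bind _) (funext fun one => congrArg (PMF.bind _) (funext fun zero =>
    congrArg (PMF.bind _) (funext fun ω => congrArg PMF.pure ?_)))))))
  refine secWorst_messages k (fun j => ∑ i, r j i * ((h i : ZMod k.N) - (h' (π j) i : ZMod k.N)))
    (fun j => x' (π j)) (fun j => (∏ i, (ρ.1 i * ((ρ' (π j)).1 i)⁻¹) ^ (r j i).val) * β j)
    (fun j => (ρ' (π j)).2) τ one zero ω _ fun j => ?_
  rw [ehlSub_encItem, reenc, enc_mul, add_zero]

end Messages

/-! ## Changes of variables -/

section Uniform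

variable {γ : Type} {m : ℕ}

lemma uniform_bind_pi_mulRight {G : Type} [Group G] [Fintype G] (g : Fin m → G)
    (f : (Fin m → G) → PMF γ) :
    ((PMF.uniformOfFintype (Fin m → G)).bind fun a => f fun j => g j * a j) =
      (PMF.uniformOfFintype (Fin m → G)).bind f :=
  uniform_bind_mul_left g f

/-- Shifting random messages and random units. -/
lemma uniform_bind_shift {N : ℕ} [NeZero N] (c : Fin m → ZMod N) (g : Fin m → (ZMod N)ˣ)
    (f : (Fin m → ZMod N × (ZMod N)ˣ) → PMF γ) :
    ((PMF.uniformOfFintype (Fin m → ZMod N × (ZMod N)ˣ)).bind fun a =>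
      f fun j => (c j + (a j).1, g j * (a j).2)) =
        (PMF.uniformOfFintype (Fin m → ZMod N × (ZMod N)ˣ)).bind f :=
  uniform_bind_equiv (Equiv.piCongrRight fun j =>
    (Equiv.addLeft (c j)).prodCongr (Equiv.mulLeft (g j))) f

/-- The randomness of a product of fresh encryptions. -/
lemma uniform_bind_prod {G : Type} [CommGroup G] [Fintype G] (hm : m ≠ 0) (g : Fin m → G)
    (f : G → PMF γ) :
    ((PMF.uniformOfFintype (Fin m → G)).bind fun a => f (∏ j, g j * a j)) =
      (PMF.uniformOfFintype G).bind f := by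
  obtain ⟨m, rfl⟩ := Nat.exists_eq_succ_of_ne_zero hm
  let φ : (Fin (m + 1) → G) →* G :=
    { toFun := fun a => ∏ j, a j
      map_one' := by simp
      map_mul' := fun a b => by simp [Finset.prod_mul_distrib] }
  have hφ : Function.Surjective φ := fun y => ⟨Pi.mulSingle 0 y, by
    change ∏ j, (Pi.mulSingle 0 y : Fin (m + 1) → G) j = y
    rw [Fintype.prod_eq_single 0 fun j hj => Pi.mulSingle_eq_of_ne (M := fun _ => G) hj y, Pi.mulSingle_eq_same]⟩
  rw [uniform_bind_pi_mulRight g fun a => f (∏ j, a j), ← uniform_map_monoidHom φ hφ, PMF.bind_map]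
  rfl

/-- The differences of hash lists under random linear combinations: zero for equal objects, and
uniformly random for the others. -/
lemma uniform_bind_linear {R : Type} [CommRing R] [Fintype R] {s : ℕ} (hs : 0 < s) (e : Fin m → Prop)
    [DecidablePred e] (d : Fin m → Fin s → R) (h0 : ∀ j, e j → ∀ i, d j i = 0)
    (h1 : ∀ j, ¬ e j → IsUnit (d j ⟨0, hs⟩)) (f : (Fin m → R) → PMF γ) :
    ((PMF.uniformOfFintype (Fin m → Fin s → R)).bind fun r => f fun j => ∑ i, r j i * d j i) =
      (PMF.uniformOfFintype (Fin m → R)).bind fun y => f fun j => if e j then 0 else y j := by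
  classical
  let u : Fin m → Fin s → R := fun j i => if e j then 1 else d j i
  have hu : ∀ j, IsUnit (u j ⟨0, hs⟩) := fun j => by
    by_cases hj : e j
    · simp [u, hj]
    · simpa [u, hj] using h1 j hj
  let φ : (Fin m → Fin s → R) →+ (Fin m → R) :=
    { toFun := fun r j => ∑ i, r j i * u j i
      map_zero' := by ext j; simp
      map_add' := fun a b => by ext j; simp [add_mul, Finset.sum_add_distrib] }
  have hφ : Function.Surjective φ := fun y => by
    choose v hv using fun j => (hu j).exists_left_inv
    refine ⟨fun j => Pi.single ⟨0, hs⟩ (y j * v j), ?_⟩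
    ext j
    change ∑ i, (Pi.single ⟨0, hs⟩ (y j * v j) : Fin s → R) i * u j i = y j
    rw [Fintype.sum_eq_single ⟨0, hs⟩ fun i hi => by rw [Pi.single_eq_of_ne hi, zero_mul],
      Pi.single_eq_same, mul_assoc, hv, mul_one]
  rw [← uniform_map_addMonoidHom φ hφ, PMF.bind_map]
  congr 1; ext1 r
  rw [Function.comp_apply]
  congr 1; ext1 j
  by_cases hj : e j
  · simp [hj, h0 j hj]
  · have : φ r j = ∑ i, r j i * u j i := rfl
    rw [if_neg hj, this]
    simp only [u, if_neg hj]

/-- The messages of `RecoverEnc` to `S₁` and the randomness of its outputs. -/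
lemma uniform_bind_recover_S1 {N : ℕ} [NeZero N] (c : Fin m → ZMod N) (g : Fin m → (ZMod N)ˣ)
    (f : (Fin m → ZMod N × (ZMod N)ˣ) → (Fin m → (ZMod N)ˣ) → PMF γ) :
    ((PMF.uniformOfFintype (Fin m → RecoverCoins N)).bind fun ω =>
      f (fun j => (c j + (ω j).1.1, g j * (ω j).1.2 * (ω j).2.2)) fun j => g j * (ω j).2.2) =
    (PMF.uniformOfFintype (Fin m → ZMod N × (ZMod N)ˣ)).bind fun a =>
      (PMF.uniformOfFintype (Fin m → (ZMod N)ˣ)).bind fun b => f a fun j => g j * b j := by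
  rw [uniform_pi_prod_bind]
  calc _ = (PMF.uniformOfFintype (Fin m → ZMod N × (ZMod N)ˣ)).bind fun a =>
          (PMF.uniformOfFintype (Fin m → (ZMod N)ˣ)).bind fun b =>
            f (fun j => (c j + (a j).1, g j * b j * (a j).2)) fun j => g j * b j := by
        congr 1; ext1 a
        rw [uniform_pi_prod_bind]
        simp only [PMF.bind_const, mul_right_comm]
    _ = _ := by
        rw [PMF.bind_comm]
        refine Eq.trans ?_ (PMF.bind_comm _ _ fun (b : Fin m → (ZMod N)ˣ) a =>
          f a fun j => g j * b j)
        congr 1; ext1 b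
        exact uniform_bind_shift c (fun j => g j * b j) fun a => f a fun j => g j * b j

/-- The messages of `RecoverEnc` to `S₂`. -/
lemma uniform_bind_recover_S2 {N : ℕ} [NeZero N] (c : Fin m → ZMod N) (g : Fin m → (ZMod N)ˣ)
    (D : Fin m → ZMod N × (ZMod N)ˣ → (ZMod N)ˣ)
    (f : (Fin m → ZMod N × (ZMod N)ˣ) → (Fin m → (ZMod N)ˣ) → PMF γ) :
    ((PMF.uniformOfFintype (Fin m → RecoverCoins N)).bind fun ω =>
      f (fun j => (c j + (ω j).1.1, g j * (ω j).1.2)) fun j => D j (ω j).1 * (ω j).2.1) =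
    (PMF.uniformOfFintype (Fin m → ZMod N × (ZMod N)ˣ)).bind fun a =>
      (PMF.uniformOfFintype (Fin m → (ZMod N)ˣ)).bind fun b => f a b := by
  rw [uniform_pi_prod_bind, ← uniform_bind_shift c g fun a =>
    (PMF.uniformOfFintype (Fin m → (ZMod N)ˣ)).bind fun b => f a b]
  congr 1; ext1 a
  rw [uniform_pi_prod_bind]
  simp only [PMF.bind_const]
  exact uniform_bind_pi_mulRight (fun j => D j (a j)) (f _)

/-- The probability that one of the coordinates vanishes. -/
lemma Ex_exists_zero_le {N : ℕ} [NeZero N] {l : ℕ} (hN : 2 ^ l ≤ N) :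
    (Ex (PMF.uniformOfFintype (Fin m → ZMod N)) fun y => if ∃ j, y j = 0 then 1 else 0) ≤
      m * ((2 : ℝ≥0∞) ^ l)⁻¹ := by
  classical
  have h1 : ∀ j : Fin m, Ex (PMF.uniformOfFintype (Fin m → ZMod N))
      (fun y => if y j = 0 then 1 else 0) ≤ ((2 : ℝ≥0∞) ^ l)⁻¹ := by
    intro j
    have hsurj : Function.Surjective (Pi.evalAddMonoidHom (fun _ : Fin m => ZMod N) j) :=
      fun y => ⟨fun _ => y, rfl⟩
    have h2 := Ex_map (PMF.uniformOfFintype (Fin m → ZMod N))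
      (Pi.evalAddMonoidHom (fun _ : Fin m => ZMod N) j) fun a => if a = 0 then 1 else 0
    rw [uniform_map_addMonoidHom _ hsurj, Ex_uniform] at h2
    simp only [Finset.sum_ite_eq', Finset.mem_univ, if_true, ZMod.card, mul_one] at h2
    refine (h2.symm.le).trans ?_
    rw [ENNReal.inv_le_inv]
    exact_mod_cast hN
  calc _ ≤ Ex (PMF.uniformOfFintype (Fin m → ZMod N))
        (fun y => ∑ j, if y j = 0 then 1 else 0) := Ex_mono fun y _ => by
          split_ifs with h
          · obtain ⟨j, hj⟩ := h
            refine le_trans ?_ (Finset.single_le_sum (fun _ _ => zero_le) (Finset.mem_univ j))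
            rw [if_pos hj]
          · exact zero_le
    _ = ∑ j, Ex (PMF.uniformOfFintype (Fin m → ZMod N)) (fun y => if y j = 0 then 1 else 0) := by
        simp only [Ex_fintype, Finset.mul_sum]
        rw [Finset.sum_comm]
    _ ≤ ∑ _j : Fin m, ((2 : ℝ≥0∞) ^ l)⁻¹ := Finset.sum_le_sum fun j _ => h1 j
    _ = _ := by simp

end Uniform

/-! ## Views and outputs of `SecWorst` -/

section Views

variable {s m : ℕ}

lemma sem_enc2 (N : ℕ) [NeZero N] (t : ℕ) :
    (Tm.leaf (.enc 0) (.raise t)).sem (unitNat N) N =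
      (PMF.uniformOfFintype (ZMod N)ˣ).bind fun τ =>
        PMF.pure (.nat (enc2N N t (τ : ZMod N).val)) := by
  simp [Tm.sem, leafSem, Src.sem, Post.sem, raiseN_encN, unitNat, PMF.bind_map,
    Function.comp_def]

lemma sem_enc (N : ℕ) [NeZero N] (n : ℕ) :
    (Tm.leaf (.enc n) .none).sem (unitNat N) N =
      (PMF.uniformOfFintype (ZMod N)ˣ).bind fun ρ => PMF.pure (zdata (enc (n : ZMod N) ρ)) := by
  simp only [Tm.sem, leafSem, Src.sem, Post.sem, unitNat, PMF.bind_map, PMF.bind_bind,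
    PMF.pure_bind, zdata_one_enc, Function.comp_def]
  congr 1; ext1 ρ
  rw [encN_congr (val_natCast_modEq N n) rfl]

lemma sem_rnd (N : ℕ) [NeZero N] :
    (Tm.leaf .rnd .none).sem (unitNat N) N =
      (PMF.uniformOfFintype (ZMod N × (ZMod N)ˣ)).bind fun a => PMF.pure (zdata (enc a.1 a.2)) := by
  rw [uniform_prod_bind]
  simp only [Tm.sem, leafSem, Src.sem, Post.sem, unitNat, PMF.bind_map, PMF.bind_bind,
    PMF.pure_bind, zdata_one_enc, Function.comp_def, ← uniform_zmod_map_val]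

/-- The messages to `S₁`. -/
def viewTm {m : ℕ} (e : Fin m → Prop) [DecidablePred e] : Tm :=
  .ofFin fun j => .pair (.leaf (.enc 0) (.raise (if e j then 1 else 0))) (.leaf .rnd .none)

/-- The output of `S₁`. -/
def outputTm (m W : ℕ) : Tm := if m = 0 then .leaf (.plain 1) .none else .leaf (.enc W) .none

lemma sem_viewTm (k : Key) (e : Fin m → Prop) [DecidablePred e] :
    (viewTm e).sem (unitNat k.N) k.N =
      (PMF.uniformOfFintype (Fin m → (ZMod k.N)ˣ)).bind fun τ =>
      (PMF.uniformOfFintype (Fin m → ZMod k.N × (ZMod k.N)ˣ)).bind fun a =>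
        PMF.pure (.ofFin fun j => .pair (zdata (enc2 (if e j then 1 else 0) (τ j)))
          (zdata (enc (a j).1 (a j).2))) := by
  have : Fact (1 < k.N ^ 2) := ⟨Nat.one_lt_pow (by norm_num) k.one_lt_N⟩
  let g : (ZMod k.N)ˣ × (ZMod k.N × (ZMod k.N)ˣ) → Fin m → Data := fun c j =>
    .pair (zdata (enc2 (if e j then 1 else 0) c.1)) (zdata (enc c.2.1 c.2.2))
  refine Eq.trans ?_ (uniform_pi_prod_bind (γ := Data)
    fun c : Fin m → (ZMod k.N)ˣ × (ZMod k.N × (ZMod k.N)ˣ) =>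
      PMF.pure (Data.ofFin fun j => g (c j) j))
  rw [uniform_ofFin fun j c => g c j, viewTm, Tm.sem_ofFin]
  congr 1; ext1 j
  rw [uniform_prod_bind, Tm.sem, sem_enc2, sem_rnd]
  simp only [PMF.bind_bind, PMF.pure_bind]
  congr 1; ext1 τ; congr 1; ext1 a
  congr 3
  rw [val_enc2]
  split_ifs
  · rw [ZMod.val_one]
  · rw [ZMod.val_zero]

lemma sem_outputTm (k : Key) (W : ℕ) :
    (outputTm m W).sem (unitNat k.N) k.N =
      if m = 0 then PMF.pure (.nat 1)
      else (PMF.uniformOfFintype (ZMod k.N)ˣ).bind fun ζ =>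
        PMF.pure (zdata (enc (W : ZMod k.N) ζ)) := by
  unfold outputTm
  split_ifs
  · simp [Tm.sem, leafSem, Src.sem, Post.sem]
  · exact sem_enc _ _

/-- The output of `S₁` is a fresh encryption. -/
lemma sem_outputTm_bind {γ : Type} (k : Key) (x : Fin m → ℕ) (g : Fin m → (ZMod k.N)ˣ)
    (f : Data → PMF γ) :
    ((PMF.uniformOfFintype (Fin m → (ZMod k.N)ˣ)).bind fun b =>
      f (.nat (enc (∑ j, (x j : ZMod k.N)) (∏ j, g j * b j)).val)) =
    ((outputTm m (∑ j, x j)).sem (unitNat k.N) k.N).bind f := by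
  have : Fact (1 < k.N ^ 2) := ⟨Nat.one_lt_pow (by norm_num) k.one_lt_N⟩
  rw [sem_outputTm]
  split_ifs with hm
  · subst hm
    simp [enc_zero_one, ZMod.val_one]
  · rw [uniform_bind_prod hm g fun z => f (.nat (enc (∑ j, (x j : ZMod k.N)) z).val)]
    simp [zdata]

/-- View and output of `S₁`, given the numbers that `S₂` decrypts. -/
lemma view_output_S1 {γ : Type} (k : Key) (b : Fin m → ZMod k.N) (x : Fin m → ℕ)
    (ρ : Fin m → (ZMod k.N)ˣ) (G : Data → Data → PMF γ) :
    ((PMF.uniformOfFintype (Fin m → (ZMod k.N)ˣ)).bind fun τ =>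
      (PMF.uniformOfFintype (Fin m → (ZMod k.N)ˣ)).bind fun zero =>
      (PMF.uniformOfFintype (Fin m → RecoverCoins k.N)).bind fun ω =>
        let c : Fin m → ZMod k.N := fun j => if b j = 0 then (x j : ZMod k.N) else 0
        let g : Fin m → (ZMod k.N)ˣ := fun j => if b j = 0 then ρ j else zero j
        G (.ofFin fun j => .pair (zdata (enc2 (if b j = 0 then 1 else 0) (τ j)))
          (zdata (enc (c j + (ω j).1.1) (g j * (ω j).1.2 * (ω j).2.2))))
          (.nat (enc (∑ j, c j) (∏ j, g j * (ω j).2.2)).val)) =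
    ((viewTm fun j => b j = 0).sem (unitNat k.N) k.N).bind fun v =>
      ((outputTm m (∑ j, if b j = 0 then x j else 0)).sem (unitNat k.N) k.N).bind fun o =>
        G v o := by
  rw [sem_viewTm]
  simp only [PMF.bind_bind, PMF.pure_bind]
  congr 1; ext1 τ
  have hc : ∀ j, (if b j = 0 then (x j : ZMod k.N) else 0) =
      ((if b j = 0 then x j else 0 : ℕ) : ZMod k.N) := fun j => by split_ifs <;> simp
  have h1 : ∀ zero : Fin m → (ZMod k.N)ˣ, _ = _ := fun zero => uniform_bind_recover_S1
    (fun j => if b j = 0 then (x j : ZMod k.N) else 0) (fun j => if b j = 0 then ρ j else zero j)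
    fun a z => G (.ofFin fun j => .pair (zdata (enc2 (if b j = 0 then 1 else 0) (τ j)))
      (zdata (enc (a j).1 (a j).2)))
      (.nat (enc (∑ j, if b j = 0 then (x j : ZMod k.N) else 0) (∏ j, z j)).val)
  simp only [h1]
  rw [PMF.bind_comm]
  congr 1; ext1 a
  simp only [hc, sem_outputTm_bind k (fun j => if b j = 0 then x j else 0) _ (G _), PMF.bind_const]

/-- The joint distribution of the view and the output of `S₁`. -/
lemma sd_secWorst_S1 {γ : Type} (k : Key) {l : ℕ} (hl : 2 ^ l ≤ k.N) (hs : 0 < s) (h : Fin s → ℕ)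
    (x : ℕ) (h' : Fin m → Fin s → ℕ) (x' : Fin m → ℕ)
    (ρ : (Fin s → (ZMod k.N)ˣ) × (ZMod k.N)ˣ)
    (ρ' : Fin m → (Fin s → (ZMod k.N)ˣ) × (ZMod k.N)ˣ)
    (e : Fin m → Prop) [DecidablePred e] (h0 : ∀ j, e j → ∀ i, h' j i = h i)
    (h1 : ∀ j, ¬ e j → IsUnit ((h ⟨0, hs⟩ : ZMod k.N) - h' j ⟨0, hs⟩)) (G : Data → Data → PMF γ) :
    SD ((secWorst k (encItem h x ρ) (fun j => encItem (h' j) (x' j) (ρ' j))).bind fun T =>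
        G T.viewS1 (.nat T.output))
      ((PMF.uniformOfFintype (Equiv.Perm (Fin m))).bind fun π =>
        ((viewTm fun j => e (π j)).sem (unitNat k.N) k.N).bind fun v =>
        ((outputTm m (∑ j, if e j then x' j else 0)).sem (unitNat k.N) k.N).bind fun o => G v o)
      (m * ((2 : ℝ≥0∞) ^ l)⁻¹) := by
  classical
  rw [secWorst_encItem]
  simp only [PMF.bind_bind, PMF.pure_bind]
  refine SD.bind_const _ fun π _ => ?_
  let S : (Fin m → ZMod k.N) → PMF γ := fun b =>
    ((viewTm fun j => b j = 0).sem (unitNat k.N) k.N).bind fun v =>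
      ((outputTm m (∑ j, if b j = 0 then x' (π j) else 0)).sem (unitNat k.N) k.N).bind fun o => G v o
  refine (congrArg (fun Z => SD Z _ _) (congrArg (PMF.bind _) (funext fun r => ?_) :
    _ = (PMF.uniformOfFintype (Fin m → Fin s → ZMod k.N)).bind fun r =>
    S fun j => ∑ i, r j i * ((h i : ZMod k.N) - (h' (π j) i : ZMod k.N)))).mpr ?_
  · simp only [PMF.bind_const]
    exact view_output_S1 k _ _ _ G
  rw [uniform_bind_linear hs (fun j => e (π j))
    (fun j i => (h i : ZMod k.N) - (h' (π j) i : ZMod k.N))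
    (fun j hj i => by rw [h0 _ hj i, sub_self]) (fun j hj => h1 _ hj) S]
  have hS : ∀ y : Fin m → ZMod k.N, (¬ ∃ j, y j = 0) → (S fun j => if e (π j) then 0 else y j) =
      ((viewTm fun j => e (π j)).sem (unitNat k.N) k.N).bind fun v =>
        ((outputTm m (∑ j, if e j then x' j else 0)).sem (unitNat k.N) k.N).bind fun o => G v o := by
    intro y hy
    have he : ∀ j, (if e (π j) then 0 else y j) = 0 ↔ e (π j) := fun j => by
      split_ifs with hj
      · simp [hj]
      · simpa [hj] using fun h => hy ⟨j, h⟩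
    simp only [S, he]
    rw [Equiv.sum_comp π fun j => if e j then x' j else 0]
  rw [← PMF.bind_const (PMF.uniformOfFintype (Fin m → ZMod k.N))
    (((viewTm fun j => e (π j)).sem (unitNat k.N) k.N).bind fun v =>
      ((outputTm m (∑ j, if e j then x' j else 0)).sem (unitNat k.N) k.N).bind fun o => G v o)]
  exact (SD.bind_event _ (fun y => ∃ j, y j = 0) fun y _ hy => hS y hy).mono (Ex_exists_zero_le hl)

/-- View of `S₂`, given the numbers that it decrypts. -/
lemma view_S2 {γ : Type} (k : Key) (b c : Fin m → ZMod k.N) (S : Fin m → (ZMod k.N)ˣ)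
    (g : (Fin m → (ZMod k.N)ˣ) → Fin m → (ZMod k.N)ˣ)
    (D : (Fin m → (ZMod k.N)ˣ) → (Fin m → (ZMod k.N)ˣ) → (Fin m → (ZMod k.N)ˣ) →
      Fin m → ZMod k.N × (ZMod k.N)ˣ → (ZMod k.N)ˣ) (G : Data → PMF γ) :
    ((PMF.uniformOfFintype (Fin m → (ZMod k.N)ˣ)).bind fun β =>
      (PMF.uniformOfFintype (Fin m → (ZMod k.N)ˣ)).bind fun τ =>
      (PMF.uniformOfFintype (Fin m → (ZMod k.N)ˣ)).bind fun one =>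
      (PMF.uniformOfFintype (Fin m → (ZMod k.N)ˣ)).bind fun zero =>
      (PMF.uniformOfFintype (Fin m → RecoverCoins k.N)).bind fun ω =>
        G (.ofFin fun j => .pair (zdata (enc (b j) (S j * β j)))
            (zdata (enc2 (enc (c j + (ω j).1.1) (g zero j * (ω j).1.2))
              (D τ one zero j (ω j).1 * (ω j).2.1))))) =
    (PMF.uniformOfFintype (Fin m → (ZMod k.N)ˣ × (ZMod k.N × (ZMod k.N)ˣ) × (ZMod k.N)ˣ)).bind
      fun a => G (.ofFin fun j => .pair (zdata (enc (b j) (a j).1))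
        (zdata (enc2 (enc (a j).2.1.1 (a j).2.1.2) (a j).2.2))) := by
  have h1 : ∀ β τ one zero : Fin m → (ZMod k.N)ˣ, _ = _ := fun β τ one zero =>
    uniform_bind_recover_S2 c (g zero) (D τ one zero) fun a z =>
      G (.ofFin fun j => .pair (zdata (enc (b j) (S j * β j)))
        (zdata (enc2 (enc (a j).1 (a j).2) (z j))))
  simp only [h1, PMF.bind_const]
  refine (uniform_bind_pi_mulRight S fun β =>
    (PMF.uniformOfFintype (Fin m → ZMod k.N × (ZMod k.N)ˣ)).bind fun a =>
      (PMF.uniformOfFintype (Fin m → (ZMod k.N)ˣ)).bind fun z =>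
        G (.ofFin fun j => .pair (zdata (enc (b j) (β j)))
          (zdata (enc2 (enc (a j).1 (a j).2) (z j))))).trans ?_
  simp only [uniform_pi_prod_bind]

lemma doubleEnc_unitNat (k : Key) :
    doubleEnc (unitNat k.N) k.N =
      (PMF.uniformOfFintype ((ZMod k.N × (ZMod k.N)ˣ) × (ZMod k.N)ˣ)).bind fun a =>
        PMF.pure (zdata (enc2 (enc a.1.1 a.1.2) a.2)) := by
  rw [uniform_prod_bind, uniform_prod_bind, doubleEnc, ← uniform_zmod_map_val]
  simp only [unitNat, PMF.bind_map, Function.comp_def, zdata, val_enc2, val_enc]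

lemma entryS2_unitNat (k : Key) (eq : Prop) [Decidable eq] :
    entryS2 (unitNat k.N) k.N eq = (PMF.uniformOfFintype (ZMod k.N ×
      (ZMod k.N)ˣ × (ZMod k.N × (ZMod k.N)ˣ) × (ZMod k.N)ˣ)).bind fun a =>
        PMF.pure (.pair (zdata (enc (if eq then 0 else a.1) a.2.1))
          (zdata (enc2 (enc a.2.2.1.1 a.2.2.1.2) a.2.2.2))) := by
  rw [entryS2, uniform_prod_bind, doubleEnc_unitNat, sem_enc, sem_rnd, Nat.cast_zero]
  have h1 : ∀ a : ZMod k.N, _ = _ := fun a => uniform_prod_bind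
    fun c : (ZMod k.N)ˣ × (ZMod k.N × (ZMod k.N)ˣ) × (ZMod k.N)ˣ => PMF.pure
      (Data.pair (zdata (enc (if eq then 0 else a) c.1)) (zdata (enc2 (enc c.2.1.1 c.2.1.2) c.2.2)))
  rw [funext h1]
  split_ifs <;> simp [uniform_prod_bind]

/-- The distribution of the view of `S₂`. -/
lemma secWorst_S2 {γ : Type} (k : Key) (hs : 0 < s) (h : Fin s → ℕ)
    (x : ℕ) (h' : Fin m → Fin s → ℕ) (x' : Fin m → ℕ)
    (ρ : (Fin s → (ZMod k.N)ˣ) × (ZMod k.N)ˣ)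
    (ρ' : Fin m → (Fin s → (ZMod k.N)ˣ) × (ZMod k.N)ˣ)
    (e : Fin m → Prop) [DecidablePred e] (h0 : ∀ j, e j → ∀ i, h' j i = h i)
    (h1 : ∀ j, ¬ e j → IsUnit ((h ⟨0, hs⟩ : ZMod k.N) - h' j ⟨0, hs⟩)) (G : Data → PMF γ) :
    ((secWorst k (encItem h x ρ) (fun j => encItem (h' j) (x' j) (ρ' j))).bind fun T =>
        G T.viewS2) =
      (PMF.uniformOfFintype (Equiv.Perm (Fin m))).bind fun π =>
        (ofFinM fun j => entryS2 (unitNat k.N) k.N (e (π j))).bind G := by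
  classical
  rw [secWorst_encItem]
  simp only [PMF.bind_bind, PMF.pure_bind]
  congr 1; ext1 π
  let S : (Fin m → ZMod k.N) → PMF γ := fun b =>
    (PMF.uniformOfFintype (Fin m → (ZMod k.N)ˣ × (ZMod k.N × (ZMod k.N)ˣ) × (ZMod k.N)ˣ)).bind
      fun a => G (.ofFin fun j => .pair (zdata (enc (b j) (a j).1))
        (zdata (enc2 (enc (a j).2.1.1 (a j).2.1.2) (a j).2.2)))
  refine (congrArg (PMF.bind _) (funext fun r => ?_) :
    _ = (PMF.uniformOfFintype (Fin m → Fin s → ZMod k.N)).bind fun r =>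
    S fun j => ∑ i, r j i * ((h i : ZMod k.N) - (h' (π j) i : ZMod k.N))).trans ?_
  · exact view_S2 k _ _ _ (fun zero j => if ∑ i, r j i * ((h i : ZMod k.N) - h' (π j) i) = 0
      then (ρ' (π j)).2 else zero j)
      (fun τ one zero j a => (τ j ^ (enc (x' (π j) : ZMod k.N) (ρ' (π j)).2).val *
          (one j * (τ j)⁻¹) ^ (enc 0 (zero j)).val) ^ (enc a.1 a.2).val) G
  rw [uniform_bind_linear hs (fun j => e (π j))
    (fun j i => (h i : ZMod k.N) - (h' (π j) i : ZMod k.N))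
    (fun j hj i => by rw [h0 _ hj i, sub_self]) (fun j hj => h1 _ hj) S]
  simp only [entryS2_unitNat, S]
  rw [← uniform_ofFin fun j (a : ZMod k.N × (ZMod k.N)ˣ × (ZMod k.N × (ZMod k.N)ˣ) × (ZMod k.N)ˣ) =>
    .pair (zdata (enc (if e (π j) then 0 else a.1) a.2.1))
      (zdata (enc2 (enc a.2.2.1.1 a.2.2.1.2) a.2.2.2)), PMF.bind_bind, uniform_pi_prod_bind]
  simp only [PMF.pure_bind]

end Views

/-! ## Mixtures -/

/-- Computational indistinguishability is preserved under mixtures. -/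
lemma CompIndist.mix {C : ℕ → Type} [∀ l, Nonempty (C l)] (θ : ∀ l, PMF (C l))
    {X Y : ∀ l, C l → PMF Data} (h : ∀ c : ∀ l, C l, CompIndist (fun l => X l (c l)) fun l => Y l (c l)) :
    CompIndist (fun l => (θ l).bind (X l)) fun l => (θ l).bind (Y l) := by
  intro D hD a ha
  obtain ⟨ε, hε, hε0, hle⟩ := exists_uniform_negligible (fun l (c : C l) =>
    |prOne ((X l c).bind fun x => D.out (.pair (.unary l) (.pair (a l) x)))
      - prOne ((Y l c).bind fun y => D.out (.pair (.unary l) (.pair (a l) y)))|) 1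
    (fun _ _ => abs_nonneg _) (fun _ _ => abs_prOne_sub_le_one _ _) fun c => h c D hD a ha
  refine hε.mono fun l => ?_
  rw [abs_abs, PMF.bind_bind, PMF.bind_bind]
  exact abs_prOne_bind_sub_le _ _ _ (hle l) (hε0 l)

lemma Ex_uniform_eval {ι α : Type} [Fintype ι] [DecidableEq ι] [Fintype α] [Nonempty α] (i : ι)
    (f : α → ℝ≥0∞) :
    Ex (PMF.uniformOfFintype (ι → α)) (fun κ => f (κ i)) = Ex (PMF.uniformOfFintype α) f := by
  classical
  rw [← PMF.bind_pure (PMF.uniformOfFintype (ι → α)),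
    ← uniform_bind_equiv (Equiv.funSplitAt i α).symm, uniform_prod_bind]
  simp [Ex_bind, Ex_pure, Ex_const, Equiv.funSplitAt]

/-- The probability of a union of events. -/
lemma Ex_exists_le {α ι : Type} [Fintype ι] (X : PMF α) (B : ι → α → Prop) (c : ℝ≥0∞)
    [∀ i, DecidablePred (B i)] {_ : DecidablePred fun a => ∃ i, B i a}
    (h : ∀ i, Ex X (fun a => if B i a then 1 else 0) ≤ c) :
    Ex X (fun a => if ∃ i, B i a then 1 else 0) ≤ Fintype.card ι * c := by
  calc _ ≤ Ex X (fun a => ∑ i, if B i a then 1 else 0) := Ex_mono fun a _ => by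
          split_ifs with h
          · obtain ⟨j, hj⟩ := h
            refine le_trans ?_ (Finset.single_le_sum (fun _ _ => zero_le) (Finset.mem_univ j))
            rw [if_pos hj]
          · exact zero_le
    _ = ∑ i, Ex X (fun a => if B i a then 1 else 0) := by
        simp only [Ex, Finset.mul_sum]
        exact Summable.tsum_finsetSum fun i _ => ENNReal.summable
    _ ≤ ∑ _i : ι, c := Finset.sum_le_sum fun j _ => h j
    _ = _ := by simp

/-! ## The encrypted relation -/

section Encryption

variable {s M n : ℕ}

/-- The encryption of an item. -/
def itemTm (h : Fin s → ℕ) (x : ℕ) : Tm :=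
  .pair (.ofFin fun t => .leaf (.enc (h t)) .none) (.leaf (.enc x) .none)

/-- The encryption of a relation. -/
def relTm (h : Fin M → Fin n → Fin s → ℕ) (x : Fin M → Fin n → ℕ) : Tm :=
  .ofFin fun i => .ofFin fun d => itemTm (h i d) (x i d)

lemma sem_itemTm (k : Key) (h : Fin s → ℕ) (x : ℕ) :
    (itemTm h x).sem (unitNat k.N) k.N =
      (PMF.uniformOfFintype ((Fin s → (ZMod k.N)ˣ) × (ZMod k.N)ˣ)).bind fun ρ =>
        PMF.pure (encItem h x ρ).data := by
  have h1 := uniform_ofFin fun (t : Fin s) (ρ : (ZMod k.N)ˣ) => zdata (enc (h t : ZMod k.N) ρ)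
  rw [uniform_prod_bind, itemTm, Tm.sem, Tm.sem_ofFin]
  simp only [sem_enc, ← h1, PMF.bind_bind, PMF.pure_bind]
  rfl

lemma sem_relTm (k : Key) (h : Fin M → Fin n → Fin s → ℕ) (x : Fin M → Fin n → ℕ) :
    (relTm h x).sem (unitNat k.N) k.N =
      (PMF.uniformOfFintype (Fin M → Fin n → (Fin s → (ZMod k.N)ˣ) × (ZMod k.N)ˣ)).bind fun ρ =>
        PMF.pure (.ofFin fun i => .ofFin fun d => (encItem (h i d) (x i d) (ρ i d)).data) := by
  rw [uniform_ofFin fun (i : Fin M) (ρ : Fin n → (Fin s → (ZMod k.N)ˣ) × (ZMod k.N)ˣ) =>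
    .ofFin fun d => (encItem (h i d) (x i d) (ρ d)).data, relTm, Tm.sem_ofFin]
  congr 1; ext1 i
  rw [Tm.sem_ofFin, uniform_ofFin fun (d : Fin n) ρ => (encItem (h i d) (x i d) ρ).data]
  simp only [sem_itemTm]

lemma hide_enc_none (m : ℕ) : (Tm.leaf (.enc m) .none).hide = .leaf (.enc m) .none := by
  cases m <;> rfl

lemma hide_relTm (h : Fin M → Fin n → Fin s → ℕ) (x : Fin M → Fin n → ℕ) :
    (relTm h x).hide = relTm h x := by
  simp only [relTm, itemTm, Tm.hide_ofFin, Tm.hide, hide_enc_none]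

lemma hide_viewTm (e : Fin n → Prop) [DecidablePred e] :
    (viewTm e).hide = .ofFin fun _ : Fin n => .pair (.leaf .rnd .lift) (.leaf .rnd .none) := by
  simp only [viewTm, Tm.hide_ofFin, Tm.hide]

lemma hide_outputTm (n W : ℕ) : (outputTm n W).hide = outputTm n W := by
  unfold outputTm; split_ifs
  · rfl
  · exact hide_enc_none W

lemma csize_enc_le {x B : ℕ} (h : Nat.size x ≤ B) : (Tm.leaf (.enc x) .none).csize ≤ B + 20 := by
  rw [Tm.csize_leaf]
  have h2 : Nat.size 1 = 1 := by decide
  have h3 : Nat.size 3 = 2 := by decide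
  simp only [Src.encode, Post.encode, Data.size, Nat.size_zero, h2, h3]
  omega

lemma csize_relTm_le {h : Fin M → Fin n → Fin s → ℕ} {x : Fin M → Fin n → ℕ} {B : ℕ}
    (hh : ∀ i d t, Nat.size (h i d t) ≤ B) (hx : ∀ i d, Nat.size (x i d) ≤ B) :
    (relTm h x).csize ≤ M * (n * (s * (B + 20 + 3) + 14 + (B + 20) + 3 + 3) + 14 + 3) + 14 := by
  refine Tm.csize_ofFin_le fun i => Tm.csize_ofFin_le fun d => ?_
  rw [itemTm, Tm.csize_pair]
  have h1 := Tm.csize_ofFin_le fun t => csize_enc_le (hh i d t)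
  have h2 := csize_enc_le (hx i d)
  omega

lemma csize_viewTm_le (e : Fin n → Prop) [DecidablePred e] : (viewTm e).csize ≤ n * 53 + 14 := by
  refine Tm.csize_ofFin_le (B := 50) fun j => ?_
  rw [Tm.csize_pair, Tm.csize_leaf, Tm.csize_leaf]
  have h1 : Nat.size 1 = 1 := by decide
  have h2 : Nat.size 2 = 2 := by decide
  have h3 : Nat.size 3 = 2 := by decide
  split_ifs <;> simp only [Src.encode, Post.encode, Data.size, Nat.size_zero, h1, h2, h3] <;> omega

lemma csize_outputTm_le {W B : ℕ} (h : Nat.size W ≤ B) : (outputTm n W).csize ≤ B + 20 := by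
  unfold outputTm
  split_ifs
  · rw [Tm.csize_leaf]
    have h1 : Nat.size 1 = 1 := by decide
    simp only [Src.encode, Post.encode, Data.size, Nat.size_zero, h1]
    omega
  · exact csize_enc_le h

lemma size_sum_le {x : Fin n → ℕ} {B : ℕ} (h : ∀ j, Nat.size (x j) ≤ B) :
    Nat.size (∑ j, x j) ≤ B + n := by
  rw [Nat.size_le, pow_add]
  calc ∑ j, x j ≤ ∑ _j : Fin n, 2 ^ B := Finset.sum_le_sum fun j _ => (Nat.size_le.1 (h j)).le
    _ = 2 ^ B * n := by simp [mul_comm]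
    _ < 2 ^ B * 2 ^ n := by gcongr; exact Nat.lt_two_pow_self

end Encryption

/-! ## Security of `SecWorst` -/

section SecWorst

variable {K : ℕ → PMF Key} {dom len : ℕ → ℕ} {F : HashFamily dom len} {s : ℕ}

lemma Instance.m_le {d : ℕ} (I : Instance d) : I.m ≤ I.R.M := by
  have := Fintype.card_le_of_embedding I.lists
  simp only [Fintype.card_fin] at this
  omega

/-- Hash values of distinct objects of `H` and `I` with a non-invertible difference. -/
def BadKey (F : HashFamily dom len) (hs : 0 < s) (l N : ℕ) (I : Instance (dom l))
    (κ : Fin s → Fin (2 ^ l)) : Prop :=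
  ∃ j : Fin I.m, I.object j.succ ≠ I.object 0 ∧
    ¬ IsUnit (((F l (κ ⟨0, hs⟩) (I.object 0) : ℕ) : ZMod N) -
      ((F l (κ ⟨0, hs⟩) (I.object j.succ) : ℕ) : ZMod N))

open scoped Classical in
lemma exists_badKey_bound (hK : IsKeyGen K) (hlen : ∀ l, l ≤ len l) (hF : IsPRF F) (hs : 0 < s)
    {I : ∀ l, Instance (dom l)} (hI : Instance.PolySize I) :
    ∃ δ : ℕ → ℝ, Negligible δ ∧ (∀ l, 0 ≤ δ l) ∧ ∀ l, ∀ k ∈ (K l).support,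
      Ex (PMF.uniformOfFintype (Fin s → Fin (2 ^ l)))
        (fun κ => if BadKey F hs l k.N (I l) κ then 1 else 0) ≤ ENNReal.ofReal (δ l) := by
  obtain ⟨P, hP⟩ := hI
  obtain ⟨hK1, Q, hQ⟩ := hK
  obtain ⟨ε, hε, hε0, hle⟩ := exists_collision_bound hlen hF (B := fun l => (P + Q).eval l)
    ⟨P + Q, fun l => le_rfl⟩
  have hm : PolyBounded fun l => (I l).m := ⟨P, fun l => (I l).m_le.trans (hP l).2.1⟩
  refine ⟨fun l => (I l).m * (2 * ε l), (hε.const_mul 2).poly_mul (fun l => by linarith [hε0 l]) hm,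
    fun l => by have := hε0 l; positivity, fun l k hk => ?_⟩
  rw [ENNReal.ofReal_mul (Nat.cast_nonneg _), ENNReal.ofReal_natCast]
  refine (Ex_exists_le _ (fun (j : Fin (I l).m) κ => _ ∧ _) _ fun j => ?_).trans
    (by rw [Fintype.card_fin])
  have hsize : ∀ j, Nat.size ((I l).object j) ≤ (P + Q).eval l := fun j =>
    ((hP l).2.2 _ _).1.trans (by simp)
  have hN : ∀ p, p ≤ k.N → Nat.size p ≤ (P + Q).eval l := fun p hp =>
    (Nat.size_le_size hp).trans ((hQ l k hk).trans (by simp))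
  have hp : k.p ≤ k.N := Nat.le_mul_of_pos_right _ k.prime_q.pos
  have hq : k.q ≤ k.N := Nat.le_mul_of_pos_left _ k.prime_p.pos
  by_cases ho : (I l).object 0 = (I l).object j.succ
  · simp [ho, Ex_const]
  have hcol : ∀ p, 2 ^ l ≤ p → p ≤ k.N → _ := fun p h1 h2 =>
    hle l p _ _ h1 (hN p h2) (hsize 0) (hsize j.succ) ho
  rw [two_mul, ENNReal.ofReal_add (hε0 l) (hε0 l)]
  refine le_trans ?_ (add_le_add (hcol k.p (hK1 l k hk).1 hp) (hcol k.q (hK1 l k hk).2 hq))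
  rw [← Ex_add]
  refine le_trans ?_ (Ex_uniform_eval (ι := Fin s) ⟨0, hs⟩ _).le
  refine Ex_mono fun κ _ => ?_
  split_ifs with h1 h2 h3 h3 <;> try simp
  exact h1.2 (isUnit_sub_of_not_modEq k h2 h3)

/-- Hash values under the keys `κ`. -/
def hashes (F : HashFamily dom len) {l : ℕ} (κ : Fin s → Fin (2 ^ l)) (o : Fin (2 ^ dom l))
    (t : Fin s) : ℕ := F l (κ t) o

/-- The encryption of the relation with hash keys `κ` and randomness `ρ`. -/
def encRelWith (F : HashFamily dom len) {l : ℕ} (k : Key) (R : Relation (dom l))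
    (κ : Fin s → Fin (2 ^ l))
    (ρ : Fin R.M → Fin R.n → (Fin s → (ZMod k.N)ˣ) × (ZMod k.N)ˣ) : EncRel k.N s R :=
  fun i d => encItem (hashes F κ (R.obj i d)) (R.score i d) (ρ i d)

/-- Continue with a random key pair and a random encryption of the relation. -/
noncomputable def withSetup {β : Type} (K : ℕ → PMF Key) (F : HashFamily dom len) (s : ℕ) {l : ℕ}
    (R : Relation (dom l)) (f : ∀ k : Key, EncRel k.N s R → PMF β) : PMF β :=
  (K l).bind fun k => (PMF.uniformOfFintype (Fin s → Fin (2 ^ l))).bind fun κ =>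
    (PMF.uniformOfFintype (Fin R.M → Fin R.n → (Fin s → (ZMod k.N)ˣ) × (ZMod k.N)ˣ)).bind fun ρ =>
      f k (encRelWith F k R κ ρ)

lemma setup_bind {β : Type} (l : ℕ) (I : Instance (dom l))
    (f : (secWorstExperiment K F s l I).Setup → PMF β) :
    (secWorstExperiment K F s l I).setup.bind f =
      withSetup K F s I.R fun k ER => f (⟨k, ER⟩ : Σ k : Key, EncRel k.N s I.R) := by
  have h : ∀ f : (Σ k : Key, EncRel k.N s I.R) → PMF β,
      ((K l).bind fun k => (encRel F s l k.N I.R).map fun ER => ⟨k, ER⟩).bind f =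
        withSetup K F s I.R fun k ER => f ⟨k, ER⟩ := fun f => by
    simp only [encRel, PMF.bind_bind, PMF.bind_map, PMF.map_bind, PMF.map_comp]
    rfl
  exact h f

/-- Run `SecWorst` on an encrypted relation. -/
noncomputable def runWorst {d : ℕ} (I : Instance d) (k : Key) (ER : EncRel k.N s I.R) :
    PMF Transcript :=
  secWorst k (ER (I.lists 0) I.d) fun j => ER (I.lists j.succ) I.d

open scoped Classical in
/-- The joint distribution of the setup and of view and output of `S₁`. -/
lemma sd_exec_S1 {γ : Type} (hK : IsKeyGen K) (hs : 0 < s) {l : ℕ} (I : Instance (dom l)) {δ : ℝ≥0∞}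
    (hδ : ∀ k ∈ (K l).support, Ex (PMF.uniformOfFintype (Fin s → Fin (2 ^ l)))
      (fun κ => if BadKey F hs l k.N I κ then 1 else 0) ≤ δ)
    (G : ∀ k : Key, EncRel k.N s I.R → Data → Data → PMF γ) :
    SD (withSetup K F s I.R fun k ER => (runWorst I k ER).bind fun T => G k ER T.viewS1 (.nat T.output))
      (withSetup K F s I.R fun k ER =>
        (PMF.uniformOfFintype (Equiv.Perm (Fin I.m))).bind fun π =>
        ((viewTm fun j => I.object (π j).succ = I.object 0).sem (unitNat k.N) k.N).bind fun v =>
        ((outputTm I.m I.worst).sem (unitNat k.N) k.N).bind fun o => G k ER v o)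
      (I.m * ((2 : ℝ≥0∞) ^ l)⁻¹ + δ) := by
  refine SD.bind_const _ fun k hk => ?_
  refine SD.mono (SD.bind_right (PMF.uniformOfFintype (Fin s → Fin (2 ^ l)))
    (ε := fun κ => I.m * ((2 : ℝ≥0∞) ^ l)⁻¹ + if BadKey F hs l k.N I κ then 1 else 0)
    fun κ _ => ?_) ?_
  · split_ifs with hbad
    · exact (SD.one _ _).mono le_add_self
    · rw [add_zero]
      refine SD.bind_const _ fun ρ _ => ?_
      refine sd_secWorst_S1 k ?_ hs _ _ _ _ _ _ (fun j => I.object j.succ = I.object 0) ?_ ?_ _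
      · exact ((hK.1 l k hk).1).trans (Nat.le_mul_of_pos_right _ k.prime_q.pos)
      · intro j hj i
        simp only [hashes]
        rw [show I.R.obj (I.lists j.succ) I.d = I.R.obj (I.lists 0) I.d from hj]
      · intro j hj
        by_contra hcon
        exact hbad ⟨j, hj, hcon⟩
  · rw [Ex_add, Ex_const]
    gcongr
    exact hδ k hk

open scoped Classical in
/-- The joint distribution of the setup and of the view of `S₂`. -/
lemma sd_exec_S2 {γ : Type} (hs : 0 < s) {l : ℕ} (I : Instance (dom l)) {δ : ℝ≥0∞}
    (hδ : ∀ k ∈ (K l).support, Ex (PMF.uniformOfFintype (Fin s → Fin (2 ^ l)))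
      (fun κ => if BadKey F hs l k.N I κ then 1 else 0) ≤ δ)
    (G : ∀ k : Key, EncRel k.N s I.R → Data → PMF γ) :
    SD (withSetup K F s I.R fun k ER => (runWorst I k ER).bind fun T => G k ER T.viewS2)
      (withSetup K F s I.R fun k ER =>
        (PMF.uniformOfFintype (Equiv.Perm (Fin I.m))).bind fun π =>
        (ofFinM fun j => entryS2 (unitNat k.N) k.N (I.object 0 = I.object (π j).succ)).bind (G k ER))
      δ := by
  refine SD.bind_const _ fun k hk => ?_
  refine (SD.bind_event (PMF.uniformOfFintype (Fin s → Fin (2 ^ l))) (BadKey F hs l k.N I)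
    fun κ _ hbad => ?_).mono (hδ k hk)
  congr 1; ext1 ρ
  refine secWorst_S2 k hs _ _ _ _ _ _ (fun j => I.object 0 = I.object j.succ) ?_ ?_ _
  · intro j hj i
    simp only [hashes]
    rw [show I.R.obj (I.lists 0) I.d = I.R.obj (I.lists j.succ) I.d from hj]
  · intro j hj
    by_contra hcon
    exact hbad ⟨j, fun h => hj h.symm, hcon⟩

lemma SD.withSetup {β : Type} {l : ℕ} {R : Relation (dom l)} {f g : ∀ k : Key, EncRel k.N s R → PMF β}
    {ε : ℝ≥0∞} (h : ∀ k ∈ (K l).support, ∀ ER, SD (f k ER) (g k ER) ε) :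
    SD (withSetup K F s R f) (withSetup K F s R g) ε :=
  SD.bind_const _ fun k hk => SD.bind_const _ fun _ _ => SD.bind_const _ fun _ _ => h k hk _

/-- Public key, encrypted relation, view and output of `S₁`, for given equality pattern. -/
def realTm (F : HashFamily dom len) {l : ℕ} (I : Instance (dom l))
    (c : (Fin s → Fin (2 ^ l)) × Equiv.Perm (Fin I.m)) : Tm :=
  .pair (.pair (.leaf .pk .none) (relTm (fun i d => hashes F c.1 (I.R.obj i d)) I.R.score))
    (.pair (viewTm fun j => I.object (c.2 j).succ = I.object 0) (outputTm I.m I.worst))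

/-- The simulated view of `S₁`. -/
def simTm (m : ℕ) : Tm := .ofFin fun _ : Fin m => .pair (.leaf .rnd .lift) (.leaf .rnd .none)

lemma withSetup_sem (F : HashFamily dom len) {l : ℕ} (I : Instance (dom l))
    (t : Equiv.Perm (Fin I.m) → Tm) (t' : Tm) :
    (withSetup K F s I.R fun k ER => (PMF.uniformOfFintype (Equiv.Perm (Fin I.m))).bind fun π =>
      ((t π).sem (unitNat k.N) k.N).bind fun v => (t'.sem (unitNat k.N) k.N).bind fun o =>
        PMF.pure (.pair (.pair k.pkData ER.data) (.pair v o))) =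
    (PMF.uniformOfFintype ((Fin s → Fin (2 ^ l)) × Equiv.Perm (Fin I.m))).bind fun c =>
      (K l).bind fun k => (Tm.pair (.pair (.leaf .pk .none)
        (relTm (fun i d => hashes F c.1 (I.R.obj i d)) I.R.score)) (.pair (t c.2) t')).sem
          (unitNat k.N) k.N := by
  rw [uniform_prod_bind, withSetup, PMF.bind_comm]
  congr 1; ext1 κ
  rw [PMF.bind_comm (PMF.uniformOfFintype (Equiv.Perm (Fin I.m)))]
  congr 1; ext1 k
  rw [PMF.bind_comm]
  congr 1; ext1 π
  simp only [Tm.sem, sem_relTm, PMF.bind_bind, PMF.pure_bind, leafSem, Src.sem, Post.sem]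
  rfl

lemma realS1_eq (l : ℕ) (I : Instance (dom l)) :
    (secWorstExperiment K F s l I).realS1 = withSetup K F s I.R fun k ER =>
      (runWorst I k ER).bind fun T =>
        PMF.pure (.pair (.pair k.pkData ER.data) (.pair T.viewS1 (.nat T.output))) := by
  rw [Experiment.realS1, setup_bind]
  rfl

lemma realS2_eq (l : ℕ) (I : Instance (dom l)) :
    (secWorstExperiment K F s l I).realS2 = withSetup K F s I.R fun k ER =>
      (runWorst I k ER).bind fun T =>
        PMF.pure (.pair (.pair k.pkData (.pair k.skData ER.data)) T.viewS2) := by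
  rw [Experiment.realS2, setup_bind]
  rfl

lemma idealS1_eq (l : ℕ) (I : Instance (dom l)) :
    (secWorstExperiment K F s l I).idealS1 l Prog.simWorstS1 = withSetup K F s I.R fun k ER =>
      (runWorst I k ER).bind fun T => ((simTm I.m).sem (uniformNat k.N) k.N).bind fun v =>
        PMF.pure (.pair (.pair k.pkData ER.data) (.pair v (.nat T.output))) := by
  rw [Experiment.idealS1, setup_bind]
  congr 1; ext1 k; ext1 ER
  refine (PMF.pure_bind _ _).trans ?_
  rw [PMF.bind_comm, simTm, ← Prog.out_simWorstS1 (.unary l) I.sizeER]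
  rfl

lemma idealS2_eq (l : ℕ) (I : Instance (dom l)) :
    (secWorstExperiment K F s l I).idealS2 l Prog.simWorstS2 = withSetup K F s I.R fun k ER =>
      (PMF.uniformOfFintype (Equiv.Perm (Fin I.m))).bind fun π =>
        (ofFinM fun j => entryS2 (uniformNat k.N) k.N (I.object 0 = I.object (π j).succ)).bind
          fun v => PMF.pure (.pair (.pair k.pkData (.pair k.skData ER.data)) v) := by
  rw [Experiment.idealS2, setup_bind]
  congr 1; ext1 k; ext1 ER
  refine (PMF.bind_map _ _ _).trans ?_
  congr 1; ext1 π
  rw [← Prog.out_simWorstS2 I π (.unary l) k.skData (.unary I.m)]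
  rfl

lemma polyBounded_csize_realTm (hlen' : PolyBounded len) {I : ∀ l, Instance (dom l)}
    (hI : Instance.PolySize I)
    (c : ∀ l, (Fin s → Fin (2 ^ l)) × Equiv.Perm (Fin (I l).m)) :
    PolyBounded fun l => (realTm F (I l) (c l)).csize := by
  obtain ⟨P, hP⟩ := hI
  have hp : PolyBounded fun l => P.eval l := ⟨P, fun l => le_rfl⟩
  have hB := hp.add hlen'
  have hC := PolyBounded.const
  refine (((((hp.mul (((hp.mul (((((hC s).mul (hB.add (hC 23))).add (hC 14)).add
    (hB.add (hC 20))).add (hC 6))).add (hC 14)).add (hC 3))).add (hC 14)).add ((hp.mul (hC 53)).add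
      (hC 14))).add ((hp.add hp).add (hC 20))).add (hC 40)).mono fun l => ?_
  obtain ⟨hn, hM, hsz⟩ := hP l
  have hm := (I l).m_le.trans hM
  rw [realTm, Tm.csize_pair, Tm.csize_pair, Tm.csize_pair]
  have h1 := csize_relTm_le (B := P.eval l + len l)
    (h := fun i d => hashes F (c l).1 ((I l).R.obj i d)) (x := (I l).R.score)
    (fun i d t => (Nat.size_le.2 (F l ((c l).1 t) ((I l).R.obj i d)).isLt).trans (by omega))
    (fun i d => (hsz i d).2.trans (by omega))
  have h2 := csize_viewTm_le fun j => (I l).object ((c l).2 j).succ = (I l).object 0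
  have h3 : (outputTm (I l).m (I l).worst).csize ≤ P.eval l + (I l).m + 20 :=
    csize_outputTm_le (size_sum_le fun j => by
      split_ifs
      · exact (hsz _ _).2
      · simp)
  have h4 : (Tm.leaf .pk .none).csize ≤ 20 := by
    rw [Tm.csize_leaf]; decide
  have h5 : (I l).R.M * ((I l).R.n * (s * (P.eval l + len l + 20 + 3) + 14 +
      (P.eval l + len l + 20) + 3 + 3) + 14 + 3) ≤
      P.eval l * (P.eval l * (s * (P.eval l + len l + 23) + 14 + (P.eval l + len l + 20) + 6) +
        14 + 3) := Nat.mul_le_mul hM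
          (Nat.add_le_add (Nat.add_le_add (Nat.mul_le_mul_right _ hn) le_rfl) le_rfl)
  have h6 : (I l).m * 53 ≤ P.eval l * 53 := Nat.mul_le_mul_right _ hm
  omega

/-- The error made in `sd_exec_S1` and `sd_exec_S2` is negligible. -/
lemma exec_error {m : ℕ → ℕ} (hm : PolyBounded m) {δ : ℕ → ℝ} (hδ : Negligible δ)
    (hδ0 : ∀ l, 0 ≤ δ l) :
    Negligible (fun l => m l * ((2 : ℝ) ^ l)⁻¹ + δ l) ∧
      (∀ l, 0 ≤ (m l * ((2 : ℝ) ^ l)⁻¹ + δ l)) ∧ ∀ l, (m l * ((2 : ℝ≥0∞) ^ l)⁻¹ +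
        ENNReal.ofReal (δ l)) = ENNReal.ofReal (m l * ((2 : ℝ) ^ l)⁻¹ + δ l) := by
  refine ⟨(negligible_two_pow.poly_mul (fun l => by positivity) hm).add hδ, fun l => ?_, fun l => ?_⟩
  · have := hδ0 l; positivity
  · rw [ENNReal.ofReal_add (by positivity) (hδ0 l), ENNReal.ofReal_mul (Nat.cast_nonneg _),
      ENNReal.ofReal_natCast, ENNReal.ofReal_inv_of_pos (by positivity),
      ENNReal.ofReal_pow (by norm_num)]
    simp

/-- Polynomially many samples of random units can be replaced. -/
lemma unitErr_error {m : ℕ → ℕ} (hm : PolyBounded m) :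
    Negligible (fun l => m l * (2 * ((2 : ℝ) ^ l)⁻¹)) ∧
      (∀ l, 0 ≤ m l * (2 * ((2 : ℝ) ^ l)⁻¹)) ∧ ∀ l, (m l * unitErr l) =
        ENNReal.ofReal (m l * (2 * ((2 : ℝ) ^ l)⁻¹)) := by
  refine ⟨(negligible_two_pow.const_mul 2).poly_mul (fun l => by positivity) hm,
    fun l => by positivity, fun l => ?_⟩
  rw [ENNReal.ofReal_mul (Nat.cast_nonneg _), ENNReal.ofReal_natCast, unitErr_eq]

lemma Instance.PolySize.polyBounded_m {I : ∀ l, Instance (dom l)} (hI : Instance.PolySize I) :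
    PolyBounded fun l => (I l).m :=
  let ⟨P, hP⟩ := hI; ⟨P, fun l => (I l).m_le.trans (hP l).2.1⟩

theorem compIndist_S1 (hK : IsKeyGen K) (hE : PaillierCPASecure K) (hlen : ∀ l, l ≤ len l)
    (hlen' : PolyBounded len) (hF : IsPRF F) (hs : 0 < s) {I : ∀ l, Instance (dom l)}
    (hI : Instance.PolySize I) :
    CompIndist (fun l => (secWorstExperiment K F s l (I l)).idealS1 l Prog.simWorstS1)
      fun l => (secWorstExperiment K F s l (I l)).realS1 := by
  classical
  obtain ⟨δ, hδ, hδ0, hle⟩ := exists_badKey_bound hK hlen hF hs hI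
  obtain ⟨e1, e2, e3⟩ := exec_error hI.polyBounded_m hδ hδ0
  have hhide : ∀ l (c : (Fin s → Fin (2 ^ l)) × Equiv.Perm (Fin (I l).m)),
      (realTm F (I l) c).hide = .pair (.pair (.leaf .pk .none)
        (relTm (fun i d => hashes F c.1 ((I l).R.obj i d)) (I l).R.score))
        (.pair (simTm (I l).m) (outputTm (I l).m (I l).worst)) := fun l c => by
    simp only [realTm, Tm.hide, hide_relTm, hide_viewTm, hide_outputTm, simTm]
  have hreal : CompIndist (fun l => (secWorstExperiment K F s l (I l)).realS1) fun l =>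
      (PMF.uniformOfFintype ((Fin s → Fin (2 ^ l)) × Equiv.Perm (Fin (I l).m))).bind fun c =>
        (K l).bind fun k => (realTm F (I l) c).sem (unitNat k.N) k.N := by
    refine CompIndist.of_SD e1 e2 fun l => ?_
    have h := sd_exec_S1 hK hs (I l) (hle l) fun k ER v o =>
      PMF.pure (Data.pair (.pair k.pkData ER.data) (.pair v o))
    rw [e3, withSetup_sem F (I l) fun π => viewTm fun j => (I l).object (π j).succ = (I l).object 0] at h
    rw [realS1_eq]
    exact h
  have hideal : CompIndist (fun l => (secWorstExperiment K F s l (I l)).idealS1 l Prog.simWorstS1)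
      fun l => (PMF.uniformOfFintype ((Fin s → Fin (2 ^ l)) × Equiv.Perm (Fin (I l).m))).bind
        fun c => (K l).bind fun k => (realTm F (I l) c).hide.sem (unitNat k.N) k.N := by
    have hleaves : PolyBounded fun l => (simTm (I l).m).leaves := by
      refine ((hI.polyBounded_m.mul (.const 63)).add (.const 14)).mono fun l =>
        (Tm.leaves_le_csize _).trans (Tm.csize_ofFin_le (B := 60) fun j => ?_)
      rw [Tm.csize_pair, Tm.csize_leaf, Tm.csize_leaf]
      decide
    obtain ⟨u1, u2, u3⟩ := unitErr_error hleaves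
    refine CompIndist.of_SD (e1.add u1) (fun l => add_nonneg (e2 l) (u2 l)) fun l => ?_
    rw [ENNReal.ofReal_add (e2 l) (u2 l), ← u3, ← e3]
    have h := sd_exec_S1 hK hs (I l) (hle l) fun k ER _ o =>
      ((simTm (I l).m).sem (uniformNat k.N) k.N).bind fun v =>
        PMF.pure (Data.pair (.pair k.pkData ER.data) (.pair v o))
    rw [idealS1_eq]
    refine h.trans ?_
    simp only [hhide, PMF.bind_const]
    rw [← withSetup_sem F (I l) fun _ => simTm (I l).m]
    refine SD.withSetup fun k hk ER => ?_
    simp only [PMF.bind_const]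
    rw [PMF.bind_comm]
    exact (Tm.sd_sem k (hK.1 l k hk).1 (hK.1 l k hk).2 _).symm.bind_left _
  refine hideal.trans (CompIndist.symm (hreal.trans ?_))
  exact CompIndist.mix _ fun c =>
    compIndist_sem_hide hK hE _ (polyBounded_csize_realTm hlen' hI c)

theorem compIndist_S2 (hK : IsKeyGen K) (hlen : ∀ l, l ≤ len l)
    (hF : IsPRF F) (hs : 0 < s) {I : ∀ l, Instance (dom l)} (hI : Instance.PolySize I) :
    CompIndist (fun l => (secWorstExperiment K F s l (I l)).idealS2 l Prog.simWorstS2)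
      fun l => (secWorstExperiment K F s l (I l)).realS2 := by
  classical
  obtain ⟨δ, hδ, hδ0, hle⟩ := exists_badKey_bound hK hlen hF hs hI
  obtain ⟨u1, u2, u3⟩ := unitErr_error (hI.polyBounded_m.mul (.const 3))
  refine CompIndist.symm (CompIndist.of_SD (hδ.add u1) (fun l => add_nonneg (hδ0 l) (u2 l))
    fun l => ?_)
  rw [ENNReal.ofReal_add (hδ0 l) (u2 l), ← u3, realS2_eq, idealS2_eq]
  refine (sd_exec_S2 hs (I l) (hle l) fun k ER v =>
    PMF.pure (Data.pair (.pair k.pkData (.pair k.skData ER.data)) v)).trans ?_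
  refine SD.withSetup fun k hk ER => SD.bind_const _ fun π _ => SD.bind_left ?_ _
  rw [Nat.cast_mul, mul_assoc]
  exact SD.ofFinM fun j => sd_entryS2 k (hK.1 l k hk).1 (hK.1 l k hk).2 _

lemma dec_outputTm {d : ℕ} (I : Instance d) (k : Key) :
    (((outputTm I.m I.worst).sem (unitNat k.N) k.N).bind fun o => PMF.pure
      (dec k ((match o with | .nat n => n | _ => 0 : ℕ) : ZMod (k.N ^ 2)) = (I.worst : ZMod k.N))) =
      PMF.pure True := by
  rw [sem_outputTm]
  split_ifs with hm
  · have : I.worst = 0 := Finset.sum_eq_zero fun j _ => (Fin.cast hm j).elim0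
    rw [PMF.pure_bind, this, Nat.cast_one, ← enc_zero_one, dec_enc]
    simp
  · simp only [PMF.bind_bind, PMF.pure_bind, zdata, natCast_val_self, dec_enc, PMF.bind_const]

theorem negligible_failure (hK : IsKeyGen K) (hlen : ∀ l, l ≤ len l)
    (hF : IsPRF F) (hs : 0 < s) {I : ∀ l, Instance (dom l)} (hI : Instance.PolySize I) :
    Negligible fun l => (secWorstExperiment K F s l (I l)).failure := by
  classical
  obtain ⟨δ, hδ, hδ0, hle⟩ := exists_badKey_bound hK hlen hF hs hI
  obtain ⟨e1, e2, e3⟩ := exec_error hI.polyBounded_m hδ hδ0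
  refine e1.mono fun l => ?_
  have h := sd_exec_S1 hK hs (I l) (hle l) fun k _ _ o => PMF.pure
      (dec k ((match o with | .nat n => n | _ => 0 : ℕ) : ZMod (k.N ^ 2)) = ((I l).worst : ZMod k.N))
  simp only [dec_outputTm, PMF.bind_const, withSetup] at h
  have h2 := (h (fun P => if P = False then 1 else 0) fun P => by split_ifs <;> simp).1
  have h3 : ∀ Z : PMF Prop, Z False = Ex Z fun P => if P = False then 1 else 0 := fun Z => by
    rw [apply_eq_Ex Z False]
    congr!
  rw [e3, Ex_pure, ← h3] at h2
  rw [Experiment.failure, setup_bind, abs_of_nonneg ENNReal.toReal_nonneg]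
  refine ENNReal.toReal_le_of_le_ofReal (e2 l) (le_trans (le_of_eq ?_) (h2.trans (by simp)))
  rfl

end SecWorst

/-! ## Security of `RecoverEnc` -/

section Recover

variable {K : ℕ → PMF Key}

lemma uniform_recover_S1 {γ : Type} {N : ℕ} [NeZero N] (c : ZMod N) (g : (ZMod N)ˣ)
    (f : ZMod N × (ZMod N)ˣ → (ZMod N)ˣ → PMF γ) :
    ((PMF.uniformOfFintype (RecoverCoins N)).bind fun ω =>
      f (c + ω.1.1, g * ω.1.2 * ω.2.2) (g * ω.2.2)) =
    (PMF.uniformOfFintype (ZMod N × (ZMod N)ˣ)).bind fun a =>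
      (PMF.uniformOfFintype (ZMod N)ˣ).bind fun b => f a b := by
  rw [← uniform_bind_equiv (Equiv.funUnique (Fin 1) (RecoverCoins N)),
    ← uniform_bind_equiv (Equiv.funUnique (Fin 1) (ZMod N × (ZMod N)ˣ))]
  refine (uniform_bind_recover_S1 (fun _ : Fin 1 => c) (fun _ => g) fun a z =>
    f (a 0) (z 0)).trans ?_
  congr 1; ext1 a
  rw [uniform_bind_pi_mulRight (fun _ : Fin 1 => g) fun z => f (a 0) (z 0),
    ← uniform_bind_equiv (Equiv.funUnique (Fin 1) (ZMod N)ˣ)]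
  rfl

lemma uniform_recover_S2 {γ : Type} {N : ℕ} [NeZero N] (c : ZMod N) (g : (ZMod N)ˣ)
    (D : ZMod N × (ZMod N)ˣ → (ZMod N)ˣ) (f : ZMod N × (ZMod N)ˣ → (ZMod N)ˣ → PMF γ) :
    ((PMF.uniformOfFintype (RecoverCoins N)).bind fun ω =>
      f (c + ω.1.1, g * ω.1.2) (D ω.1 * ω.2.1)) =
    (PMF.uniformOfFintype ((ZMod N × (ZMod N)ˣ) × (ZMod N)ˣ)).bind fun a => f a.1 a.2 := by
  rw [← uniform_bind_equiv (Equiv.funUnique (Fin 1) (RecoverCoins N)),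
    ← uniform_bind_equiv (Equiv.funUnique (Fin 1) ((ZMod N × (ZMod N)ˣ) × (ZMod N)ˣ))]
  refine (uniform_bind_recover_S2 (fun _ : Fin 1 => c) (fun _ => g) (fun _ => D) fun a z =>
    f (a 0) (z 0)).trans ?_
  exact (uniform_pi_prod_bind fun a : Fin 1 → (ZMod N × (ZMod N)ˣ) × (ZMod N)ˣ =>
    f (a 0).1 (a 0).2).symm

/-- The setup and a run of `RecoverEnc`. -/
lemma recover_bind {β : Type} (l c : ℕ)
    (f : (recoverExperiment K l c).Setup → Transcript → PMF β) :
    ((recoverExperiment K l c).setup.bind fun σ => ((recoverExperiment K l c).exec σ).bind (f σ)) =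
      (K l).bind fun k => (PMF.uniformOfFintype ((ZMod k.N)ˣ × (ZMod k.N)ˣ)).bind fun ρ =>
      (PMF.uniformOfFintype (RecoverCoins k.N)).bind fun ω =>
        f (⟨k, enc2 (enc (c : ZMod k.N) ρ.1) ρ.2⟩ : Σ k : Key, ZMod (k.N ^ 3))
          ⟨zdata (enc ((c : ZMod k.N) + ω.1.1) (ρ.1 * ω.1.2 * ω.2.2)),
            zdata (enc2 (enc ((c : ZMod k.N) + ω.1.1) (ρ.1 * ω.1.2))
              (ρ.2 ^ (enc ω.1.1 ω.1.2).val * ω.2.1)),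
            (enc (c : ZMod k.N) (ρ.1 * ω.2.2)).val⟩ := by
  have h : ∀ f : (Σ k : Key, ZMod (k.N ^ 3)) → PMF β,
      ((K l).bind fun k => (PMF.uniformOfFintype ((ZMod k.N)ˣ × (ZMod k.N)ˣ)).map fun ρ =>
        (⟨k, enc2 (enc (c : ZMod k.N) ρ.1) ρ.2⟩ : Σ k : Key, ZMod (k.N ^ 3))).bind f =
      (K l).bind fun k => (PMF.uniformOfFintype ((ZMod k.N)ˣ × (ZMod k.N)ˣ)).bind fun ρ =>
        f ⟨k, enc2 (enc (c : ZMod k.N) ρ.1) ρ.2⟩ := fun f => by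
    simp only [PMF.bind_bind, PMF.bind_map]
    rfl
  refine (h _).trans ?_
  congr 1; ext1 k; congr 1; ext1 ρ
  refine (PMF.bind_map _ _ _).trans ?_
  congr 1; ext1 ω
  simp only [Function.comp_apply, recoverEnc_enc2]

theorem recover_S1 (hK : IsKeyGen K) (c : ℕ → ℕ) :
    CompIndist (fun l => (recoverExperiment K l (c l)).idealS1 l Prog.simRecoverS1)
      fun l => (recoverExperiment K l (c l)).realS1 := by
  obtain ⟨u1, u2, u3⟩ := unitErr_error (PolyBounded.const 1)
  refine CompIndist.symm (CompIndist.of_SD u1 u2 fun l => ?_)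
  have hreal : (recoverExperiment K l (c l)).realS1 = (K l).bind fun k =>
      (PMF.uniformOfFintype ((ZMod k.N)ˣ × (ZMod k.N)ˣ)).bind fun ρ =>
      ((Tm.leaf .rnd .none).sem (unitNat k.N) k.N).bind fun v =>
      (PMF.uniformOfFintype (ZMod k.N)ˣ).bind fun b =>
        PMF.pure (Data.pair (.pair k.pkData (zdata (enc2 (enc (c l : ZMod k.N) ρ.1) ρ.2)))
          (.pair v (zdata (enc (c l : ZMod k.N) b)))) := by
    refine (recover_bind l (c l) fun σ T => PMF.pure (Data.pair (.pair ((recoverExperiment K l (c l)).pk σ)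
      ((recoverExperiment K l (c l)).input σ)) (.pair T.viewS1 (.nat T.output)))).trans ?_
    congr 1; ext1 k; congr 1; ext1 ρ
    rw [sem_rnd]
    simp only [PMF.bind_bind, PMF.pure_bind]
    exact uniform_recover_S1 _ _ fun a b =>
      PMF.pure (Data.pair (.pair k.pkData (zdata (enc2 (enc (c l : ZMod k.N) ρ.1) ρ.2)))
        (.pair (zdata (enc a.1 a.2)) (zdata (enc (c l : ZMod k.N) b))))
  have hideal : (recoverExperiment K l (c l)).idealS1 l Prog.simRecoverS1 = (K l).bind fun k =>
      (PMF.uniformOfFintype ((ZMod k.N)ˣ × (ZMod k.N)ˣ)).bind fun ρ =>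
      ((Tm.leaf .rnd .none).sem (uniformNat k.N) k.N).bind fun v =>
      (PMF.uniformOfFintype (ZMod k.N)ˣ).bind fun b =>
        PMF.pure (Data.pair (.pair k.pkData (zdata (enc2 (enc (c l : ZMod k.N) ρ.1) ρ.2)))
          (.pair v (zdata (enc (c l : ZMod k.N) b)))) := by
    have h1 : (recoverExperiment K l (c l)).idealS1 l Prog.simRecoverS1 =
        (recoverExperiment K l (c l)).setup.bind fun σ =>
        ((recoverExperiment K l (c l)).exec σ).bind fun T =>
        (Prog.simRecoverS1.out (.pair (.unary l) (.pair ((recoverExperiment K l (c l)).pk σ)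
          (.nat 0)))).bind fun v => PMF.pure
            (Data.pair (.pair ((recoverExperiment K l (c l)).pk σ)
              ((recoverExperiment K l (c l)).input σ)) (.pair v (.nat T.output))) := by
      rw [Experiment.idealS1]
      congr 1; ext1 σ
      refine (PMF.pure_bind _ _).trans ?_
      rw [PMF.bind_comm]
      rfl
    rw [h1]
    refine (recover_bind l (c l) _).trans ?_
    congr 1; ext1 k; congr 1; ext1 ρ
    rw [← Prog.out_simRecoverS1 (.unary l) (.nat 0)]
    refine Eq.trans ?_ (PMF.bind_comm (PMF.uniformOfFintype (ZMod k.N)ˣ) _ _)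
    refine (uniform_recover_S1 (c l : ZMod k.N) _ fun _ b =>
      (Prog.simRecoverS1.out (.pair (.unary l) (.pair k.pkData (.nat 0)))).bind fun v =>
      PMF.pure (Data.pair (.pair k.pkData (zdata (enc2 (enc (c l : ZMod k.N) ρ.1) ρ.2)))
        (.pair v (zdata (enc (c l : ZMod k.N) b))))).trans ?_
    rw [PMF.bind_const]
    rfl
  rw [hreal, hideal, ← u3]
  refine SD.bind_const _ fun k hk => SD.bind_const _ fun ρ _ => SD.bind_left ?_ _
  exact Tm.sd_sem k (hK.1 l k hk).1 (hK.1 l k hk).2 _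

theorem recover_S2 (hK : IsKeyGen K) (c : ℕ → ℕ) :
    CompIndist (fun l => (recoverExperiment K l (c l)).idealS2 l Prog.simRecoverS2)
      fun l => (recoverExperiment K l (c l)).realS2 := by
  obtain ⟨u1, u2, u3⟩ := unitErr_error (PolyBounded.const 2)
  refine CompIndist.symm (CompIndist.of_SD u1 u2 fun l => ?_)
  have hreal : (recoverExperiment K l (c l)).realS2 = (K l).bind fun k =>
      (PMF.uniformOfFintype ((ZMod k.N)ˣ × (ZMod k.N)ˣ)).bind fun ρ =>
      (doubleEnc (unitNat k.N) k.N).bind fun v =>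
        PMF.pure (Data.pair (.pair k.pkData (.pair k.skData
          (zdata (enc2 (enc (c l : ZMod k.N) ρ.1) ρ.2)))) v) := by
    refine (recover_bind l (c l) fun σ T => PMF.pure (Data.pair (.pair ((recoverExperiment K l (c l)).pk σ)
      (.pair ((recoverExperiment K l (c l)).sk σ) ((recoverExperiment K l (c l)).input σ)))
        T.viewS2)).trans ?_
    congr 1; ext1 k; congr 1; ext1 ρ
    rw [doubleEnc_unitNat]
    simp only [PMF.bind_bind, PMF.pure_bind]
    exact uniform_recover_S2 _ _ (fun a => ρ.2 ^ (enc a.1 a.2).val) fun a b =>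
      PMF.pure (Data.pair (.pair k.pkData (.pair k.skData
        (zdata (enc2 (enc (c l : ZMod k.N) ρ.1) ρ.2)))) (zdata (enc2 (enc a.1 a.2) b)))
  have hideal : (recoverExperiment K l (c l)).idealS2 l Prog.simRecoverS2 = (K l).bind fun k =>
      (PMF.uniformOfFintype ((ZMod k.N)ˣ × (ZMod k.N)ˣ)).bind fun ρ =>
      (doubleEnc (uniformNat k.N) k.N).bind fun v =>
        PMF.pure (Data.pair (.pair k.pkData (.pair k.skData
          (zdata (enc2 (enc (c l : ZMod k.N) ρ.1) ρ.2)))) v) := by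
    have h1 : (recoverExperiment K l (c l)).idealS2 l Prog.simRecoverS2 =
        (recoverExperiment K l (c l)).setup.bind fun σ =>
        ((recoverExperiment K l (c l)).exec σ).bind fun _ =>
        (Prog.simRecoverS2.out (.pair (.unary l) (.pair ((recoverExperiment K l (c l)).pk σ)
          (.pair ((recoverExperiment K l (c l)).sk σ) (.nat 0))))).bind fun v => PMF.pure
            (Data.pair (.pair ((recoverExperiment K l (c l)).pk σ)
              (.pair ((recoverExperiment K l (c l)).sk σ)
                ((recoverExperiment K l (c l)).input σ))) v) := by
      rw [Experiment.idealS2]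
      congr 1; ext1 σ
      rw [PMF.bind_const]
      exact PMF.pure_bind _ _
    rw [h1]
    refine (recover_bind l (c l) _).trans ?_
    congr 1; ext1 k; congr 1; ext1 ρ
    rw [PMF.bind_const, ← Prog.out_simRecoverS2 (.unary l) (.pair k.skData (.nat 0))]
    rfl
  rw [hreal, hideal, ← u3]
  refine SD.bind_const _ fun k hk => SD.bind_const _ fun ρ _ => SD.bind_left ?_ _
  exact sd_doubleEnc k (hK.1 l k hk).1 (hK.1 l k hk).2

lemma recover_failure (l c : ℕ) : (recoverExperiment K l c).failure = 0 := by
  have h : ((recoverExperiment K l c).setup.bind fun σ =>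
      ((recoverExperiment K l c).exec σ).map fun T =>
        (recoverExperiment K l c).IsResult σ T.output) = PMF.pure True := by
    refine (recover_bind l c fun σ T =>
      PMF.pure ((recoverExperiment K l c).IsResult σ T.output)).trans ?_
    have : ∀ (k : Key) (r : (ZMod k.N)ˣ),
        (dec k (((enc (c : ZMod k.N) r).val : ℕ) : ZMod (k.N ^ 2)) = (c : ZMod k.N)) = True :=
      fun k r => by rw [natCast_val_self, dec_enc, eq_self]
    simp only [recoverExperiment, this, PMF.bind_const]
  rw [Experiment.failure, h]
  simp

end Recover

end SecTopK

open SecTopK in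
theorem mainTheorem3
    (K : ℕ → PMF Key) (hK : IsKeyGen K) (hE : PaillierCPASecure K)
    (dom len : ℕ → ℕ) (hlen : ∀ l, l ≤ len l) (hlen' : PolyBounded len)
    (F : HashFamily dom len) (hF : IsPRF F) (s : ℕ) (hs : 1 ≤ s) :
    PrivatelyRealizes Instance.PolySize (secWorstExperiment K F s) ∧
      PrivatelyRealizes (ι := fun _ => ℕ) (fun _ => True) (recoverExperiment K) := by
  refine ⟨⟨Prog.simWorstS1, Prog.simWorstS2, Prog.ppt_simWorstS1, Prog.ppt_simWorstS2,
    fun I hI => ⟨compIndist_S1 hK hE hlen hlen' hF hs hI, compIndist_S2 hK hlen hF hs hI,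
      negligible_failure hK hlen hF hs hI⟩⟩, ⟨Prog.simRecoverS1, Prog.simRecoverS2,
    Prog.ppt_simRecoverS1, Prog.ppt_simRecoverS2, fun c _ => ⟨recover_S1 hK c, recover_S2 hK c, ?_⟩⟩⟩
  simp only [recover_failure]
  simpa using negligible_two_pow.const_mul 0
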